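/- Let $p$ be an odd prime and let $\mathcal G = H\rtimes\Gamma$ be a profinite group, where $H$ is a finite normal subgroup and $\Gamma\le\mathcal G$ is a subgroup topologically isomorphic to $\mathbb Z_p$. Let $\gamma$ be a topological generator of $\Gamma$, let $n\ge 0$ be such that $\gamma^{p^n}$ is central in $\mathcal G$, and put $\Gamma_0=\Gamma^{p^n}=\overline{\langle\gamma^{p^n}\rangle}$. Let $\mathbb Q_p^c$ be an algebraic closure of $\mathbb Q_p$, let $\chi$ be the character of an irreducible finite-dimensional representation of $\mathcal G$ over $\mathbb Q_p^c$ with open kernel, and let $\eta$ be an irreducible constituent of $\mathrm{res}^{\mathcal G}_H\chi$. Let $F\subseteq\mathbb Q_p^c$ be a finite extension of $\mathbb Q_p$ over which both $\chi$ and $\eta$ have realisations, let $V_\chi$ be a realisation of $\chi$ over $F$, and let $\mathcal O$ be the ring of integers of $F$. For a topological group $P$ write $\Lambda^{\mathcal O}(P)=\mathcal O[[P]]=\varprojlim\mathcal O[P/N]$ ($N$ running over the open normal subgroups), and put $R=\mathcal O[[\Gamma_0]]$. Let $\mathcal Q^F(\mathcal G)$ be the ring obtained from $\Lambda^{\mathcal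 O}(\mathcal G)$ by inverting all central regular elements; it contains $F[H]$. Put $$e_\chi=\sum_{\eta'\mid \mathrm{res}^{\mathcal G}_H\chi}\frac{\eta'(1)}{|H|}\sum_{h\in H}\eta'(h^{-1})h,\qquad w_\chi=[\mathcal G:\{g\in\mathcal G:\eta(g^{-1}hg)=\eta(h)\ \text{for all } h\in H\}],$$ where $\eta'$ runs over the distinct irreducible constituents of $\mathrm{res}^{\mathcal G}_H\chi$; the element $e_\chi$ lies in $F[H]$. Write $\zeta(A)$ for the centre of a ring $A$. There is a unique element $\gamma_\chi\in\zeta(\mathcal Q^F(\mathcal G)e_\chi)$ of the form $\gamma_\chi=gc$, with $g\in\mathcal G$, $g\equiv\gamma^{w_\chi}$ modulo $H$, and $c\in(F[H]e_\chi)^\times$, that acts trivially on $V_\chi$. Suppose that $v_p(\eta(1))=v_p(|H|)$. Then: 1. $e_\chi\in\Lambda^{\mathcal O}(\mathcal G)$, it is a central idempotent there, and $\gamma_\chi$ is a unit of $\Lambda^{\mathcal O}(\mathcal G)e_\chi$. 2. Let $\Gamma_\chi$ be the closed subgroup of $(\Lambda^{\mathcal O}(\mathcal G)e_\chi)^\times$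 topologically generated by $\gamma_\chi$. The inclusion of $\Gamma_\chi$ extends to a continuous injective homomorphism of $\mathcal O$-algebras $\Lambda^{\mathcal O}(\Gamma_\chi)\to\Lambda^{\mathcal O}(\mathcal G)e_\chi$ and, identifying $\Lambda^{\mathcal O}(\Gamma_\chi)$ with its image, $$\zeta(\Lambda^{\mathcal O}(\mathcal G)e_\chi)=\Lambda^{\mathcal O}(\Gamma_\chi).$$ 3. There is an isomorphism of $R$-orders $$\Lambda^{\mathcal O}(\mathcal G)e_\chi\simeq M_{\chi(1)\times\chi(1)}(\Lambda^{\mathcal O}(\Gamma_\chi)),$$ where $R$ acts on $\Lambda^{\mathcal O}(\Gamma_\chi)=\zeta(\Lambda^{\mathcal O}(\mathcal G)e_\chi)$ through $r\mapsto re_\chi$. 4. These are maximal $R$-orders, in $\mathcal Q^F(\mathcal G)e_\chi$ and in $M_{\chi(1)\times\chi(1)}(\mathcal Q^F(\Gamma_\chi))$ respectively, where $\mathcal Q^F(\Gamma_\chi)$ is the field of fractions of $\Lambda^{\mathcal O}(\Gamma_\chi)$. 5. As rings they are isomorphic to $M_{\chi(1)\times\chi(1)}(\mathcal O[[T]])$.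 -/

import Mathlib

open scoped Padic

noncomputable section

/-! ### Completed group algebras -/

section Completed

variable (k : Type*) [CommRing k] (G : Type*) [Group G] [TopologicalSpace G]

/-- The transition map `k[G/N] → k[G/M]` for open normal subgroups `N ≤ M`. -/
def groupAlgebraTransition {N M : OpenNormalSubgroup G} (h : N ≤ M) :
    MonoidAlgebra k (G ⧸ N.toSubgroup) →ₐ[k] MonoidAlgebra k (G ⧸ M.toSubgroup) :=
  MonoidAlgebra.mapDomainAlgHom k k
    (QuotientGroup.map N.toSubgroup M.toSubgroup (MonoidHom.id G) h)

/-- The inverse limit of the `k[G/N]`, `N` running over the open normal subgroups of `G`, as the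
subalgebra of compatible families in the product. -/
def compatibleFamilies :
    Subalgebra k (Π N : OpenNormalSubgroup G, MonoidAlgebra k (G ⧸ N.toSubgroup)) where
  carrier := {x | ∀ (N M : OpenNormalSubgroup G) (h : N ≤ M),
    groupAlgebraTransition k G h (x N) = x M}
  mul_mem' := by
    intro a b ha hb N M h
    rw [Pi.mul_apply, map_mul, ha N M h, hb N M h, Pi.mul_apply]
  add_mem' := by
    intro a b ha hb N M h
    rw [Pi.add_apply, map_add, ha N M h, hb N M h, Pi.add_apply]
  algebraMap_mem' := by
    intro r N M h
    rw [Pi.algebraMap_apply, AlgHom.commutes, Pi.algebraMap_apply]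

/-- The completed group algebra `k[[G]] = lim k[G/N]`. For `G` profinite and `k = 𝒪` the ring of
integers of a finite extension of `ℚ_p` this is the Iwasawa algebra `Λ^𝒪(G)`. -/
def CompletedGroupAlgebra : Type _ := compatibleFamilies k G

namespace CompletedGroupAlgebra

instance : Ring (CompletedGroupAlgebra k G) := inferInstanceAs (Ring (compatibleFamilies k G))

instance : Algebra k (CompletedGroupAlgebra k G) :=
  inferInstanceAs (Algebra k (compatibleFamilies k G))

/-- The inverse limit topology: the coarsest topology for which all coefficients of all components
are continuous (for `G` compact, each `G/N` is finite, so this is the limit of the usual topologies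
on the finite free `k`-modules `k[G/N]`). -/
instance [TopologicalSpace k] : TopologicalSpace (CompletedGroupAlgebra k G) :=
  TopologicalSpace.induced
    (fun x (N : OpenNormalSubgroup G) (g : G ⧸ N.toSubgroup) => (x.1 N).coeff g) inferInstance

/-- The canonical map `G → k[[G]]`. -/
def of : G →* CompletedGroupAlgebra k G where
  toFun g := ⟨fun N => MonoidAlgebra.of k (G ⧸ N.toSubgroup) (QuotientGroup.mk g), by
    intro N M h
    simp only [groupAlgebraTransition, MonoidAlgebra.of_apply,
      MonoidAlgebra.mapDomainAlgHom_apply, MonoidAlgebra.mapDomain_single]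
    rfl⟩
  map_one' := Subtype.ext <| funext fun N => by
    change MonoidAlgebra.of k (G ⧸ N.toSubgroup) (1 : G ⧸ N.toSubgroup) = 1
    exact map_one _
  map_mul' a b := Subtype.ext <| funext fun N => by
    change MonoidAlgebra.of k (G ⧸ N.toSubgroup)
      ((QuotientGroup.mk a : G ⧸ N.toSubgroup) * QuotientGroup.mk b) = _
    exact map_mul _ _ _

variable {G} {G' : Type*} [Group G'] [TopologicalSpace G']

/-- The inverse image of an open normal subgroup under a continuous homomorphism. -/
def comapOpenNormal (φ : G →* G') (hφ : Continuous φ) (N : OpenNormalSubgroup G') :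
    OpenNormalSubgroup G where
  toOpenSubgroup := N.toOpenSubgroup.comap φ hφ
  isNormal' := Subgroup.Normal.comap N.isNormal' φ

/-- Functoriality: the homomorphism `k[[G]] → k[[G']]` induced by a continuous homomorphism
`G → G'`. -/
def map (φ : G →* G') (hφ : Continuous φ) :
    CompletedGroupAlgebra k G →ₐ[k] CompletedGroupAlgebra k G' :=
  (AlgHom.codRestrict
    (AlgHom.pi fun N : OpenNormalSubgroup G' =>
      ((MonoidAlgebra.mapDomainAlgHom k k
        (QuotientGroup.map (comapOpenNormal φ hφ N).toSubgroup N.toSubgroup φ le_rfl)).comp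
        (Pi.evalAlgHom k _ (comapOpenNormal φ hφ N))).comp (compatibleFamilies k G).val)
    (compatibleFamilies k G') (by
      intro x N M h
      have hx := x.2 (comapOpenNormal φ hφ N) (comapOpenNormal φ hφ M) (fun g hg => h hg)
      simp only [AlgHom.pi_apply, AlgHom.comp_apply, Pi.evalAlgHom_apply, Subalgebra.coe_val]
      rw [← hx]
      simp only [groupAlgebraTransition]
      rw [← AlgHom.comp_apply, ← AlgHom.comp_apply]
      congr 1
      ext g
      induction g using QuotientGroup.induction_on with
      | H g =>
        simp only [AlgHom.comp_apply, MonoidAlgebra.mapDomainAlgHom_apply,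
          MonoidAlgebra.mapDomain_single]
        rfl))

end CompletedGroupAlgebra

end Completed

/-! ### Corners and central scalars -/

section Corner

/-- `r ↦ r • e` makes `eAe` an algebra over `R` if `A` is one. -/
instance {R A : Type*} [CommRing R] [Ring A] [Algebra R A] {e : A} (he : IsIdempotentElem e) :
    Algebra R he.Corner where
  smul r x := ⟨r • x.1, r • x.1, by
    have h := (Subsemigroup.mem_corner_iff he).mp x.2
    simp only [mul_smul_comm, smul_mul_assoc, h.1, h.2]⟩
  algebraMap :=
    { toFun := fun r => ⟨r • e, r • e, by
        simp only [mul_smul_comm, smul_mul_assoc, he.eq]⟩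
      map_one' := Subtype.ext (one_smul R e)
      map_mul' := fun r s => Subtype.ext (by
        change (r * s) • e = (r • e) * (s • e)
        rw [smul_mul_smul_comm, he.eq])
      map_zero' := Subtype.ext (zero_smul R e)
      map_add' := fun r s => Subtype.ext (add_smul r s e) }
  commutes' r x := Subtype.ext (by
    have h := (Subsemigroup.mem_corner_iff he).mp x.2
    change (r • e) * x.1 = x.1 * (r • e)
    rw [smul_mul_assoc, mul_smul_comm, h.1, h.2])
  smul_def' r x := Subtype.ext (by
    have h := (Subsemigroup.mem_corner_iff he).mp x.2
    change r • x.1 = (r • e) * x.1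
    rw [smul_mul_assoc, h.1])

instance {A : Type*} [Ring A] [TopologicalSpace A] {e : A} (he : IsIdempotentElem e) :
    TopologicalSpace he.Corner :=
  inferInstanceAs (TopologicalSpace (Subsemigroup.corner e))

/-- The homomorphism `eAe → f(e)Bf(e)` induced by an algebra homomorphism `f : A → B`. -/
def cornerMap {R A B : Type*} [CommRing R] [Ring A] [Algebra R A] [Ring B] [Algebra R B]
    (f : A →ₐ[R] B) {e : A} (he : IsIdempotentElem e) :
    he.Corner →ₐ[R] (he.map f).Corner where
  toFun x := ⟨f x.1, f x.1, by
    have h := (Subsemigroup.mem_corner_iff he).mp x.2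
    change f e * f x.1 * f e = f x.1
    rw [← map_mul, ← map_mul, h.1, h.2]⟩
  map_one' := rfl
  map_mul' x y := Subtype.ext (map_mul f x.1 y.1)
  map_zero' := Subtype.ext (map_zero f)
  map_add' x y := Subtype.ext (map_add f x.1 y.1)
  commutes' r := Subtype.ext (map_smul f r e)

end Corner

/-! ### Total rings of fractions -/

section Fractions

/-- The multiplicative set of central regular elements of a ring. -/
def centralRegular (A : Type*) [Ring A] : Submonoid A :=
  Submonoid.center A ⊓ nonZeroDivisors A

instance (A : Type*) [Ring A] : OreLocalization.OreSet (centralRegular A) where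
  ore_right_cancel a b s h := ⟨s, by
    have hs := Submonoid.mem_center_iff.mp s.2.1
    rw [← hs a, ← hs b, h]⟩
  oreNum r _ := r
  oreDenom _ s := s
  ore_eq r s := (Submonoid.mem_center_iff.mp s.2.1 r).symm

/-- The total ring of fractions of `A`, obtained by inverting all central regular elements. -/
abbrev TotalFractions (A : Type*) [Ring A] : Type _ := OreLocalization (centralRegular A) A

/-- The canonical map from `A` to its total ring of fractions, as a homomorphism of `R`-algebras. -/
def toFractions (R : Type*) {A : Type*} [CommRing R] [Ring A] [Algebra R A] :
    A →ₐ[R] TotalFractions A where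
  toRingHom := OreLocalization.numeratorRingHom
  commutes' _ := rfl

variable {k : Type*} [CommRing k] [IsDomain k] {G : Type*} [Group G] [TopologicalSpace G]

theorem algebraMap_mem_centralRegular {a : k} (ha : a ≠ 0) :
    algebraMap k (CompletedGroupAlgebra k G) a ∈ centralRegular (CompletedGroupAlgebra k G) := by
  have key : ∀ x : CompletedGroupAlgebra k G,
      algebraMap k (CompletedGroupAlgebra k G) a * x = 0 → x = 0 := by
    intro x hx
    rw [← Algebra.smul_def] at hx
    refine Subtype.ext (funext fun N => ?_)
    have h1 : a • (x.1 N) = 0 := congrFun (congrArg Subtype.val hx) N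
    ext g
    have h2 : a * (x.1 N).coeff g = 0 := by
      have := congrArg (fun y => y.coeff g) h1
      simpa using this
    exact (mul_eq_zero.mp h2).resolve_left ha
  refine ⟨Submonoid.mem_center_iff.mpr fun x => (Algebra.commutes a x).symm, ?_⟩
  refine ⟨key, fun x hx => key x ?_⟩
  rw [Algebra.commutes]
  exact hx

variable (k) (K : Type*) [Field K] [Algebra k K] [IsFractionRing k K] (G)

/-- The image of `k` in the total ring of fractions of `k[[G]]`, landing in the centre. -/
def scalarToCenter : k →+* Subring.center (TotalFractions (CompletedGroupAlgebra k G)) :=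
  (algebraMap k (TotalFractions (CompletedGroupAlgebra k G))).codRestrict _ fun a =>
    Subring.mem_center_iff.mpr fun x => (Algebra.commutes a x).symm

/-- The embedding of `K = Frac k` into the total ring of fractions of `k[[G]]` (with central
image) extending `k → k[[G]]`. -/
def fractionScalars : K →+* TotalFractions (CompletedGroupAlgebra k G) :=
  (Subring.center (TotalFractions (CompletedGroupAlgebra k G))).subtype.comp
    (IsLocalization.lift (M := nonZeroDivisors k) (S := K) (g := scalarToCenter k G) (by
      intro a
      let s : centralRegular (CompletedGroupAlgebra k G) :=
        ⟨_, algebraMap_mem_centralRegular (G := G) (nonZeroDivisors.ne_zero a.2)⟩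
      have hu : IsUnit (algebraMap k (TotalFractions (CompletedGroupAlgebra k G)) a) :=
        OreLocalization.numerator_isUnit s
      obtain ⟨u, hu⟩ := hu
      have hc : ∀ x, x * (u : TotalFractions (CompletedGroupAlgebra k G)) = u * x := fun x => by
        rw [hu]; exact (Algebra.commutes _ x).symm
      refine IsUnit.of_mul_eq_one ⟨(u⁻¹ : (TotalFractions (CompletedGroupAlgebra k G))ˣ),
        Subring.mem_center_iff.mpr fun x => ?_⟩ (Subtype.ext ?_)
      · rw [Units.mul_inv_eq_iff_eq_mul, mul_assoc, hc, ← mul_assoc, Units.inv_mul, one_mul]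
      · change algebraMap k (TotalFractions (CompletedGroupAlgebra k G)) a * _ = 1
        rw [← hu]; exact Units.mul_inv u))

/-- The ring homomorphism `K[H] → Frac(k[[G]])`, for a subgroup `H` of `G`, that is the inclusion on
`H` and extends the embedding of the scalars `K`. -/
def groupAlgebraToFractions (H : Subgroup G) :
    MonoidAlgebra K H →+* TotalFractions (CompletedGroupAlgebra k G) :=
  MonoidAlgebra.liftNCRingHom (fractionScalars k G K)
    (((toFractions k : CompletedGroupAlgebra k G →ₐ[k] _) : _ →* _).comp
      ((CompletedGroupAlgebra.of k G).comp H.subtype))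
    fun _ _ => (Subring.mem_center_iff.mp (Subtype.prop (p := (· ∈ Subring.center _)) _) _).symm

end Fractions

/-! ### Central group elements and orders -/

section Orders

variable (k : Type*) [CommRing k] {G : Type*} [Group G] [TopologicalSpace G]

/-- For a subgroup `Z` of the centre of `G`, the ring `k[[G]]` is an algebra over the commutative
ring `k[[Z]]` via the map induced by the inclusion. -/
def centralInclusion (Z : Subgroup (Subgroup.center G)) :
    CompletedGroupAlgebra k Z →ₐ[k] CompletedGroupAlgebra k G :=
  CompletedGroupAlgebra.map k ((Subgroup.center G).subtype.comp Z.subtype)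
    (continuous_subtype_val.comp continuous_subtype_val)

instance (Z : Subgroup (Subgroup.center G)) : CommRing (CompletedGroupAlgebra k Z) where
  __ := (inferInstance : Ring (CompletedGroupAlgebra k Z))
  mul_comm x y := Subtype.ext (funext fun N => by
    let _ : CommGroup (Z ⧸ N.toSubgroup) :=
      { (inferInstance : Group (Z ⧸ N.toSubgroup)) with
        mul_comm := fun a b => by
          induction a using QuotientGroup.induction_on with
          | H a =>
            induction b using QuotientGroup.induction_on with
            | H b => exact congrArg QuotientGroup.mk (Subtype.ext (Subtype.ext
                (Subgroup.mem_center_iff.mp b.1.2 a.1.1))) }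
    exact mul_comm (x.1 N) (y.1 N))

instance (Z : Subgroup (Subgroup.center G)) :
    Algebra (CompletedGroupAlgebra k Z) (CompletedGroupAlgebra k G) :=
  (centralInclusion k Z).toRingHom.toAlgebra' (by
    intro r x
    refine Subtype.ext (funext fun N => ?_)
    have key : ∀ (M : OpenNormalSubgroup Z) (f : Z ⧸ M.toSubgroup →* G ⧸ N.toSubgroup)
        (_ : ∀ z : Z, f (QuotientGroup.mk z) = QuotientGroup.mk (z : G))
        (a : MonoidAlgebra k (Z ⧸ M.toSubgroup)) (b : MonoidAlgebra k (G ⧸ N.toSubgroup)),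
        Commute (MonoidAlgebra.mapDomain f a) b := by
      intro M f hf a b
      induction a using MonoidAlgebra.induction_linear with
      | zero => rw [MonoidAlgebra.mapDomain_zero]; exact Commute.zero_left b
      | add a a' ha ha' => rw [MonoidAlgebra.mapDomain_add]; exact ha.add_left ha'
      | single z c =>
        induction b using MonoidAlgebra.induction_linear with
        | zero => exact Commute.zero_right _
        | add b b' hb hb' => exact hb.add_right hb'
        | single g d =>
          induction z using QuotientGroup.induction_on with
          | H z =>
            induction g using QuotientGroup.induction_on with
            | H g =>
              rw [MonoidAlgebra.mapDomain_single, hf, Commute, SemiconjBy,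
                MonoidAlgebra.single_mul_single, MonoidAlgebra.single_mul_single, mul_comm c d]
              congr 1
              exact congrArg QuotientGroup.mk (Subgroup.mem_center_iff.mp z.1.2 g).symm
    exact key _ _ (fun _ => rfl) _ _)

/-- `S` is an `R`-order in `A`, where `R` is a domain: nonzero elements of `R` are invertible in
`A` (so that `A` is an algebra over the field of fractions of `R`), and `S` is an `R`-subalgebra
that is finitely generated as an `R`-module and spans `A` over the field of fractions. -/
structure IsROrder (R : Type*) {A : Type*} [CommRing R] [Ring A] [Algebra R A]
    (S : Subalgebra R A) : Prop where
  isUnit_algebraMap : ∀ r ∈ nonZeroDivisors R, IsUnit (algebraMap R A r)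
  fg : (Subalgebra.toSubmodule S).FG
  exists_smul_mem : ∀ a : A, ∃ r ∈ nonZeroDivisors R, r • a ∈ S

/-- A maximal `R`-order in `A`: an order not properly contained in another one. -/
def IsMaximalROrder (R : Type*) {A : Type*} [CommRing R] [Ring A] [Algebra R A]
    (S : Subalgebra R A) : Prop :=
  IsROrder R S ∧ ∀ T : Subalgebra R A, IsROrder R T → S ≤ T → T = S

end Orders

/-! ### Characters -/

section Characters

variable {K : Type*} [Field K] {G : Type*} [Group G] [TopologicalSpace G]

/-- The representation `ρ` over `F` has open kernel and affords the character `χ`, where `χ` takes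
values in an extension `K` of `F`; in other words `ρ` is a realisation of `χ` over `F`. -/
def Representation.Affords {F V : Type*} [Field F] [Algebra F K] [AddCommGroup V] [Module F V]
    (ρ : Representation F G V) (χ : G → K) : Prop :=
  IsOpen (MonoidHom.ker ρ : Set G) ∧ ∀ g, algebraMap F K (ρ.character g) = χ g

/-- `χ ∈ Irr_K(G)`: the character of an irreducible finite-dimensional representation over `K` with
open kernel. -/
def IsIrrCharacter (χ : G → K) : Prop :=
  ∃ (d : ℕ) (ρ : Representation K G (Fin d → K)), ρ.IsIrreducible ∧ ρ.Affords χ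

/-- `χ` has a realisation over the subfield `F` of `K`. -/
def IsRealisableOver (F : Type*) [Field F] [Algebra F K] (χ : G → K) : Prop :=
  ∃ (d : ℕ) (ρ : Representation F G (Fin d → F)), ρ.Affords χ

/-- The usual inner product of class functions on a finite group. -/
def characterInner {H : Type*} [Group H] [Fintype H] (φ ψ : H → K) : K :=
  (Fintype.card H : K)⁻¹ * ∑ h, φ h * ψ h⁻¹

/-- `e(η) = (η(1)/|H|) ∑ η(h⁻¹) h`. -/
def characterIdempotent {H : Type*} [Group H] [Fintype H] (η : H → K) : MonoidAlgebra K H :=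
  ∑ h, MonoidAlgebra.single h (η 1 / (Fintype.card H : K) * η h⁻¹)

variable (H : Subgroup G) [Fintype H]

/-- `η` is an irreducible constituent of the restriction of `χ` to `H`. -/
def IsConstituent (χ : G → K) (η : H → K) : Prop :=
  IsIrrCharacter η ∧ characterInner (fun h : H => χ h) η ≠ 0

/-- `e_χ = ∑ e(η)`, the sum over the (finitely many) irreducible constituents `η` of the
restriction of `χ` to `H`. -/
def chiIdempotent (χ : G → K) : MonoidAlgebra K H :=
  ∑ᶠ (η : H → K) (_ : IsConstituent H χ η), characterIdempotent η

/-- `St(η) = {g ∈ G : η^g = η}`, where `η^g(h) = η(g⁻¹hg)`. -/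
def characterStabilizer [H.Normal] (η : H → K) : Subgroup G where
  carrier := {g | ∀ h : H, η (MulAut.conjNormal g⁻¹ h) = η h}
  one_mem' h := by simp
  mul_mem' {a b} ha hb h := by
    rw [mul_inv_rev, map_mul, MulAut.mul_apply, hb, ha]
  inv_mem' {a} ha h := by
    rw [← ha (MulAut.conjNormal a⁻¹⁻¹ h), ← MulAut.mul_apply, ← map_mul]
    simp

/-- The defining property of `γ_χ`, for an element `x` of the total ring of fractions `Q` of
`k[[G]]`. Here `K = Frac k`, `ρ` is a realisation of `χ` over `K`, `e ∈ K[H]` is the idempotent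
`e_χ` and `w = w_χ`. The conditions are: `x` is a central element of `Qe`, it has the form `x = gc`
with `g ≡ γ^w` modulo `H` and `c` a unit of `K[H]e`, and `gc` acts trivially on the space of `ρ`. -/
def IsGammaChi (k : Type*) [CommRing k] [IsDomain k] [Algebra k K] [IsFractionRing k K]
    {V : Type*} [AddCommGroup V] [Module K V] (ρ : Representation K G V)
    (e : MonoidAlgebra K H) (γ : G) (w : ℕ)
    (x : TotalFractions (CompletedGroupAlgebra k G)) : Prop :=
  x * groupAlgebraToFractions k G K H e = x ∧
  (∀ q, Commute x (q * groupAlgebraToFractions k G K H e)) ∧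
  ∃ (g : G) (c : MonoidAlgebra K H),
    (QuotientGroup.mk g : G ⧸ H) = QuotientGroup.mk (γ ^ w) ∧
    c * e = c ∧
    (∃ d : MonoidAlgebra K H, d * e = d ∧ c * d = e ∧ d * c = e) ∧
    x = toFractions k (CompletedGroupAlgebra.of k G g) * groupAlgebraToFractions k G K H c ∧
    ρ g ∘ₗ Representation.asAlgebraHom (ρ.comp H.subtype) c = LinearMap.id

end Characters

/-- The closed subgroup topologically generated by `u`: the smallest closed subgroup containing
`u`. -/
def closedSubgroupGenerated {M : Type*} [Group M] [TopologicalSpace M] (u : M) : Subgroup M :=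
  sInf {P : Subgroup M | IsClosed (P : Set M) ∧ u ∈ P}

/-- The ring of integers of a finite extension `F` of `ℚ_p` inside the algebraic closure. -/
abbrev padicIntegers {p : ℕ} [Fact p.Prime] (F : IntermediateField ℚ_[p] (PadicAlgCl p)) :
    Subalgebra ℤ_[p] F := integralClosure ℤ_[p] F

instance {p : ℕ} [Fact p.Prime] (F : IntermediateField ℚ_[p] (PadicAlgCl p))
    [FiniteDimensional ℚ_[p] F] : IsFractionRing (padicIntegers F) F :=
  integralClosure.isFractionRing_of_finite_extension ℚ_[p] F

/-- The closed subgroup topologically generated by a central element `z`, as a subgroup of the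
centre. For `z = γ ^ p ^ n` this is `Γ₀ = Γ^{p^n}`. -/
abbrev centralClosure {G : Type*} [Group G] [TopologicalSpace G] [IsTopologicalGroup G]
    {z : G} (hz : z ∈ Subgroup.center G) : Subgroup (Subgroup.center G) :=
  (Subgroup.zpowers (⟨z, hz⟩ : Subgroup.center G)).topologicalClosure

end

set_option linter.unusedSectionVars false

noncomputable section

/-! ### Power series and the elements `(1 + X) ^ p ^ a - 1` -/

section PowerSeriesEvaluation

open scoped PowerSeries PowerSeries.WithPiTopology
open IsLocalRing

/-! The valuation hypothesis puts `η(1)/|H|` in `𝒪`, and this makes Fourier inversion integral on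
the block of `η`. Let `σ` on `W` realise `η` over `F`. The map `f ↦ ∑ (η(1)/|H|) tr(f σ(h⁻¹)) h` is
a multiplicative section of `F[H] → End W` with image `F[H]e(η)` (`asAlgebraHom_fourierInv`,
`fourierInv_mul`). With respect to a basis of a stable lattice (`exists_integral_basis`) it sends
elementary matrices to matrix units `E_ab` with coefficients in `𝒪`.

Let `w = w_χ`, the length of the orbit of `η` under `γ`. By Skolem–Noether `γ^w` acts on `F[H]e(η) =
End W` by an inner automorphism. Corrected by an element of `F[H]`, it commutes on `e(η)V` with `H`
and `γ^w`, hence is a scalar there (`exists_res_eq`). So `γ^w` acts on `V` through `F[H]`, the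
restriction of `χ` to `H` is the multiplicity-free sum of the `w` conjugates of `η`
(`character_res`), and `χ(1) = wη(1)`. There is a unique `c` in `F[H]e_χ` acting as `γ^{-w}`; its
coefficients are `η(1)/|H|` times values of `χ`, so again integral, and `γ_χ = γ^w c`. These
integral data form a `CliffordUnits`, obtained in `exists_cliffordUnits`.

The conjugates of `e(η)` by `γ^i`, `0 ≤ i < w`, are orthogonal with sum `e_χ`, so the elements `γ^i
E_ab γ^{-j}` are a full set of `χ(1) × χ(1)` matrix units of `Λe_χ` (`unitE_mul_unitE`,
`sum_unitE`). At a finite level, sandwiching between two copies of `E_aa` kills the terms `hγ^i`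
with `w ∤ i`, while `γ^{ws}` can be traded for `γ_χ^s` times an element of `𝒪[H]`. Since `E_aa 𝒪[H]
E_aa = 𝒪 E_aa`, the corner consists of polynomials in `γ_χ` (`exists_aeval_corner`), and so does the
centralizer of the matrix units (`exists_aeval_of_commute`).

The limit is reached by evaluating power series at `γ_χ - 1`. As `c` has finite order, `γ_χ + (1 -
e_χ)` has `p`-power order at each finite level, and Weierstrass division by `(1 + X)^{p^a} - 1`
defines the evaluation (`exists_eval`). Compactness of `𝒪[[X]]` reduces surjectivity onto the centre
to finite levels. Weierstrass preparation reduces injectivity to the independence of the powers of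
`γ_χ`, which lie over different powers of `γ`. Thus the centre is `𝒪[[X]]`
(`CliffordUnits.exists_powerSeries`), it is also `𝒪[[Γ_χ]]`
(`exists_algHom_closedSubgroupGenerated`), and `Λe_χ` is a matrix ring over it
(`nonempty_algEquiv_matrix_center`).

For the orders, some power of `γ_χ` is `e_χ` times an element of `Γ₀`, so the centre is finite over
`R` (`range_fg`). An element of a larger order has matrix entries integral over the centre, which is
integrally closed, so matrix rings over it are maximal (`isMaximalROrder_range_of_matrix`). -/

theorem PowerSeries.compactSpace_withPiTopology {k : Type*} [TopologicalSpace k] [CompactSpace k] :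
    CompactSpace k⟦X⟧ :=
  inferInstanceAs (CompactSpace ((Unit →₀ ℕ) → k))

variable {k : Type*} [CommRing k]

/-- The polynomial `(1 + X) ^ p ^ a - 1`. -/
def omegaPoly (k : Type*) [CommRing k] (p a : ℕ) : Polynomial k := (1 + Polynomial.X) ^ p ^ a - 1

theorem aeval_omegaPoly {B : Type*} [Ring B] [Algebra k B] (p a : ℕ) (x : B) :
    Polynomial.aeval x (omegaPoly k p a) = (1 + x) ^ p ^ a - 1 := by
  simp [omegaPoly]

theorem omegaPoly_coe (p a : ℕ) :
    ((omegaPoly k p a : Polynomial k) : k⟦X⟧) = (1 + PowerSeries.X) ^ p ^ a - 1 := by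
  simp [omegaPoly]

/-- The intermediate binomial coefficients of `p ^ a` are divisible by `p` and the constant term
vanishes. Distinguishedness is what permits Weierstrass division by this polynomial. -/
theorem omegaPoly_isDistinguishedAt [Nontrivial k] {p : ℕ} [hp : Fact p.Prime] {I : Ideal k}
    (hpI : (p : k) ∈ I) (a : ℕ) : (omegaPoly k p a).IsDistinguishedAt I := by
  have hpos : 0 < p ^ a := pow_pos hp.out.pos a
  have hmon : (omegaPoly k p a).Monic := by
    have h1 : ((1 + Polynomial.X : Polynomial k) ^ p ^ a).Monic := by
      rw [add_comm]; exact (Polynomial.monic_X_add_C (1 : k)).pow _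
    refine h1.sub_of_left ?_
    rw [Polynomial.degree_one, Polynomial.degree_eq_natDegree h1.ne_zero, add_comm,
      ← Polynomial.C_1, (Polynomial.monic_X_add_C (1 : k)).natDegree_pow,
      Polynomial.natDegree_X_add_C, mul_one]
    exact_mod_cast hpos
  have hdeg : (omegaPoly k p a).natDegree ≤ p ^ a := by
    unfold omegaPoly
    compute_degree
  refine ⟨⟨fun {n} hn => ?_⟩, hmon⟩
  rcases Nat.eq_zero_or_pos n with rfl | hn0
  · simp [omegaPoly, Polynomial.coeff_zero_eq_eval_zero]
  · have hlt : n < p ^ a := hn.trans_le hdeg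
    have : (omegaPoly k p a).coeff n = ((p ^ a).choose n : k) := by
      rw [omegaPoly, Polynomial.coeff_sub, Polynomial.coeff_one_add_X_pow, Polynomial.coeff_one,
        if_neg hn0.ne', sub_zero]
    rw [this]
    obtain ⟨c, hc⟩ : p ∣ (p ^ a).choose n := hp.out.dvd_choose_pow hn0.ne' hlt.ne
    rw [hc, Nat.cast_mul]
    exact I.mul_mem_right _ hpI

section Weierstrass

variable [IsLocalRing k] [IsAdicComplete (maximalIdeal k) k] {p : ℕ} [Fact p.Prime]

/-- Modulo `(1 + X) ^ p ^ a - 1` every power series is a polynomial of bounded degree. The weak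
bound `≤ p ^ a` is enough for the compactness argument below. -/
theorem exists_omegaPoly_division (hpk : (p : k) ∈ maximalIdeal k)
    (a : ℕ) (f : k⟦X⟧) :
    ∃ (q : k⟦X⟧) (r : Polynomial k), f = (omegaPoly k p a : k⟦X⟧) * q + r ∧ r.natDegree ≤ p ^ a := by
  have H := (omegaPoly_isDistinguishedAt hpk a).isWeierstrassDivisorAt'
  have h := H.isWeierstrassDivisionAt_div_mod f
  have := h.eq_mul_add
  set r := H.mod f
  -- The Weierstrass remainder is divided once more, now as a polynomial by a monic one, so that the
  -- degree bound is elementary.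
  refine ⟨H.div f + (r /ₘ omegaPoly k p a : Polynomial k), r %ₘ omegaPoly k p a, ?_, ?_⟩
  · conv_lhs => rw [this, ← Polynomial.modByMonic_add_div r (q := omegaPoly k p a)]
    push_cast
    ring
  · refine (Polynomial.natDegree_modByMonic_le r (omegaPoly_isDistinguishedAt hpk a).monic).trans ?_
    unfold omegaPoly
    compute_degree

/-- No continuity is needed: both maps kill `(1 + X) ^ p ^ a - 1`, so only the polynomial remainder
of Weierstrass division matters. -/
theorem PowerSeries.algHom_eq_of_X (hpk : (p : k) ∈ maximalIdeal k)
    {B : Type*} [Ring B] [Algebra k B] {φ ψ : k⟦X⟧ →ₐ[k] B}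
    (h : φ PowerSeries.X = ψ PowerSeries.X) {a : ℕ} (ha : (1 + φ PowerSeries.X) ^ p ^ a = 1) :
    φ = ψ := by
  have hpoly : ∀ (χ : k⟦X⟧ →ₐ[k] B) (P : Polynomial k), χ P = Polynomial.aeval (χ PowerSeries.X) P :=
    fun χ P => by
      have : χ.comp (Polynomial.coeToPowerSeries.algHom k) = Polynomial.aeval (χ PowerSeries.X) := by
        ext; simp
      simpa using DFunLike.congr_fun this P
  ext f
  obtain ⟨q, r, rfl, -⟩ := exists_omegaPoly_division hpk a f
  simp only [map_add, map_mul, hpoly, ← h, aeval_omegaPoly, ha, sub_self, zero_mul]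

/-- Evaluation of power series at `X = b - 1`, where `b ^ p ^ a = 1`. -/
theorem PowerSeries.exists_algHom_X (hpk : (p : k) ∈ maximalIdeal k)
    {B : Type*} [Ring B] [Algebra k B] {b : B} {a : ℕ}
    (hb : b ^ p ^ a = 1) : ∃ φ : k⟦X⟧ →ₐ[k] B, φ PowerSeries.X = b - 1 := by
  have H := omegaPoly_isDistinguishedAt (k := k) hpk a
  let ψ : (Polynomial k ⧸ Ideal.span {omegaPoly k p a}) →ₐ[k] B :=
    Ideal.Quotient.liftₐ _ (Polynomial.aeval (b - 1)) fun x hx => by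
      obtain ⟨y, rfl⟩ := Ideal.mem_span_singleton'.1 hx
      rw [map_mul, aeval_omegaPoly, add_sub_cancel, hb, sub_self, mul_zero]
  -- For a distinguished polynomial, polynomials and power series have the same quotient, so
  -- polynomial evaluation transfers to power series.
  refine ⟨(ψ.comp H.algEquivQuotient.symm.toAlgHom).comp (Ideal.Quotient.mkₐ k _), ?_⟩
  have : H.algEquivQuotient (Ideal.Quotient.mk _ Polynomial.X) =
      Ideal.Quotient.mk _ (PowerSeries.X : k⟦X⟧) := by
    simp
  change ψ (H.algEquivQuotient.symm (Ideal.Quotient.mk _ PowerSeries.X)) = _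
  rw [← this, AlgEquiv.symm_apply_apply]
  change Polynomial.aeval (b - 1) (Polynomial.X : Polynomial k) = _
  simp

variable [TopologicalSpace k] [IsTopologicalRing k] [CompactSpace k] [T2Space k]

/-- A linear form on power series that factors through a finite quotient is continuous. -/
theorem PowerSeries.continuous_linear_of_omegaPoly (hpk : (p : k) ∈ maximalIdeal k)
    (a : ℕ) (L : k⟦X⟧ →ₗ[k] k)
    (hL : ∀ q : k⟦X⟧, L ((omegaPoly k p a : k⟦X⟧) * q) = 0) : Continuous L := by
  have := PowerSeries.compactSpace_withPiTopology (k := k)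
  -- The division map (quotient, coefficients of the remainder) is a continuous surjection from a
  -- compact space, hence a quotient map. Composed with it, `L` is a finite linear expression in the
  -- coefficients of the remainder.
  let Θ : k⟦X⟧ × (Fin (p ^ a + 1) → k) → k⟦X⟧ := fun x =>
    (omegaPoly k p a : k⟦X⟧) * x.1 + ∑ i, PowerSeries.C (x.2 i) * PowerSeries.X ^ (i : ℕ)
  have hC : Continuous (PowerSeries.C : k → k⟦X⟧) := PowerSeries.WithPiTopology.continuous_C
  have hΘ : Continuous Θ := by
    refine (continuous_const.mul continuous_fst).add (continuous_finsetSum _ fun i _ => ?_)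
    exact (hC.comp ((continuous_apply i).comp continuous_snd)).mul continuous_const
  have hsurj : Function.Surjective Θ := by
    intro f
    obtain ⟨q, r, rfl, hr⟩ := exists_omegaPoly_division hpk a f
    refine ⟨(q, fun i => r.coeff i), ?_⟩
    have : (r : k⟦X⟧) = ∑ i : Fin (p ^ a + 1), PowerSeries.C (r.coeff i) * PowerSeries.X ^ (i : ℕ) := by
      conv_lhs => rw [r.as_sum_range_C_mul_X_pow' (Nat.lt_succ_of_le hr)]
      rw [Finset.sum_range (fun i => Polynomial.C (r.coeff i) * Polynomial.X ^ i),
        ← Polynomial.coeToPowerSeries.ringHom_apply, map_sum]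
      exact Finset.sum_congr rfl fun i _ => by simp
    simp only [Θ, this]
  have hq : Topology.IsQuotientMap Θ := hΘ.isClosedMap.isQuotientMap hΘ hsurj
  rw [hq.continuous_iff]
  have : L ∘ Θ = fun x => ∑ i : Fin (p ^ a + 1), x.2 i * L (PowerSeries.X ^ (i : ℕ)) := by
    funext x
    simp only [Θ, Function.comp_apply, map_add, hL, zero_add, map_sum]
    refine Finset.sum_congr rfl fun i _ => ?_
    rw [← PowerSeries.smul_eq_C_mul, map_smul, smul_eq_mul]
  rw [this]
  fun_prop

end Weierstrass

/-- A ring homomorphism from power series over a complete discrete valuation ring is injective if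
it is injective on polynomials. -/
theorem PowerSeries.injective_of_polynomial [IsDomain k] [IsDiscreteValuationRing k]
    [IsAdicComplete (maximalIdeal k) k] {B : Type*} [Ring B] (φ : k⟦X⟧ →+* B)
    (h : ∀ P : Polynomial k, φ P = 0 → P = 0) : Function.Injective φ := by
  rw [injective_iff_map_eq_zero]
  intro f hf
  by_contra hf0
  obtain ⟨ϖ, hϖ⟩ := IsDiscreteValuationRing.exists_irreducible k
  -- Taking out the largest power of the uniformizer dividing all coefficients leaves a series with
  -- nonzero reduction, to which Weierstrass preparation applies.
  obtain ⟨n, g, rfl, hg⟩ : ∃ (n : ℕ) (g : k⟦X⟧), f = PowerSeries.C (ϖ ^ n) * g ∧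
      g.map (residue k) ≠ 0 := by
    obtain ⟨i, hi⟩ : ∃ i, f.coeff i ≠ 0 := by
      by_contra hcon; push Not at hcon; exact hf0 (PowerSeries.ext (by simpa using hcon))
    obtain ⟨N, u, hu⟩ := IsDiscreteValuationRing.eq_unit_mul_pow_irreducible hi hϖ
    -- The valuation `N` of a single nonzero coefficient bounds the exponents to be searched.
    have hbd : ∀ n, (∀ j, ϖ ^ n ∣ f.coeff j) → n ≤ N := by
      intro n hn
      by_contra hlt
      have h1 := hn i
      rw [hu] at h1
      have h2 : ϖ ^ (N + 1) ∣ ϖ ^ N :=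
        (pow_dvd_pow ϖ (not_le.mp hlt)).trans ((Units.dvd_mul_left).mp h1)
      rw [pow_dvd_pow_iff hϖ.ne_zero hϖ.not_isUnit] at h2
      omega
    classical
    set n := Nat.findGreatest (fun n => ∀ j, ϖ ^ n ∣ f.coeff j) N
    have hn : ∀ j, ϖ ^ n ∣ f.coeff j :=
      Nat.findGreatest_spec (P := fun n => ∀ j, ϖ ^ n ∣ f.coeff j) (Nat.zero_le N) (by simp)
    choose c hc using hn
    refine ⟨n, PowerSeries.mk c, by ext j; rw [PowerSeries.coeff_C_mul, PowerSeries.coeff_mk, hc], fun h0 => ?_⟩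
    have hn1 : ∀ j, ϖ ^ (n + 1) ∣ f.coeff j := by
      intro j
      have h1 : residue k (c j) = 0 := by simpa using congrArg (PowerSeries.coeff j) h0
      rw [residue_eq_zero_iff, hϖ.maximalIdeal_eq, Ideal.mem_span_singleton] at h1
      rw [hc, pow_succ]
      exact mul_dvd_mul_left _ h1
    have := Nat.le_findGreatest (P := fun n => ∀ j, ϖ ^ n ∣ f.coeff j) (hbd _ hn1) hn1
    exact absurd this (by simp [n])
  obtain ⟨P, w, hPw⟩ := PowerSeries.exists_isWeierstrassFactorization hg
  obtain ⟨u, hu⟩ := hPw.isUnit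
  -- The kernel contains a polynomial associated to `f`: multiply by the inverse of the Weierstrass
  -- unit.
  have hz : φ ((Polynomial.C (ϖ ^ n) * P : Polynomial k) : k⟦X⟧) = 0 := by
    have : ((Polynomial.C (ϖ ^ n) * P : Polynomial k) : k⟦X⟧) =
        PowerSeries.C (ϖ ^ n) * g * (u⁻¹ : (k⟦X⟧)ˣ) := by
      rw [hPw.eq_mul, ← hu, mul_assoc, mul_assoc, Units.mul_inv, mul_one]
      simp
    rw [this, map_mul, hf, zero_mul]
  have := h _ hz
  rcases mul_eq_zero.mp this with h1 | h1
  · exact pow_ne_zero n hϖ.ne_zero (Polynomial.C_eq_zero.mp h1)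
  · exact hPw.isDistinguishedAt.monic.ne_zero h1

/-- Variant of `PowerSeries.injective_of_polynomial` in terms of polynomials in `1 + X`. -/
theorem PowerSeries.injective_of_aeval [IsDomain k] [IsDiscreteValuationRing k]
    [IsAdicComplete (maximalIdeal k) k] {B : Type*} [Ring B] [Algebra k B] (φ : k⟦X⟧ →ₐ[k] B)
    (h : ∀ Q : Polynomial k, Polynomial.aeval (1 + φ PowerSeries.X) Q = 0 → Q = 0) :
    Function.Injective φ := by
  refine PowerSeries.injective_of_polynomial φ.toRingHom fun P hP => ?_
  have h1 : Polynomial.aeval (1 + φ PowerSeries.X) (P.comp (Polynomial.X - 1)) = 0 := by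
    rw [Polynomial.aeval_comp]
    simp only [map_sub, Polynomial.aeval_X, map_one, add_sub_cancel_left]
    have : φ.comp (Polynomial.coeToPowerSeries.algHom k) = Polynomial.aeval (φ PowerSeries.X) := by
      ext; simp
    rw [← this]
    simpa using hP
  have h2 := congrArg (fun Q => Polynomial.comp Q (Polynomial.X + 1)) (h _ h1)
  simpa [Polynomial.comp_assoc] using h2

end PowerSeriesEvaluation

end

noncomputable section

/-! ### Topology of completed group algebras -/

namespace CompletedGroupAlgebra

section Levels

variable {k : Type*} [CommRing k] {G : Type*} [Group G] [TopologicalSpace G]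

/-- The projection of `k[[G]]` onto `k[G/N]`. -/
def proj (N : OpenNormalSubgroup G) :
    CompletedGroupAlgebra k G →ₐ[k] MonoidAlgebra k (G ⧸ N.toSubgroup) :=
  (Pi.evalAlgHom k _ N).comp (compatibleFamilies k G).val

theorem ext_proj {x y : CompletedGroupAlgebra k G} (h : ∀ N, proj N x = proj N y) : x = y :=
  Subtype.ext (funext h)

theorem transition_proj {N M : OpenNormalSubgroup G} (h : N ≤ M) (x : CompletedGroupAlgebra k G) :
    groupAlgebraTransition k G h (proj N x) = proj M x :=
  x.2 N M h

theorem proj_of (N : OpenNormalSubgroup G) (g : G) :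
    proj N (of k G g) = MonoidAlgebra.single (QuotientGroup.mk g : G ⧸ N.toSubgroup) 1 := rfl

theorem proj_eq_of_le {N M : OpenNormalSubgroup G} (h : N ≤ M) {x y : CompletedGroupAlgebra k G}
    (hxy : proj N x = proj N y) : proj M x = proj M y := by
  rw [← transition_proj h, hxy, transition_proj h]

/-- A compatible family of algebra homomorphisms to the `k[G/N]` defines an algebra homomorphism to
`k[[G]]`. -/
def lift {B : Type*} [Ring B] [Algebra k B]
    (φ : ∀ N : OpenNormalSubgroup G, B →ₐ[k] MonoidAlgebra k (G ⧸ N.toSubgroup))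
    (hφ : ∀ (N M : OpenNormalSubgroup G) (h : N ≤ M),
      (groupAlgebraTransition k G h).comp (φ N) = φ M) :
    B →ₐ[k] CompletedGroupAlgebra k G :=
  AlgHom.codRestrict (AlgHom.pi φ) (compatibleFamilies k G) fun b N M h =>
    DFunLike.congr_fun (hφ N M h) b

theorem proj_lift {B : Type*} [Ring B] [Algebra k B]
    (φ : ∀ N : OpenNormalSubgroup G, B →ₐ[k] MonoidAlgebra k (G ⧸ N.toSubgroup))
    (hφ) (N : OpenNormalSubgroup G) (b : B) : proj N (lift φ hφ b) = φ N b := rfl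

variable [TopologicalSpace k]

theorem continuous_iff {X : Type*} [TopologicalSpace X] {f : X → CompletedGroupAlgebra k G} :
    Continuous f ↔ ∀ (N : OpenNormalSubgroup G) (g : G ⧸ N.toSubgroup),
      Continuous fun x => (proj N (f x)).coeff g := by
  rw [continuous_induced_rng, continuous_pi_iff]
  simp_rw [continuous_pi_iff]
  rfl

theorem continuous_coeff_proj (N : OpenNormalSubgroup G) (g : G ⧸ N.toSubgroup) :
    Continuous fun x : CompletedGroupAlgebra k G => (proj N x).coeff g :=
  continuous_iff.mp continuous_id N g

instance [T2Space k] : T2Space (CompletedGroupAlgebra k G) := by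
  refine T2Space.of_injective_continuous
    (f := fun (x : CompletedGroupAlgebra k G) (N : OpenNormalSubgroup G) (g : G ⧸ N.toSubgroup) =>
      (proj N x).coeff g) ?_ ?_
  · intro x y h
    refine ext_proj fun N => ?_
    ext g
    exact congrFun (congrFun h N) g
  · exact continuous_pi fun N => continuous_pi fun g => continuous_coeff_proj N g

instance [TotallyDisconnectedSpace k] : TotallyDisconnectedSpace (CompletedGroupAlgebra k G) := by
  refine ⟨isTotallyDisconnected_of_image
    (f := fun (x : CompletedGroupAlgebra k G) (N : OpenNormalSubgroup G) (g : G ⧸ N.toSubgroup) =>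
      (proj N x).coeff g) ?_ ?_ (isTotallyDisconnected_of_totallyDisconnectedSpace _)⟩
  · exact (continuous_pi fun N => continuous_pi fun g => continuous_coeff_proj N g).continuousOn
  · intro x y h
    refine ext_proj fun N => ?_
    ext g
    exact congrFun (congrFun h N) g

/-- Compactness of `G` makes each `G/N` finite, so a coefficient of a product is a finite sum of
products of coefficients. -/
instance [IsTopologicalRing k] [IsTopologicalGroup G] [CompactSpace G] :
    IsTopologicalRing (CompletedGroupAlgebra k G) where
  continuous_add := continuous_iff.mpr fun N g => by
    simp only [map_add, MonoidAlgebra.coeff_add, Finsupp.add_apply]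
    exact ((continuous_coeff_proj N g).comp continuous_fst).add
      ((continuous_coeff_proj N g).comp continuous_snd)
  continuous_neg := continuous_iff.mpr fun N g => by
    simp only [map_neg, MonoidAlgebra.coeff_neg, Finsupp.neg_apply]
    exact (continuous_coeff_proj N g).neg
  continuous_mul := continuous_iff.mpr fun N g => by
    have : Finite (G ⧸ N.toSubgroup) := Subgroup.quotient_finite_of_isOpen _ N.isOpen'
    have := Fintype.ofFinite (G ⧸ N.toSubgroup)
    simp only [map_mul, MonoidAlgebra.coeff_mul_apply_left]
    have hsum : ∀ x : CompletedGroupAlgebra k G × CompletedGroupAlgebra k G,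
        ((proj N x.1).coeff.sum fun a r => r * (proj N x.2).coeff (a⁻¹ * g)) =
          ∑ a, (proj N x.1).coeff a * (proj N x.2).coeff (a⁻¹ * g) :=
      fun x => Finsupp.sum_fintype _ _ fun _ => zero_mul _
    simp_rw [hsum]
    exact continuous_finsetSum _ fun a _ => ((continuous_coeff_proj N a).comp continuous_fst).mul
      ((continuous_coeff_proj N _).comp continuous_snd)

theorem continuous_of [IsTopologicalGroup G] : Continuous (of k G) := by
  refine continuous_iff.mpr fun N g => ?_
  simp only [proj_of]
  have : DiscreteTopology (G ⧸ N.toSubgroup) := QuotientGroup.discreteTopology N.isOpen'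
  exact (continuous_of_discreteTopology
    (f := fun y : G ⧸ N.toSubgroup => (MonoidAlgebra.single y (1 : k)).coeff g)).comp
    QuotientGroup.continuous_mk

/-- An element of `k[[G]]` is in the image of a continuous map from a compact space if it is so
at every finite level. -/
theorem mem_range_of_forall_proj [T2Space k] {X : Type*} [TopologicalSpace X] [CompactSpace X]
    {φ : X → CompletedGroupAlgebra k G} (hφ : Continuous φ) {x : CompletedGroupAlgebra k G}
    (h : ∀ N, ∃ ξ, proj N (φ ξ) = proj N x) : x ∈ Set.range φ := by
  have hcl : ∀ N, IsClosed {ξ | proj N (φ ξ) = proj N x} := by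
    intro N
    have : {ξ | proj N (φ ξ) = proj N x} =
        ⋂ g, {ξ | (proj N (φ ξ)).coeff g = (proj N x).coeff g} := by
      ext ξ
      simp only [Set.mem_ofPred_eq, Set.mem_iInter]
      exact ⟨fun h g => by rw [h], fun h => by ext g; exact h g⟩
    rw [this]
    exact isClosed_iInter fun g => isClosed_eq (continuous_iff.mp hφ N g) continuous_const
  have : Nonempty (OpenNormalSubgroup G) :=
    ⟨{ toOpenSubgroup := ⊤, isNormal' := inferInstanceAs (⊤ : Subgroup G).Normal }⟩
  obtain ⟨ξ, hξ⟩ := IsCompact.nonempty_iInter_of_directed_nonempty_isCompact_isClosed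
    (fun N => {ξ | proj N (φ ξ) = proj N x})
    (fun N M => ⟨N ⊓ M, fun ξ hξ => proj_eq_of_le inf_le_left hξ,
      fun ξ hξ => proj_eq_of_le inf_le_right hξ⟩) h (fun N => (hcl N).isCompact) hcl
  exact ⟨ξ, ext_proj fun N => Set.mem_iInter.mp hξ N⟩

end Levels

section Evaluation

open scoped PowerSeries PowerSeries.WithPiTopology
open IsLocalRing

variable {k : Type*} [CommRing k] {G : Type*} [Group G] [TopologicalSpace G]
  [TopologicalSpace k] [IsTopologicalRing k] [CompactSpace k] [T2Space k]
  [IsLocalRing k] [IsAdicComplete (maximalIdeal k) k] {p : ℕ} [Fact p.Prime]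

/-- Evaluation of power series at a topologically unipotent element of `k[[G]]`. -/
theorem exists_eval (hpk : (p : k) ∈ maximalIdeal k) (v : CompletedGroupAlgebra k G)
    (hv : ∀ N, ∃ a, (proj N v) ^ p ^ a = 1) :
    ∃ φ : k⟦X⟧ →ₐ[k] CompletedGroupAlgebra k G, φ PowerSeries.X = v - 1 ∧ Continuous φ := by
  choose a ha using hv
  choose φ hφ using fun N => PowerSeries.exists_algHom_X hpk (ha N)
  -- The evaluations at the finite levels are compatible because an algebra map is determined by its
  -- value at `X` when `1 + X` goes to an element of `p`-power order.
  have hcomp : ∀ (N M : OpenNormalSubgroup G) (h : N ≤ M),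
      (groupAlgebraTransition k G h).comp (φ N) = φ M := by
    intro N M h
    have hX : (groupAlgebraTransition k G h).comp (φ N) PowerSeries.X = φ M PowerSeries.X := by
      rw [AlgHom.comp_apply, hφ, hφ, map_sub, map_one, transition_proj h]
    refine PowerSeries.algHom_eq_of_X hpk hX (a := a M) ?_
    rw [hX, hφ, add_sub_cancel, ha]
  refine ⟨lift φ hcomp, ext_proj fun N => ?_, continuous_iff.mpr fun N g => ?_⟩
  · rw [proj_lift, hφ, map_sub, map_one]
  -- Each coefficient at level `N` is a linear form that vanishes on the multiples of `(1 + X) ^ p ^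
  -- a N - 1`.
  · let L : k⟦X⟧ →ₗ[k] k :=
      { toFun := fun f => (φ N f).coeff g
        map_add' := by simp
        map_smul' := by simp }
    refine PowerSeries.continuous_linear_of_omegaPoly hpk (a N) L fun q => ?_
    change (φ N (_ * q)).coeff g = 0
    rw [map_mul, omegaPoly_coe, map_sub, map_pow, map_add, map_one, hφ, add_sub_cancel, ha, sub_self,
      zero_mul]
    rfl

end Evaluation

section Procyclic

open scoped PowerSeries PowerSeries.WithPiTopology
open IsLocalRing

variable {P : Type*} [Group P] [TopologicalSpace P] [IsTopologicalGroup P]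

theorem exists_zpow_mem_of_dense {G : Type*} [Group G] [TopologicalSpace G] [IsTopologicalGroup G]
    {t y : G} (hy : y ∈ (Subgroup.zpowers t).topologicalClosure) (N : OpenNormalSubgroup G) :
    ∃ i : ℤ, (QuotientGroup.mk y : G ⧸ N.toSubgroup) = QuotientGroup.mk (t ^ i) := by
  have hopen : IsOpen ((fun x => y⁻¹ * x) ⁻¹' (N : Set G)) :=
    N.isOpen'.preimage (continuous_const_mul y⁻¹)
  obtain ⟨x, hx, i, rfl⟩ := mem_closure_iff.mp hy _ hopen (by
    change y⁻¹ * y ∈ N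
    rw [inv_mul_cancel]; exact one_mem N)
  exact ⟨i, QuotientGroup.eq.mpr hx⟩

/-- In the finite group `G/N` every integral power is also a power with natural exponent. -/
theorem exists_pow_mem_of_dense {G : Type*} [Group G] [TopologicalSpace G] [IsTopologicalGroup G]
    [CompactSpace G] {t y : G} (hy : y ∈ (Subgroup.zpowers t).topologicalClosure)
    (N : OpenNormalSubgroup G) :
    ∃ i : ℕ, (QuotientGroup.mk y : G ⧸ N.toSubgroup) = QuotientGroup.mk (t ^ i) := by
  have : Finite (G ⧸ N.toSubgroup) := Subgroup.quotient_finite_of_isOpen _ N.isOpen'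
  obtain ⟨i, hi⟩ := exists_zpow_mem_of_dense hy N
  have : (QuotientGroup.mk y : G ⧸ N.toSubgroup) ∈
      Subgroup.zpowers (QuotientGroup.mk t : G ⧸ N.toSubgroup) := ⟨i, by rw [hi]; rfl⟩
  rw [← mem_powers_iff_mem_zpowers] at this
  obtain ⟨j, hj⟩ := this
  exact ⟨j, by rw [← hj]; rfl⟩

/-- This separates finitely many group elements at one finite level, where their linear independence
becomes visible. -/
theorem exists_openNormalSubgroup_avoiding [CompactSpace P] [T2Space P] [TotallyDisconnectedSpace P]
    (s : Finset P) (hs : 1 ∉ s) : ∃ N : OpenNormalSubgroup P, ∀ x ∈ s, x ∉ N := by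
  obtain ⟨N, hN⟩ := ProfiniteGrp.exist_openNormalSubgroup_sub_open_nhds_of_one
    (U := (s : Set P)ᶜ) s.finite_toSet.isClosed.isOpen_compl (by simpa using hs)
  exact ⟨N, fun x hx hxN => hN hxN hx⟩

/-- The Iwasawa algebra of a procyclic pro-`p` group that is infinite is a power series ring. -/
theorem exists_bijective_powerSeries [CompactSpace P] [T2Space P] [TotallyDisconnectedSpace P]
    {k : Type*} [CommRing k] [IsDomain k]
    [TopologicalSpace k] [IsTopologicalRing k] [CompactSpace k] [T2Space k]
    [IsDiscreteValuationRing k] [IsAdicComplete (maximalIdeal k) k] {p : ℕ} [Fact p.Prime]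
    (hpk : (p : k) ∈ maximalIdeal k) {t : P} (ht : (Subgroup.zpowers t).topologicalClosure = ⊤)
    (htp : ∀ N : OpenNormalSubgroup P, ∃ a, t ^ p ^ a ∈ N) (hinf : ∀ i : ℕ, t ^ i = 1 → i = 0) :
    ∃ φ : k⟦X⟧ →ₐ[k] CompletedGroupAlgebra k P,
      φ PowerSeries.X = of k P t - 1 ∧ Continuous φ ∧ Function.Bijective φ := by
  obtain ⟨φ, hφ, hcont⟩ := exists_eval hpk (of k P t) fun N => by
    obtain ⟨a, ha⟩ := htp N
    refine ⟨a, ?_⟩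
    rw [← map_pow, ← map_pow, proj_of, (QuotientGroup.eq_one_iff (N := N.toSubgroup) _).mpr ha]
    rfl
  have hpow : ∀ i : ℕ, φ ((1 + PowerSeries.X) ^ i) = of k P (t ^ i) := by
    intro i
    rw [map_pow, map_add, map_one, hφ, add_sub_cancel, map_pow]
  refine ⟨φ, hφ, hcont, PowerSeries.injective_of_aeval φ fun Q hQ => ?_, fun x => ?_⟩
  · rw [hφ, add_sub_cancel] at hQ
    classical
    -- At a level where `1, t, …, t ^ deg Q` are distinct, the coefficients of `Q` can be read off
    -- from its value at `t`.
    obtain ⟨N, hN⟩ := exists_openNormalSubgroup_avoiding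
      ((Finset.Icc 1 Q.natDegree).image fun i => t ^ i) (by
        simp only [Finset.mem_image, Finset.mem_Icc, not_exists, not_and]
        intro i hi h
        have := hinf i h
        omega)
    have hinj : ∀ i ≤ Q.natDegree, ∀ j ≤ Q.natDegree, i ≤ j →
        (QuotientGroup.mk (t ^ i) : P ⧸ N.toSubgroup) = QuotientGroup.mk (t ^ j) → i = j := by
      intro i hi j hj hij h
      by_contra hne
      refine hN (t ^ (j - i)) (Finset.mem_image.mpr ⟨j - i, by simp; omega, rfl⟩) ?_
      have := QuotientGroup.eq.mp h
      rwa [← zpow_natCast, ← zpow_natCast, ← zpow_neg, ← zpow_add,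
        show -(i : ℤ) + j = ((j - i : ℕ) : ℤ) by omega, zpow_natCast] at this
    ext i
    rw [Polynomial.coeff_zero]
    by_cases hi : i ≤ Q.natDegree
    · have h1 := congrArg (fun x => (proj N x).coeff (QuotientGroup.mk (t ^ i))) hQ
      simp only [Polynomial.aeval_eq_sum_range, map_sum, map_smul, ← map_pow, proj_of,
        MonoidAlgebra.coeff_sum, MonoidAlgebra.coeff_smul, MonoidAlgebra.coeff_single,
        Finsupp.coe_finsetSum, Finset.sum_apply, Finsupp.smul_apply, map_zero,
        MonoidAlgebra.coeff_zero, Finsupp.coe_zero, Pi.zero_apply] at h1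
      rw [Finset.sum_eq_single i] at h1
      · simpa using h1
      · intro j hj hji
        rw [Finsupp.single_apply, if_neg, smul_zero]
        intro h
        rcases le_total i j with hij | hij
        · exact hji (hinj i hi j (by simpa [Nat.lt_succ_iff] using hj) hij h.symm).symm
        · exact hji (hinj j (by simpa [Nat.lt_succ_iff] using hj) i hi hij h)
      · intro hi'
        exact absurd (Finset.mem_range.mpr (Nat.lt_succ_of_le hi)) hi'
    · exact Polynomial.coeff_eq_zero_of_natDegree_lt (not_le.mp hi)
  · have := PowerSeries.compactSpace_withPiTopology (k := k)
    -- By compactness only finite levels matter, and these are spanned by the powers of `t`, the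
    -- images of `(1 + X) ^ i`.
    refine mem_range_of_forall_proj hcont fun N => ?_
    generalize proj N x = y
    induction y using MonoidAlgebra.induction_linear with
    | zero => exact ⟨0, by simp⟩
    | add y z hy hz =>
      obtain ⟨f, rfl⟩ := hy
      obtain ⟨g, rfl⟩ := hz
      exact ⟨f + g, by simp⟩
    | single g c =>
      induction g using QuotientGroup.induction_on with
      | H g =>
        obtain ⟨i, hi⟩ := exists_pow_mem_of_dense (t := t) (y := g) (by rw [ht]; trivial) N
        refine ⟨c • (1 + PowerSeries.X) ^ i, ?_⟩
        rw [map_smul, hpow, map_smul, proj_of, hi]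
        simp

end Procyclic

end CompletedGroupAlgebra

end

noncomputable section

/-! ### Absolutely irreducible representations of finite groups -/

namespace Representation

section Fourier

variable {F : Type*} [Field F] [CharZero F] {H : Type*} [Group H] [Fintype H]
  {W : Type*} [AddCommGroup W] [Module F W] [FiniteDimensional F W]

/-- Every endomorphism commuting with the group action is a scalar. -/
def HasScalarCommutant {F G W : Type*} [Field F] [Monoid G] [AddCommGroup W] [Module F W]
    (σ : Representation F G W) : Prop :=
  Nontrivial W ∧ ∀ f : Module.End F W, (∀ g, Commute f (σ g)) → ∃ c : F, f = c • 1

variable (σ : Representation F H W)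

/-- The average commutes with `H`, so it is a scalar by hypothesis, and the scalar is found by
taking traces. -/
theorem sum_conj_eq_smul_one (hσ : HasScalarCommutant σ) (X : Module.End F W) :
    ∑ h, σ h * X * σ h⁻¹ =
      ((Fintype.card H : F) * LinearMap.trace F W X / Module.finrank F W) • 1 := by
  have := hσ.1
  obtain ⟨c, hc⟩ := hσ.2 (∑ h, σ h * X * σ h⁻¹) fun g => by
    have hg : σ g * (∑ h, σ h * X * σ h⁻¹) * σ g⁻¹ = ∑ h, σ h * X * σ h⁻¹ := by
      rw [Finset.mul_sum, Finset.sum_mul]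
      refine Fintype.sum_equiv (Equiv.mulLeft g) _ _ fun h => ?_
      simp only [Equiv.coe_mulLeft, mul_inv_rev, map_mul, mul_assoc]
    have h1 := congrArg (· * σ g) hg
    simp only [mul_assoc] at h1
    rw [← map_mul, inv_mul_cancel, map_one, mul_one] at h1
    simp only [Commute, SemiconjBy, mul_assoc]
    exact h1.symm
  rw [hc]
  congr 1
  have ht := congrArg (LinearMap.trace F W) hc
  rw [map_sum, map_smul, LinearMap.trace_one, smul_eq_mul] at ht
  have hd : (Module.finrank F W : F) ≠ 0 := Nat.cast_ne_zero.mpr Module.finrank_pos.ne'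
  rw [eq_div_iff hd, ← ht]
  have : ∀ h ∈ Finset.univ, LinearMap.trace F W (σ h * X * σ h⁻¹) = LinearMap.trace F W X := by
    intro h _
    rw [LinearMap.trace_mul_comm, ← mul_assoc, ← map_mul, inv_mul_cancel, map_one, one_mul]
  rw [Finset.sum_congr rfl this]
  simp

/-- The inverse Fourier transform `End W → F[H]`. -/
def fourierInv : Module.End F W →ₗ[F] MonoidAlgebra F H where
  toFun f := ∑ h, MonoidAlgebra.single h
    ((Module.finrank F W : F) / Fintype.card H * LinearMap.trace F W (f * σ h⁻¹))
  map_add' f g := by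
    simp only [add_mul, map_add, mul_add, MonoidAlgebra.single_add, Finset.sum_add_distrib]
  map_smul' c f := by
    rw [RingHom.id_apply, Finset.smul_sum]
    refine Finset.sum_congr rfl fun h _ => ?_
    rw [MonoidAlgebra.smul_single, smul_mul_assoc, map_smul, smul_eq_mul, smul_eq_mul]
    ring_nf

theorem fourierInv_apply (f : Module.End F W) :
    fourierInv σ f = ∑ h, MonoidAlgebra.single h
      ((Module.finrank F W : F) / Fintype.card H * LinearMap.trace F W (f * σ h⁻¹)) := rfl

variable {σ}

/-- Fourier inversion: apply the averaging identity to suitable rank-one operators and sum over a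
basis. -/
theorem asAlgebraHom_fourierInv (hσ : HasScalarCommutant σ) (f : Module.End F W) :
    asAlgebraHom σ (fourierInv σ f) = f := by
  have := hσ.1
  let b := Module.finBasis F W
  ext v
  have hd : (Module.finrank F W : F) ≠ 0 := Nat.cast_ne_zero.mpr Module.finrank_pos.ne'
  have hH : (Fintype.card H : F) ≠ 0 := Nat.cast_ne_zero.mpr Fintype.card_ne_zero
  -- The operator `x ↦ b_j^*(f x) v`; averaging it and evaluating at `b_j` produces the `j`-th
  -- coordinate of `f v`.
  let X : Fin (Module.finrank F W) → Module.End F W := fun j => ((b.coord j).comp f).smulRight v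
  have htr : ∀ j, LinearMap.trace F W (X j) = b.coord j (f v) := fun j => by
    simp [X, LinearMap.trace_smulRight]
  have hsum : ∀ j, ∑ h, (b.coord j (f (σ h⁻¹ (b j)))) • σ h v =
      ((Fintype.card H : F) * b.coord j (f v) / Module.finrank F W) • b j := by
    intro j
    have := DFunLike.congr_fun (sum_conj_eq_smul_one σ hσ (X j)) (b j)
    rw [htr, LinearMap.sum_apply] at this
    simpa [X] using this
  rw [fourierInv_apply, map_sum, LinearMap.sum_apply]
  simp only [asAlgebraHom_single, LinearMap.smul_apply]
  calc ∑ h, ((Module.finrank F W : F) / Fintype.card H * LinearMap.trace F W (f * σ h⁻¹)) • σ h v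
      = ((Module.finrank F W : F) / Fintype.card H) •
          ∑ j, ∑ h, (b.coord j (f (σ h⁻¹ (b j)))) • σ h v := by
        rw [Finset.sum_comm, Finset.smul_sum]
        refine Finset.sum_congr rfl fun h _ => ?_
        rw [← Finset.sum_smul, smul_smul, LinearMap.trace_eq_matrix_trace F b, Matrix.trace]
        simp [LinearMap.toMatrix_apply]
    _ = f v := by
        simp_rw [hsum]
        rw [Finset.smul_sum]
        conv_rhs => rw [← b.sum_repr (f v)]
        refine Finset.sum_congr rfl fun j _ => ?_
        rw [smul_smul]
        congr 1
        rw [Module.Basis.coord_apply]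
        field_simp

theorem fourierInv_single_mul (g : H) (f : Module.End F W) :
    fourierInv σ (σ g * f) = MonoidAlgebra.single g 1 * fourierInv σ f := by
  rw [fourierInv_apply, fourierInv_apply, Finset.mul_sum]
  refine (Fintype.sum_equiv (Equiv.mulLeft g) _ _ fun h => ?_).symm
  have key : LinearMap.trace F W (σ g * f * σ (h⁻¹ * g⁻¹)) = LinearMap.trace F W (f * σ h⁻¹) := by
    rw [LinearMap.trace_mul_comm, ← mul_assoc, ← map_mul σ, inv_mul_cancel_right,
      LinearMap.trace_mul_comm]
  rw [MonoidAlgebra.single_mul_single, one_mul, Equiv.coe_mulLeft, mul_inv_rev, key]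

theorem fourierInv_mul_single (g : H) (f : Module.End F W) :
    fourierInv σ (f * σ g) = fourierInv σ f * MonoidAlgebra.single g 1 := by
  rw [fourierInv_apply, fourierInv_apply, Finset.sum_mul]
  refine (Fintype.sum_equiv (Equiv.mulRight g) _ _ fun h => ?_).symm
  rw [MonoidAlgebra.single_mul_single, mul_one, Equiv.coe_mulRight, mul_inv_rev, mul_assoc f,
    ← map_mul σ, mul_inv_cancel_left]

theorem fourierInv_asAlgebraHom_mul (x : MonoidAlgebra F H) (f : Module.End F W) :
    fourierInv σ (asAlgebraHom σ x * f) = x * fourierInv σ f := by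
  induction x using MonoidAlgebra.induction_linear with
  | zero => simp
  | add x y hx hy => rw [map_add, add_mul, map_add, hx, hy, add_mul]
  | single g c =>
    rw [asAlgebraHom_single, smul_mul_assoc, map_smul, fourierInv_single_mul, ← smul_mul_assoc,
      MonoidAlgebra.smul_single, smul_eq_mul, mul_one]

theorem fourierInv_mul_asAlgebraHom (x : MonoidAlgebra F H) (f : Module.End F W) :
    fourierInv σ (f * asAlgebraHom σ x) = fourierInv σ f * x := by
  induction x using MonoidAlgebra.induction_linear with
  | zero => simp
  | add x y hx hy => rw [map_add, mul_add, map_add, hx, hy, mul_add]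
  | single g c =>
    rw [asAlgebraHom_single, mul_smul_comm, map_smul, fourierInv_mul_single, ← mul_smul_comm,
      MonoidAlgebra.smul_single, smul_eq_mul, mul_one]

/-- The inverse transform is linear for multiplication by the group algebra and a section of the
action; writing `f` as the action of its inverse transform gives multiplicativity. -/
theorem fourierInv_mul (hσ : HasScalarCommutant σ) (f g : Module.End F W) :
    fourierInv σ (f * g) = fourierInv σ f * fourierInv σ g := by
  conv_lhs => rw [← asAlgebraHom_fourierInv hσ f, fourierInv_asAlgebraHom_mul]

theorem fourierInv_asAlgebraHom (x : MonoidAlgebra F H) :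
    fourierInv σ (asAlgebraHom σ x) = x * fourierInv σ 1 := by
  simpa using fourierInv_asAlgebraHom_mul x (1 : Module.End F W)

theorem fourierInv_asAlgebraHom' (x : MonoidAlgebra F H) :
    fourierInv σ (asAlgebraHom σ x) = fourierInv σ 1 * x := by
  simpa using fourierInv_mul_asAlgebraHom x (1 : Module.End F W)

theorem fourierInv_one_commute (x : MonoidAlgebra F H) : Commute (fourierInv σ 1) x :=
  (fourierInv_asAlgebraHom' x).symm.trans (fourierInv_asAlgebraHom x)

theorem fourierInv_one (σ : Representation F H W) :
    fourierInv σ 1 = characterIdempotent σ.character := by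
  rw [fourierInv_apply, characterIdempotent]
  simp only [one_mul, character, map_one, LinearMap.trace_one]

theorem fourierInv_injective (hσ : HasScalarCommutant σ) : Function.Injective (fourierInv σ) :=
  Function.LeftInverse.injective (asAlgebraHom_fourierInv hσ)

end Fourier

section Schur

open scoped Classical in
-- In characteristic zero the norm of a character is the dimension of the space of
-- self-intertwiners. The resulting criterion involves only the character, so it is insensitive to
-- the field of realisation.
theorem hasScalarCommutant_iff {F : Type*} [Field F] [CharZero F] {H : Type*} [Group H] [Fintype H]
    {W : Type*} [AddCommGroup W] [Module F W] [FiniteDimensional F W] (σ : Representation F H W) :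
    HasScalarCommutant σ ↔
      (Nat.card H : F)⁻¹ * ∑ h, σ.character h * σ.character h⁻¹ = 1 := by
  have : Invertible (Nat.card H : F) := invertibleOfNonzero (Nat.cast_ne_zero.mpr Nat.card_pos.ne')
  rw [card_inv_mul_sum_char_mul_char_eq_finrank, Nat.cast_eq_one]
  constructor
  · rintro ⟨_, h⟩
    refine finrank_eq_one (⟨1, fun g => by rfl⟩ : IntertwiningMap σ σ) ?_ ?_
    · intro h0
      have := congrArg IntertwiningMap.toLinearMap h0
      exact one_ne_zero this
    · intro w
      obtain ⟨c, hc⟩ := h w.toLinearMap fun g => w.isIntertwining' g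
      exact ⟨c, IntertwiningMap.ext hc.symm⟩
  · intro h
    have hone : (⟨1, fun g => by rfl⟩ : IntertwiningMap σ σ) ≠ 0 := by
      intro h0
      have h1 : (1 : Module.End F W) = 0 := congrArg IntertwiningMap.toLinearMap h0
      have hW : Subsingleton W := ⟨fun a b => by
        rw [← Module.End.one_apply (R := F) a, ← Module.End.one_apply (R := F) b, h1]; rfl⟩
      have : Subsingleton (IntertwiningMap σ σ) :=
        ⟨fun f g => IntertwiningMap.ext (LinearMap.ext fun x => Subsingleton.elim _ _)⟩
      rw [Module.finrank_zero_of_subsingleton] at h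
      exact zero_ne_one h
    refine ⟨?_, fun f hf => ?_⟩
    · by_contra hW
      rw [not_nontrivial_iff_subsingleton] at hW
      exact hone (IntertwiningMap.ext (LinearMap.ext fun x => Subsingleton.elim _ _))
    · obtain ⟨c, hc⟩ := (finrank_eq_one_iff_of_nonzero' _ hone).mp h ⟨f, fun g => hf g⟩
      exact ⟨c, (congrArg IntertwiningMap.toLinearMap hc).symm⟩

theorem IsIrreducible.hasScalarCommutant {K : Type*} [Field K] [IsAlgClosed K] {G : Type*} [Group G]
    {W : Type*} [AddCommGroup W] [Module K W] [FiniteDimensional K W] (σ : Representation K G W)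
    [IsIrreducible σ] : HasScalarCommutant σ := by
  constructor
  · by_contra hW
    rw [not_nontrivial_iff_subsingleton] at hW
    have : (⊥ : Subrepresentation σ) = ⊤ := by
      ext x
      have : x = 0 := Subsingleton.elim _ _
      subst this
      exact ⟨fun _ => zero_mem (⊤ : Subrepresentation σ).toSubmodule,
        fun _ => zero_mem (⊥ : Subrepresentation σ).toSubmodule⟩
    exact bot_ne_top this
  · intro f hf
    obtain ⟨c, hc⟩ := (algebraMap_intertwiningMap_bijective_of_isAlgClosed (ρ := σ)).2
      ⟨f, fun g => hf g⟩
    exact ⟨c, (congrArg IntertwiningMap.toLinearMap hc).symm⟩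

/-- Absolute irreducibility depends only on the character. -/
theorem HasScalarCommutant.of_character_eq {F K : Type*} [Field F] [Field K] [CharZero F]
    [CharZero K] [Algebra F K] {G : Type*} [Group G] (N : Subgroup G) [N.Normal] [Finite (G ⧸ N)]
    {V W : Type*} [AddCommGroup V] [Module F V] [FiniteDimensional F V]
    [AddCommGroup W] [Module K W] [FiniteDimensional K W]
    {ρ : Representation F G V} {σ : Representation K G W}
    (hρ : N ≤ MonoidHom.ker ρ) (hσ : N ≤ MonoidHom.ker σ)
    (h : ∀ g, algebraMap F K (ρ.character g) = σ.character g) (hs : HasScalarCommutant σ) :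
    HasScalarCommutant ρ := by
  -- Both representations factor through the finite group `G/N`, where the norm criterion is
  -- available.
  have := Fintype.ofFinite (G ⧸ N)
  let ρ' : Representation F (G ⧸ N) V := QuotientGroup.lift N ρ hρ
  let σ' : Representation K (G ⧸ N) W := QuotientGroup.lift N σ hσ
  have hρ' : ∀ g : G, ρ' (QuotientGroup.mk g) = ρ g := fun _ => rfl
  have hσ' : ∀ g : G, σ' (QuotientGroup.mk g) = σ g := fun _ => rfl
  have h' : ∀ g, algebraMap F K (ρ'.character g) = σ'.character g := by
    intro g
    induction g using QuotientGroup.induction_on with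
    | H g => exact h g
  have hs' : HasScalarCommutant σ' := ⟨hs.1, fun f hf => hs.2 f fun g => hf (QuotientGroup.mk g)⟩
  have key : HasScalarCommutant ρ' := by
    rw [hasScalarCommutant_iff] at hs' ⊢
    apply (algebraMap F K).injective
    rw [map_mul, map_inv₀, map_sum, map_one, map_natCast]
    simp only [map_mul, h']
    exact hs'
  refine ⟨key.1, fun f hf => key.2 f fun g => ?_⟩
  induction g using QuotientGroup.induction_on with
  | H g => exact hf g

end Schur

section Integral

open scoped Pointwise in
/-- A representation with finite image over the field of fractions of a principal ideal domain is
integral with respect to some basis. -/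
theorem exists_integral_basis (k : Type*) {F : Type*} [CommRing k] [IsDomain k]
    [IsPrincipalIdealRing k] [Field F] [Algebra k F] [IsFractionRing k F] {G : Type*} [Group G]
    {V : Type*} [AddCommGroup V] [Module F V] [FiniteDimensional F V]
    (ρ : Representation F G V) (hfin : (Set.range ρ).Finite) :
    ∃ b : Module.Basis (Fin (Module.finrank F V)) F V, ∀ g i j,
      b.repr (ρ g (b j)) i ∈ Set.range (algebraMap k F) := by
  let _ : Module k V := Module.compHom V (algebraMap k F)
  have : IsScalarTower k F V := ⟨fun a b v => by
    rw [Algebra.smul_def, mul_smul]; rfl⟩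
  let b0 := Module.finBasis F V
  -- The translates of a basis form a finite stable set; its `k`-span is a stable lattice, free
  -- because `k` is a principal ideal domain.
  let s : Set V := (fun x : Module.End F V × Fin (Module.finrank F V) => x.1 (b0 x.2)) ''
    (Set.range ρ ×ˢ Set.univ)
  have hs : s.Finite := (hfin.prod Set.finite_univ).image _
  let M : Submodule k V := Submodule.span k s
  have hb0 : ∀ j, b0 j ∈ s := fun j => ⟨(1, j), ⟨⟨1, map_one ρ⟩, Set.mem_univ _⟩, rfl⟩
  have : Submodule.IsLattice F M :=
    { fg := Submodule.fg_span hs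
      span_eq_top := by
        rw [eq_top_iff, ← b0.span_eq]
        refine Submodule.span_mono ?_
        rintro _ ⟨j, rfl⟩
        exact Submodule.subset_span (hb0 j) }
  have hstab : ∀ g, ∀ v ∈ M, ρ g v ∈ M := by
    intro g v hv
    induction hv using Submodule.span_induction with
    | mem x hx =>
      obtain ⟨⟨_, j⟩, ⟨⟨g', rfl⟩, -⟩, rfl⟩ := hx
      exact Submodule.subset_span ⟨(ρ (g * g'), j), ⟨⟨_, rfl⟩, Set.mem_univ _⟩, by simp⟩
    | zero => simp
    | add x y _ _ hx hy => rw [map_add]; exact add_mem hx hy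
    | smul a x _ hx =>
      rw [← algebraMap_smul F a x, map_smul, algebraMap_smul]
      exact M.smul_mem a hx
  have : Module.IsTorsionFree k F := inferInstance
  let bM := Module.finBasis k M
  let bF := bM.extendOfIsLattice F
  have hcard : Module.finrank k M = Module.finrank F V := by
    rw [Module.finrank_eq_card_basis bF, Fintype.card_fin]
  refine ⟨bF.reindex (finCongr hcard), fun g i j => ?_⟩
  have hM : ∀ x : M, ∀ i, bF.repr x i = algebraMap k F (bM.repr x i) := by
    intro x i
    conv_lhs => rw [← bM.sum_repr x]
    rw [Submodule.coe_sum, map_sum, Finsupp.finsetSum_apply]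
    have : ∀ l, bF.repr ((bM.repr x l • bM l : M) : V) i =
        algebraMap k F (bM.repr x l) * (Finsupp.single l (1 : F) i) := by
      intro l
      rw [Submodule.coe_smul, ← Module.Basis.extendOfIsLattice_apply F, ← algebraMap_smul F, map_smul,
        Module.Basis.repr_self, Finsupp.smul_apply, smul_eq_mul]
    simp only [this]
    rw [Finset.sum_eq_single i] <;> simp +contextual
  have hj : (bF.reindex (finCongr hcard)) j = (bM ((finCongr hcard).symm j) : V) := by
    rw [Module.Basis.reindex_apply, Module.Basis.extendOfIsLattice_apply]
  rw [hj, Module.Basis.repr_reindex_apply]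
  exact ⟨_, (hM ⟨_, hstab g _ (bM ((finCongr hcard).symm j)).2⟩ _).symm⟩

end Integral

end Representation

end

noncomputable section

/-! ### Conjugation on the group algebra of a normal subgroup -/

section Conjugation

variable {R : Type*} [CommRing R] {G : Type*} [Group G] {H : Subgroup G} [H.Normal]

/-- The action of `g ∈ G` on `R[H]` by conjugation, for a normal subgroup `H`. -/
def groupAlgebraConj (g : G) : MonoidAlgebra R H →ₐ[R] MonoidAlgebra R H :=
  MonoidAlgebra.mapDomainAlgHom R R (MulAut.conjNormal g : H ≃* H).toMonoidHom

@[simp]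
theorem groupAlgebraConj_single (g : G) (h : H) (r : R) :
    groupAlgebraConj g (MonoidAlgebra.single h r) =
      MonoidAlgebra.single (MulAut.conjNormal g h) r := by
  simp [groupAlgebraConj]

theorem groupAlgebraConj_mul (g g' : G) (x : MonoidAlgebra R H) :
    groupAlgebraConj (g * g') x = groupAlgebraConj g (groupAlgebraConj g' x) := by
  rw [← AlgHom.comp_apply]
  congr 1
  ext h
  simp

@[simp]
theorem groupAlgebraConj_one (x : MonoidAlgebra R H) : groupAlgebraConj (1 : G) x = x := by
  conv_rhs => rw [← AlgHom.id_apply (R := R) x]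
  congr 1
  ext h
  simp

theorem groupAlgebraConj_inv_apply (g : G) (x : MonoidAlgebra R H) :
    groupAlgebraConj g⁻¹ (groupAlgebraConj g x) = x := by
  rw [← groupAlgebraConj_mul, inv_mul_cancel, groupAlgebraConj_one]

theorem groupAlgebraConj_apply_inv (g : G) (x : MonoidAlgebra R H) :
    groupAlgebraConj g (groupAlgebraConj g⁻¹ x) = x := by
  rw [← groupAlgebraConj_mul, mul_inv_cancel, groupAlgebraConj_one]

theorem lift_groupAlgebraConj {A : Type*} [Ring A] [Algebra R A] (φ : G →* A) (g : G)
    (x : MonoidAlgebra R H) :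
    MonoidAlgebra.lift R A H (φ.comp H.subtype) (groupAlgebraConj g x) =
      φ g * MonoidAlgebra.lift R A H (φ.comp H.subtype) x * φ g⁻¹ := by
  induction x using MonoidAlgebra.induction_linear with
  | zero => simp
  | add x y hx hy => simp only [map_add, hx, hy, mul_add, add_mul]
  | single h r => simp [MonoidAlgebra.lift_single, mul_assoc]

theorem lift_groupAlgebraConj_mul {A : Type*} [Ring A] [Algebra R A] (φ : G →* A) (g : G)
    (x : MonoidAlgebra R H) :
    MonoidAlgebra.lift R A H (φ.comp H.subtype) (groupAlgebraConj g x) * φ g =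
      φ g * MonoidAlgebra.lift R A H (φ.comp H.subtype) x := by
  rw [lift_groupAlgebraConj, mul_assoc, ← map_mul, inv_mul_cancel, map_one, mul_one]

end Conjugation

namespace Representation

section Idempotents

variable {F : Type*} [Field F] [CharZero F] {H : Type*} [Group H] [Fintype H]
  {W : Type*} [AddCommGroup W] [Module F W] [FiniteDimensional F W]
  {U : Type*} [AddCommGroup U] [Module F U] [FiniteDimensional F U]
  {σ : Representation F H W} {τ : Representation F H U}

theorem HasScalarCommutant.isIdempotentElem (hσ : HasScalarCommutant σ) :
    IsIdempotentElem (characterIdempotent σ.character) := by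
  rw [← fourierInv_one, IsIdempotentElem, ← fourierInv_mul hσ, one_mul]

/-- The product of the idempotent of `σ` with a central idempotent is zero or the former. -/
theorem HasScalarCommutant.mul_characterIdempotent (hσ : HasScalarCommutant σ)
    {x : MonoidAlgebra F H} (hx : IsIdempotentElem x) (hc : ∀ y, Commute x y) :
    x * characterIdempotent σ.character = 0 ∨
      x * characterIdempotent σ.character = characterIdempotent σ.character := by
  have := hσ.1
  rw [← fourierInv_one, ← fourierInv_asAlgebraHom]
  -- A central element acts by a scalar, and for an idempotent that scalar is `0` or `1`.
  obtain ⟨c, hcc⟩ := hσ.2 (asAlgebraHom σ x) fun g => by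
    rw [← asAlgebraHom_single_one]
    exact (hc _).map (asAlgebraHom σ)
  have hid := hx.map (asAlgebraHom σ)
  rw [hcc, IsIdempotentElem, smul_mul_smul_comm, one_mul] at hid
  have h1 : c * c = c := by
    by_contra hne
    have h2 : (c * c - c) • (1 : Module.End F W) = 0 := by rw [sub_smul, hid, sub_self]
    rcases smul_eq_zero.mp h2 with h | h
    · exact hne (sub_eq_zero.mp h)
    · exact one_ne_zero h
  rw [hcc]
  rcases IsIdempotentElem.iff_eq_zero_or_one.mp h1 with rfl | rfl
  · left; simp
  · right; simp

/-- Orthogonality of the central idempotents of absolutely irreducible representations. -/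
theorem HasScalarCommutant.character_eq_or_mul_eq_zero (hσ : HasScalarCommutant σ)
    (hτ : HasScalarCommutant τ) : σ.character = τ.character ∨
      characterIdempotent σ.character * characterIdempotent τ.character = 0 := by
  have := hσ.1
  have := hτ.1
  have hcσ : ∀ y, Commute (characterIdempotent σ.character) y := fun y => by
    rw [← fourierInv_one]; exact fourierInv_one_commute y
  have hcτ : ∀ y, Commute (characterIdempotent τ.character) y := fun y => by
    rw [← fourierInv_one]; exact fourierInv_one_commute y
  rcases hτ.mul_characterIdempotent hσ.isIdempotentElem hcσ with h | h
  · exact Or.inr h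
  rcases hσ.mul_characterIdempotent hτ.isIdempotentElem hcτ with h' | h'
  · exact Or.inr ((hcσ _).eq.trans h')
  left
  have heq : characterIdempotent σ.character = characterIdempotent τ.character :=
    h'.symm.trans ((hcτ _).eq.trans h)
  have hH : (Fintype.card H : F) ≠ 0 := Nat.cast_ne_zero.mpr Fintype.card_ne_zero
  have hcoef : ∀ (f : H → F) (g : H), (characterIdempotent f).coeff g =
      f 1 / (Fintype.card H : F) * f g⁻¹ := by
    intro f g
    classical
    rw [characterIdempotent, MonoidAlgebra.coeff_sum, Finsupp.finsetSum_apply]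
    simp [Finsupp.single_apply]
  -- Equal idempotents have equal coefficients, so the characters agree up to their degrees; the
  -- value at `1` then compares the squares of the degrees.
  have hval : ∀ g, (Module.finrank F W : F) * σ.character g =
      Module.finrank F U * τ.character g := by
    intro g
    have h1 := congrArg (fun x => x.coeff g⁻¹) heq
    simp only [hcoef, inv_inv, char_one] at h1
    field_simp at h1
    exact h1
  have hdim : Module.finrank F W = Module.finrank F U := by
    have h1 := hval 1
    rw [char_one, char_one] at h1
    have h2 : Module.finrank F W * Module.finrank F W = Module.finrank F U * Module.finrank F U := by
      exact_mod_cast h1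
    exact Nat.mul_self_inj.mp h2
  funext g
  have := hval g
  rw [hdim] at this
  exact mul_left_cancel₀ (Nat.cast_ne_zero.mpr Module.finrank_pos.ne') this

end Idempotents

end Representation

end

noncomputable section

/-! ### Clifford theory for a normal subgroup with cyclic quotient -/

theorem groupAlgebraConj_characterIdempotent {F : Type*} [Field F] {G : Type*} [Group G]
    {H : Subgroup G} [H.Normal] [Fintype H] (g : G) (f : H → F) :
    groupAlgebraConj g (characterIdempotent f) =
      characterIdempotent fun h => f (MulAut.conjNormal g⁻¹ h) := by
  rw [characterIdempotent, characterIdempotent, map_sum]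
  refine Fintype.sum_equiv (MulAut.conjNormal g : H ≃* H).toEquiv _ _ fun h => ?_
  rw [groupAlgebraConj_single]
  have h1 : (MulAut.conjNormal g⁻¹ : H ≃* H) 1 = 1 := map_one _
  have h2 : (MulAut.conjNormal g⁻¹ : H ≃* H) ((MulAut.conjNormal g : H ≃* H) h)⁻¹ = h⁻¹ := by
    rw [← map_inv, ← MulAut.mul_apply, ← map_mul, inv_mul_cancel, map_one]; rfl
  congr 1
  change _ = f ((MulAut.conjNormal g⁻¹ : H ≃* H) 1) / _ *
    f ((MulAut.conjNormal g⁻¹ : H ≃* H) ((MulAut.conjNormal g : H ≃* H) h)⁻¹)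
  rw [h1, h2]

namespace Representation

variable {F : Type*} [Field F] [CharZero F] {G : Type*} [Group G] {H : Subgroup G} [H.Normal]
  [Fintype H] {V : Type*} [AddCommGroup V] [Module F V] [FiniteDimensional F V]
  {W : Type*} [AddCommGroup W] [Module F W] [FiniteDimensional F W]

theorem HasScalarCommutant.conj {σ : Representation F H W} (hσ : HasScalarCommutant σ) (g : G) :
    HasScalarCommutant (σ.comp (MulAut.conjNormal g : H ≃* H).toMonoidHom) := by
  refine ⟨hσ.1, fun f hf => hσ.2 f fun h => ?_⟩
  have := hf ((MulAut.conjNormal g : H ≃* H).symm h)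
  simpa using this

/-- An absolutely irreducible representation `ρ` of `G`, generated by `H` and `γ`, and an absolutely
irreducible constituent `σ` of its restriction to `H` whose orbit under `γ` has length `w`. -/
structure IsCliffordPair (ρ : Representation F G V) (σ : Representation F H W) (γ : G) (w : ℕ) :
    Prop where
  scalar : HasScalarCommutant ρ
  scalar' : HasScalarCommutant σ
  gen : ∀ g, ∃ (h : H) (i : ℕ), ρ g = ρ (h * γ ^ i)
  pos : 0 < w
  char_conj : ∀ h : H, σ.character (MulAut.conjNormal (γ ^ w)⁻¹ h) = σ.character h
  char_conj_ne : ∀ i, 0 < i → i < w →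
    ∃ h : H, σ.character (MulAut.conjNormal (γ ^ i)⁻¹ h) ≠ σ.character h
  ne_zero : asAlgebraHom (ρ.comp H.subtype) (characterIdempotent σ.character) ≠ 0

variable (σ : Representation F H W) (γ : G)

/-- The conjugates of the central idempotent of `σ`. -/
def conjIdempotent (i : ℕ) : MonoidAlgebra F H :=
  groupAlgebraConj (γ ^ i) (characterIdempotent σ.character)

theorem conjIdempotent_zero : conjIdempotent σ γ 0 = characterIdempotent σ.character := by
  rw [conjIdempotent, pow_zero, groupAlgebraConj_one]

theorem characterIdempotent_commute (x : MonoidAlgebra F H) :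
    Commute (characterIdempotent σ.character) x := by
  rw [← fourierInv_one]; exact fourierInv_one_commute x

theorem conjIdempotent_commute (i : ℕ) (x : MonoidAlgebra F H) :
    Commute (conjIdempotent σ γ i) x := by
  have := (characterIdempotent_commute σ (groupAlgebraConj (γ ^ i)⁻¹ x)).map
    (groupAlgebraConj (γ ^ i))
  rwa [groupAlgebraConj_apply_inv] at this

variable {σ γ} {ρ : Representation F G V} {w : ℕ}

namespace IsCliffordPair

theorem conj_pow (h : IsCliffordPair ρ σ γ w) :
    groupAlgebraConj (γ ^ w) (characterIdempotent σ.character) =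
      characterIdempotent σ.character := by
  rw [groupAlgebraConj_characterIdempotent]
  congr 1
  funext x
  exact h.char_conj x

/-- For `0 < i < w` the conjugate by `γ ^ i` has a different character, so orthogonality of central
idempotents applies. -/
theorem mul_eq_zero_of_lt (h : IsCliffordPair ρ σ γ w) {i : ℕ} (hi0 : 0 < i) (hi : i < w) :
    conjIdempotent σ γ i * characterIdempotent σ.character = 0 := by
  rw [conjIdempotent, groupAlgebraConj_characterIdempotent]
  rcases (h.scalar'.conj (γ ^ i)⁻¹).character_eq_or_mul_eq_zero h.scalar' with h1 | h1
  · obtain ⟨x, hx⟩ := h.char_conj_ne i hi0 hi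
    exact absurd (congrFun h1 x) hx
  · exact h1

theorem conjIdempotent_add_mul (h : IsCliffordPair ρ σ γ w) (i j : ℕ) :
    conjIdempotent σ γ (i + w * j) = conjIdempotent σ γ i := by
  induction j with
  | zero => rw [mul_zero, add_zero]
  | succ j ih =>
    rw [mul_add, mul_one, ← add_assoc, ← ih, conjIdempotent, pow_add, groupAlgebraConj_mul,
      h.conj_pow, conjIdempotent]

theorem conjIdempotent_mod (h : IsCliffordPair ρ σ γ w) (i : ℕ) :
    conjIdempotent σ γ (i % w) = conjIdempotent σ γ i := by
  conv_rhs => rw [← Nat.mod_add_div i w]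
  rw [h.conjIdempotent_add_mul]

theorem conjIdempotent_mul_base (h : IsCliffordPair ρ σ γ w) {i : ℕ} (hi : ¬ w ∣ i) :
    conjIdempotent σ γ i * characterIdempotent σ.character = 0 := by
  rw [← h.conjIdempotent_mod]
  exact h.mul_eq_zero_of_lt (Nat.pos_of_ne_zero fun h0 => hi (Nat.dvd_of_mod_eq_zero h0))
    (Nat.mod_lt _ h.pos)

/-- The restriction of `ρ` to `F[H]`. -/
theorem res_conj (g : G) (x : MonoidAlgebra F H) :
    asAlgebraHom (ρ.comp H.subtype) (groupAlgebraConj g x) =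
      ρ g * asAlgebraHom (ρ.comp H.subtype) x * ρ g⁻¹ :=
  lift_groupAlgebraConj ρ g x

theorem res_conj_mul (g : G) (x : MonoidAlgebra F H) :
    asAlgebraHom (ρ.comp H.subtype) (groupAlgebraConj g x) * ρ g =
      ρ g * asAlgebraHom (ρ.comp H.subtype) x :=
  lift_groupAlgebraConj_mul ρ g x

theorem eq_scalar_of_commute (h : IsCliffordPair ρ σ γ w) (f : Module.End F V)
    (hH : ∀ x : H, Commute f (ρ x)) (hγ : Commute f (ρ γ)) : ∃ c : F, f = c • 1 := by
  refine h.scalar.2 f fun g => ?_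
  obtain ⟨x, i, hx⟩ := h.gen g
  rw [hx, map_mul, map_pow]
  exact (hH x).mul_right (hγ.pow_right i)

/-- Cyclic reindexing, used to see that sums over the orbit of `γ` are invariant under `γ`. -/
theorem sum_range_succ_eq {M : Type*} [AddCommGroup M] (f : ℕ → M) {w : ℕ} (h : f w = f 0) :
    ∑ i ∈ Finset.range w, f (i + 1) = ∑ i ∈ Finset.range w, f i := by
  have h1 := Finset.sum_range_succ f w
  have h2 := Finset.sum_range_succ' f w
  rw [h1, h] at h2
  exact (add_right_cancel h2).symm

/-- The sum of the conjugates acts as the identity. -/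
theorem res_sum_conjIdempotent (h : IsCliffordPair ρ σ γ w) :
    asAlgebraHom (ρ.comp H.subtype) (∑ i ∈ Finset.range w, conjIdempotent σ γ i) = 1 := by
  set E := ∑ i ∈ Finset.range w, conjIdempotent σ γ i with hE
  have hconj : groupAlgebraConj γ E = E := by
    rw [hE, map_sum, ← sum_range_succ_eq (conjIdempotent σ γ)]
    · refine Finset.sum_congr rfl fun i _ => ?_
      rw [conjIdempotent, ← groupAlgebraConj_mul, ← pow_succ', conjIdempotent]
    · rw [conjIdempotent, h.conj_pow, conjIdempotent_zero]
  -- The orbit sum is central and invariant under `γ`, so it acts by a scalar; the scalar is `1`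
  -- because the sum fixes `e(σ)`, which acts nontrivially.
  obtain ⟨c, hc⟩ := h.eq_scalar_of_commute (asAlgebraHom (ρ.comp H.subtype) E)
    (fun x => by
      have : Commute E (MonoidAlgebra.single x 1) :=
        Commute.sum_left _ _ _ fun i _ => conjIdempotent_commute σ γ i _
      have := this.map (asAlgebraHom (ρ.comp H.subtype))
      rwa [asAlgebraHom_single_one] at this)
    (by
      have := res_conj_mul (ρ := ρ) γ E
      rwa [hconj] at this)
  have hEe : E * characterIdempotent σ.character = characterIdempotent σ.character := by
    rw [hE, Finset.sum_mul, Finset.sum_eq_single 0]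
    · rw [conjIdempotent_zero]
      exact h.scalar'.isIdempotentElem
    · intro i hi hi0
      exact h.mul_eq_zero_of_lt (Nat.pos_of_ne_zero hi0) (Finset.mem_range.mp hi)
    · intro h0
      exact absurd (Finset.mem_range.mpr h.pos) h0
  have h1 := congrArg (asAlgebraHom (ρ.comp H.subtype)) hEe
  rw [map_mul, hc, smul_mul_assoc, one_mul] at h1
  have h2 : c = 1 := by
    have h3 : (c - 1) • asAlgebraHom (ρ.comp H.subtype) (characterIdempotent σ.character) = 0 := by
      rw [sub_smul, h1, one_smul, sub_self]
    exact sub_eq_zero.mp ((smul_eq_zero.mp h3).resolve_right h.ne_zero)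
  rw [hc, h2, one_smul]

/-- An endomorphism of `e(σ)V` commuting with `H` and `γ ^ w` is a scalar. -/
theorem eq_smul_of_commute_pow (h : IsCliffordPair ρ σ γ w) (f : Module.End F V)
    (hr : f * asAlgebraHom (ρ.comp H.subtype) (characterIdempotent σ.character) = f)
    (hH : ∀ x : H, Commute f (ρ x)) (hγ : Commute f (ρ (γ ^ w))) :
    ∃ c : F, f = c • asAlgebraHom (ρ.comp H.subtype) (characterIdempotent σ.character) := by
  set e := characterIdempotent σ.character
  -- Spreading `f` over the orbit gives an operator commuting with all of `G`, hence a scalar.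
  -- Cutting back by `e(σ)` leaves only the term `i = 0`, which is `f`.
  let φ : ℕ → Module.End F V := fun i => ρ (γ ^ i) * f * ρ (γ ^ i)⁻¹
  have hφ0 : φ 0 = f := by simp [φ]
  have hφw : φ w = φ 0 := by
    rw [hφ0]
    simp only [φ]
    rw [← hγ.eq, mul_assoc, ← map_mul, mul_inv_cancel, map_one, mul_one]
  obtain ⟨c, hc⟩ := h.eq_scalar_of_commute (∑ i ∈ Finset.range w, φ i)
    (fun x => Commute.sum_left _ _ _ fun i _ => by
      have hx : ρ (x : G) = ρ (γ ^ i) * ρ (MulAut.conjNormal (γ ^ i)⁻¹ x : H) * ρ (γ ^ i)⁻¹ := by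
        rw [← map_mul, ← map_mul]
        rw [MulAut.conjNormal_apply, inv_inv]
        congr 1
        group
      have hy := (hH (MulAut.conjNormal (γ ^ i)⁻¹ x)).eq
      rw [hx]
      simp only [φ, Commute, SemiconjBy]
      have hinv : ρ (γ ^ i)⁻¹ * ρ (γ ^ i) = 1 := by rw [← map_mul, inv_mul_cancel, map_one]
      generalize ρ (MulAut.conjNormal (γ ^ i)⁻¹ x : H) = a at *
      generalize ρ (γ ^ i)⁻¹ = b at *
      generalize ρ (γ ^ i) = d at *
      calc d * f * b * (d * a * b) = d * f * (b * d) * a * b := by simp only [mul_assoc]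
        _ = d * (f * a) * b := by rw [hinv]; simp only [mul_assoc, mul_one]
        _ = d * a * (b * d) * f * b := by rw [hy, hinv]; simp only [mul_assoc, mul_one]
        _ = d * a * b * (d * f * b) := by simp only [mul_assoc])
    (by
      have : ρ γ * ∑ i ∈ Finset.range w, φ i = (∑ i ∈ Finset.range w, φ i) * ρ γ := by
        conv_rhs => rw [← sum_range_succ_eq φ hφw]
        rw [Finset.mul_sum, Finset.sum_mul]
        refine Finset.sum_congr rfl fun i _ => ?_
        simp only [φ]
        rw [pow_succ', mul_inv_rev, map_mul, map_mul, mul_assoc _ _ (ρ γ), mul_assoc (ρ _) (ρ γ⁻¹),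
          ← map_mul ρ γ⁻¹, inv_mul_cancel, map_one, mul_one]
        simp only [mul_assoc]
      exact this.symm)
  -- The conjugate `φ i` factors through the conjugate idempotent, which is orthogonal to `e(σ)`.
  have hzero : ∀ i ∈ Finset.range w, i ≠ 0 → φ i * asAlgebraHom (ρ.comp H.subtype) e = 0 := by
    intro i hi hi0
    have h1 : φ i = φ i * asAlgebraHom (ρ.comp H.subtype) (conjIdempotent σ γ i) := by
      rw [conjIdempotent, res_conj]
      simp only [φ]
      have hinv : ρ (γ ^ i)⁻¹ * ρ (γ ^ i) = 1 := by rw [← map_mul, inv_mul_cancel, map_one]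
      conv_lhs => rw [← hr]
      simp only [mul_assoc]
      rw [← mul_assoc (ρ (γ ^ i)⁻¹) (ρ (γ ^ i)), hinv, one_mul]
    rw [h1, mul_assoc, ← map_mul, h.mul_eq_zero_of_lt (Nat.pos_of_ne_zero hi0)
      (Finset.mem_range.mp hi), map_zero, mul_zero]
  refine ⟨c, ?_⟩
  have h1 := congrArg (· * asAlgebraHom (ρ.comp H.subtype) e) hc
  simp only [Finset.sum_mul, smul_mul_assoc, one_mul] at h1
  rw [Finset.sum_eq_single 0 hzero fun h0 => absurd (Finset.mem_range.mpr h.pos) h0, hφ0, hr] at h1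
  exact h1

/-- Skolem–Noether for the action of `γ ^ w` on `F[H]e(σ) = End W`. -/
theorem exists_intertwiner (h : IsCliffordPair ρ σ γ w) : ∃ T : W ≃ₗ[F] W, ∀ f : Module.End F W,
    groupAlgebraConj (γ ^ w) (fourierInv σ f) = fourierInv σ (T.toLinearMap * f * T.symm.toLinearMap) := by
  have hconj_mem : ∀ g : G, groupAlgebraConj g (fourierInv σ 1) = fourierInv σ 1 → ∀ f,
      fourierInv σ (asAlgebraHom σ (groupAlgebraConj g (fourierInv σ f))) =
        groupAlgebraConj g (fourierInv σ f) := by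
    intro g hg f
    rw [fourierInv_asAlgebraHom]
    conv_lhs => rw [← hg]
    rw [← map_mul, ← fourierInv_mul h.scalar', mul_one]
  have h1 : groupAlgebraConj (γ ^ w) (fourierInv σ 1) = fourierInv σ 1 := by
    rw [fourierInv_one]; exact h.conj_pow
  have h2 : groupAlgebraConj (γ ^ w)⁻¹ (fourierInv σ 1) = fourierInv σ 1 := by
    conv_lhs => rw [← h1]
    rw [groupAlgebraConj_inv_apply]
  -- Conjugation by an element fixing `e(σ)` preserves its block and is transported to `End W`; the
  -- elements `γ ^ w` and `(γ ^ w)⁻¹` give mutually inverse maps.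
  let α : ∀ g : G, groupAlgebraConj g (fourierInv σ 1) = fourierInv σ 1 →
      (Module.End F W →ₐ[F] Module.End F W) := fun g hg =>
    AlgHom.ofLinearMap ((asAlgebraHom σ).toLinearMap ∘ₗ (groupAlgebraConj g).toLinearMap ∘ₗ
      fourierInv σ) (by simp [hg, asAlgebraHom_fourierInv h.scalar'])
      (fun x y => by simp [fourierInv_mul h.scalar'])
  have hα : ∀ g hg f, α g hg f = asAlgebraHom σ (groupAlgebraConj g (fourierInv σ f)) :=
    fun _ _ _ => rfl
  let a : Module.End F W ≃ₐ[F] Module.End F W := AlgEquiv.ofAlgHom (α _ h1) (α _ h2)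
    (by
      ext1 f
      rw [AlgHom.comp_apply, hα _ h1, hα _ h2, hconj_mem _ h2, groupAlgebraConj_apply_inv,
        asAlgebraHom_fourierInv h.scalar']
      rfl)
    (by
      ext1 f
      rw [AlgHom.comp_apply, hα _ h2, hα _ h1, hconj_mem _ h1, groupAlgebraConj_inv_apply,
        asAlgebraHom_fourierInv h.scalar']
      rfl)
  -- Automorphisms of `End W` are inner.
  obtain ⟨T, hT⟩ := a.eq_linearEquivConjAlgEquiv
  refine ⟨T, fun f => ?_⟩
  rw [← hconj_mem _ h1]
  congr 1
  exact DFunLike.congr_fun hT f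

end IsCliffordPair

end Representation

end

/-! ### Multiplicity-freeness of the restriction to `H`, and the action of `γ ^ w` through `F[H]` -/

noncomputable section

namespace Representation

variable {F : Type*} [Field F] [CharZero F] {G : Type*} [Group G] {H : Subgroup G} [H.Normal]
  [Fintype H] {V : Type*} [AddCommGroup V] [Module F V] [FiniteDimensional F V]
  {W : Type*} [AddCommGroup W] [Module F W] [FiniteDimensional F W]
  {σ : Representation F H W} {γ : G} {ρ : Representation F G V} {w : ℕ}

namespace IsCliffordPair

theorem res_single (x : H) :
    asAlgebraHom (ρ.comp H.subtype) (MonoidAlgebra.single x 1) = ρ x :=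
  asAlgebraHom_single_one _ x

/-- If conjugation by `γ ^ w` is conjugation by `T` on `End W`, then `T⁻¹ γ ^ w` commutes on `e(σ)V`
with `H` and with `γ ^ w`, so it is a scalar `c`. Hence `γ ^ w` acts there as `cT` and its inverse
as `c⁻¹T⁻¹`, both taken from `F[H]e(σ)`. -/
theorem exists_res_eq (h : IsCliffordPair ρ σ γ w) : ∃ y y' : MonoidAlgebra F H,
    ρ (γ ^ w) * asAlgebraHom (ρ.comp H.subtype) (characterIdempotent σ.character) =
      asAlgebraHom (ρ.comp H.subtype) y ∧
    ρ (γ ^ w)⁻¹ * asAlgebraHom (ρ.comp H.subtype) (characterIdempotent σ.character) =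
      asAlgebraHom (ρ.comp H.subtype) y' := by
  obtain ⟨T, hT⟩ := h.exists_intertwiner
  set A : Module.End F W := T.toLinearMap with hA
  set B : Module.End F W := T.symm.toLinearMap with hB
  have hAB : A * B = 1 := by ext v; simp [A, B]
  have hBA : B * A = 1 := by ext v; simp [A, B]
  set r := asAlgebraHom (ρ.comp H.subtype) with hr
  set e := characterIdempotent σ.character with he
  have hs1 : fourierInv σ 1 = e := fourierInv_one σ
  have hmul : ∀ f g, r (fourierInv σ f) * r (fourierInv σ g) = r (fourierInv σ (f * g)) :=
    fun f g => by rw [fourierInv_mul h.scalar', map_mul]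
  have key : ∀ f, ρ (γ ^ w) * r (fourierInv σ f) = r (fourierInv σ (A * f * B)) * ρ (γ ^ w) := by
    intro f
    rw [← hT, hr, res_conj_mul]
  have hinv : ρ (γ ^ w)⁻¹ * ρ (γ ^ w) = 1 := by rw [← map_mul, inv_mul_cancel, map_one]
  have hγe : ρ (γ ^ w) * r e = r e * ρ (γ ^ w) := by rw [← hs1, key, mul_one, hAB]
  set θ := r (fourierInv σ B) * ρ (γ ^ w) with hθ
  have hθe : θ * r e = θ := by
    rw [hθ, mul_assoc, hγe, ← mul_assoc, ← hs1, hmul, mul_one]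
  obtain ⟨c, hc⟩ := h.eq_smul_of_commute_pow θ hθe
    (fun x => by
      have h1 : θ * ρ x = r (fourierInv σ (σ x * B)) * ρ (γ ^ w) := by
        rw [← hθe, mul_assoc, ← res_single, ← hr, ← map_mul, ← hs1, ← fourierInv_mul_single, one_mul,
          hθ, mul_assoc, key, ← mul_assoc, hmul, ← mul_assoc, ← mul_assoc, hBA, one_mul]
      have h2 : ρ x * θ = r (fourierInv σ (σ x * B)) * ρ (γ ^ w) := by
        rw [← res_single, ← hr, hθ, ← mul_assoc, ← map_mul, ← fourierInv_single_mul]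
      exact h1.trans h2.symm)
    (by
      rw [Commute, SemiconjBy, hθ, ← mul_assoc, key, hAB, one_mul])
  have h1 : ρ (γ ^ w) * r e = r (fourierInv σ (c • A)) := by
    have h2 : r (fourierInv σ A) * θ = r e * ρ (γ ^ w) := by
      rw [hθ, ← mul_assoc, hmul, hAB, hs1]
    rw [hγe, ← h2, hc, mul_smul_comm, ← hr, ← he, ← hs1, hmul, mul_one, map_smul, map_smul]
  -- The scalar is nonzero because `γ ^ w` acts invertibly and `e(σ)V` is not zero.
  have hc0 : c ≠ 0 := by
    rintro rfl
    rw [zero_smul, map_zero, map_zero] at h1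
    have := congrArg (ρ (γ ^ w)⁻¹ * ·) h1
    simp only [← mul_assoc, hinv, one_mul, mul_zero] at this
    exact h.ne_zero this
  refine ⟨_, fourierInv σ (c⁻¹ • B), h1, ?_⟩
  have h3 : ρ (γ ^ w) * r (fourierInv σ (c⁻¹ • B)) = r e := by
    have h4 : r (fourierInv σ (c⁻¹ • B)) = r e * r (fourierInv σ (c⁻¹ • B)) := by
      rw [← hs1, hmul, one_mul]
    rw [h4, ← mul_assoc, h1, hmul, smul_mul_smul_comm, mul_inv_cancel₀ hc0, one_smul, hAB, hs1]
  rw [← h3, ← mul_assoc, hinv, one_mul]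

theorem pow_mul_res (h : IsCliffordPair ρ σ γ w) :
    ρ (γ ^ w) * asAlgebraHom (ρ.comp H.subtype) (characterIdempotent σ.character) =
      asAlgebraHom (ρ.comp H.subtype) (characterIdempotent σ.character) * ρ (γ ^ w) := by
  rw [← res_conj_mul, h.conj_pow]

/-- An endomorphism of `e(σ)V` commuting with `H` is a scalar. -/
theorem eq_smul_of_commute (h : IsCliffordPair ρ σ γ w) (f : Module.End F V)
    (hl : asAlgebraHom (ρ.comp H.subtype) (characterIdempotent σ.character) * f = f)
    (hr : f * asAlgebraHom (ρ.comp H.subtype) (characterIdempotent σ.character) = f)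
    (hH : ∀ x : H, Commute f (ρ x)) :
    ∃ c : F, f = c • asAlgebraHom (ρ.comp H.subtype) (characterIdempotent σ.character) := by
  refine h.eq_smul_of_commute_pow f hr hH ?_
  -- Since `γ ^ w` acts on `e(σ)V` through `F[H]`, commuting with `H` already implies commuting with
  -- `γ ^ w`.
  obtain ⟨y, -, hy, -⟩ := h.exists_res_eq
  have hfy : f * asAlgebraHom (ρ.comp H.subtype) y = asAlgebraHom (ρ.comp H.subtype) y * f := by
    clear hy
    induction y using MonoidAlgebra.induction_linear with
    | zero => simp
    | add x y hx hy => rw [map_add, mul_add, add_mul, hx, hy]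
    | single x c =>
      rw [asAlgebraHom_single, mul_smul_comm, smul_mul_assoc]
      congr 1
      exact hH x
  rw [Commute, SemiconjBy]
  conv_lhs => rw [← hr, mul_assoc, ← h.pow_mul_res, hy, hfy, ← hy, mul_assoc, hl]

/-- The representation of `H` on `e(σ)V` has scalar commutant, so `σ` occurs just once; the trace
can be computed on this subspace. -/
theorem trace_mul_res (h : IsCliffordPair ρ σ γ w) (x : H) :
    LinearMap.trace F V
      (ρ x * asAlgebraHom (ρ.comp H.subtype) (characterIdempotent σ.character)) =
      σ.character x := by
  set r := asAlgebraHom (ρ.comp H.subtype) with hr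
  set e := characterIdempotent σ.character with he
  have hee : r e * r e = r e := by rw [← map_mul, h.scalar'.isIdempotentElem]
  let V0 := LinearMap.range (r e)
  let i : V0 →ₗ[F] V := V0.subtype
  let π : V →ₗ[F] V0 := (r e).rangeRestrict
  have hiπ : i ∘ₗ π = r e := rfl
  have hi : Function.Injective i := Subtype.val_injective
  have hei : r e ∘ₗ i = i := by
    ext ⟨_, v, rfl⟩
    exact DFunLike.congr_fun hee v
  have hπi : π ∘ₗ i = LinearMap.id := by
    ext v
    exact DFunLike.congr_fun hei v
  have hπe : π ∘ₗ r e = π := by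
    ext v
    exact DFunLike.congr_fun hee v
  have hcom : ∀ y, r e * r y = r y * r e := fun y => by
    rw [← map_mul, (characterIdempotent_commute σ y).eq, map_mul]
  have hcomp : ∀ y z, (π ∘ₗ r y ∘ₗ i) ∘ₗ (π ∘ₗ r z ∘ₗ i) = π ∘ₗ r (y * z) ∘ₗ i := by
    intro y z
    have h1 : r y ∘ₗ i ∘ₗ π = r e * r y := (hcom y).symm
    calc (π ∘ₗ r y ∘ₗ i) ∘ₗ (π ∘ₗ r z ∘ₗ i) = π ∘ₗ (r y ∘ₗ i ∘ₗ π) ∘ₗ r z ∘ₗ i := rfl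
      _ = (π ∘ₗ r e) ∘ₗ (r y * r z) ∘ₗ i := by rw [h1]; rfl
      _ = _ := by rw [hπe, ← map_mul]
  let σ0 : Representation F H V0 :=
    { toFun := fun x => π ∘ₗ r (MonoidAlgebra.single x 1) ∘ₗ i
      map_one' := by
        rw [← MonoidAlgebra.one_def, map_one]
        exact hπi
      map_mul' := fun x y => by
        rw [Module.End.mul_eq_comp, hcomp, MonoidAlgebra.single_mul_single, one_mul] }
  have hσ0 : ∀ y, asAlgebraHom σ0 y = π ∘ₗ r y ∘ₗ i := by
    intro y
    induction y using MonoidAlgebra.induction_linear with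
    | zero => simp
    | add y z hy hz => rw [map_add, hy, hz, map_add, LinearMap.add_comp, LinearMap.comp_add]
    | single g c =>
      rw [asAlgebraHom_single, ← mul_one c, ← smul_eq_mul, ← MonoidAlgebra.smul_single, map_smul,
        LinearMap.smul_comp, LinearMap.comp_smul, smul_eq_mul, mul_one]
      rfl
  have hsc : HasScalarCommutant σ0 := by
    constructor
    · by_contra hsub
      rw [not_nontrivial_iff_subsingleton] at hsub
      apply h.ne_zero
      change r e = 0
      rw [← hiπ]
      ext v
      have : π v = 0 := Subsingleton.elim _ _
      rw [LinearMap.comp_apply, this, map_zero, LinearMap.zero_apply]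
    · intro f hf
      obtain ⟨c, hc⟩ := h.eq_smul_of_commute (i ∘ₗ f ∘ₗ π)
        (by
          change (r e ∘ₗ i) ∘ₗ f ∘ₗ π = _
          rw [hei])
        (by
          change i ∘ₗ f ∘ₗ (π ∘ₗ r e) = _
          rw [hπe])
        (fun x => by
          have hx : σ0 x = π ∘ₗ ρ x ∘ₗ i := by
            rw [← res_single]; rfl
          have h1 : ρ x ∘ₗ i = i ∘ₗ σ0 x := by
            rw [hx, ← LinearMap.comp_assoc, hiπ, ← res_single, ← LinearMap.comp_assoc,
              ← Module.End.mul_eq_comp, ← hr, hcom, Module.End.mul_eq_comp, LinearMap.comp_assoc, hei]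
          have h2 : π ∘ₗ ρ x = σ0 x ∘ₗ π := by
            rw [hx, LinearMap.comp_assoc, LinearMap.comp_assoc, hiπ, ← res_single,
              ← Module.End.mul_eq_comp, ← hr, ← hcom, Module.End.mul_eq_comp,
              ← LinearMap.comp_assoc, hπe]
          calc (i ∘ₗ f ∘ₗ π) * ρ x = i ∘ₗ f ∘ₗ (π ∘ₗ ρ x) := rfl
            _ = i ∘ₗ (f * σ0 x) ∘ₗ π := by rw [h2]; rfl
            _ = (i ∘ₗ σ0 x) ∘ₗ f ∘ₗ π := by rw [(hf x).eq]; rfl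
            _ = ρ x * (i ∘ₗ f ∘ₗ π) := by rw [← h1]; rfl)
      refine ⟨c, ?_⟩
      have h1 : (π ∘ₗ i) ∘ₗ f ∘ₗ (π ∘ₗ i) = π ∘ₗ (i ∘ₗ f ∘ₗ π) ∘ₗ i := rfl
      rw [hπi, LinearMap.id_comp, LinearMap.comp_id, hc, LinearMap.smul_comp, LinearMap.comp_smul] at h1
      rw [h1]
      congr 1
      change π ∘ₗ r e ∘ₗ i = 1
      rw [hei, hπi]; rfl
  -- If the characters differed, the two idempotents would be orthogonal, yet both act as the
  -- identity on the nonzero space `e(σ)V`.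
  have hchar : σ.character = σ0.character := by
    refine (h.scalar'.character_eq_or_mul_eq_zero hsc).resolve_right fun h0 => ?_
    have := hsc.1
    have h1 := congrArg (asAlgebraHom σ0) h0
    rw [map_mul, ← fourierInv_one σ0, asAlgebraHom_fourierInv hsc, mul_one, hσ0, hei, hπi,
      map_zero] at h1
    exact one_ne_zero h1
  rw [hchar, character, Module.End.mul_eq_comp, ← hiπ, ← LinearMap.comp_assoc]
  change _ = LinearMap.trace F V0 (π ∘ₗ r (MonoidAlgebra.single x 1) ∘ₗ i)
  rw [← LinearMap.trace_comp_comm', hr, res_single, ← LinearMap.comp_assoc]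

theorem trace_mul_res_conjIdempotent (h : IsCliffordPair ρ σ γ w) (x : H) (i : ℕ) :
    LinearMap.trace F V (ρ x * asAlgebraHom (ρ.comp H.subtype) (conjIdempotent σ γ i)) =
      σ.character (MulAut.conjNormal (γ ^ i)⁻¹ x) := by
  rw [← h.trace_mul_res, conjIdempotent, res_conj, ← mul_assoc, LinearMap.trace_mul_comm,
    ← mul_assoc, ← mul_assoc, ← map_mul, ← map_mul, MulAut.conjNormal_apply, inv_inv]

/-- The restriction of `ρ` to `H` is the multiplicity free sum of the conjugates of `σ`. -/
theorem character_res (h : IsCliffordPair ρ σ γ w) (x : H) :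
    ρ.character x = ∑ i ∈ Finset.range w, σ.character (MulAut.conjNormal (γ ^ i)⁻¹ x) := by
  simp_rw [← h.trace_mul_res_conjIdempotent]
  rw [← map_sum, ← Finset.mul_sum, ← map_sum, h.res_sum_conjIdempotent, mul_one, character]

theorem finrank_eq (h : IsCliffordPair ρ σ γ w) :
    Module.finrank F V = w * Module.finrank F W := by
  have h1 := h.character_res 1
  simp only [map_one, char_one, Finset.sum_const, Finset.card_range, nsmul_eq_mul,
    OneMemClass.coe_one] at h1
  exact_mod_cast h1

/-- The inverse Fourier transform `End V → F[H]`, normalized to be a section of the action. -/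
def resInv (ρ : Representation F G V) (H : Subgroup G) [Fintype H] (w : ℕ) :
    Module.End F V →ₗ[F] MonoidAlgebra F H :=
  (w : F)⁻¹ • fourierInv (ρ.comp H.subtype)

/-- Compare coefficients: `ρ.character` is the orbit sum and `dim V = w dim W`, so `w⁻¹` is exactly
the factor turning the transform of the identity into a sum of idempotents. This element is `e_χ`.
-/
theorem resInv_one (h : IsCliffordPair ρ σ γ w) :
    resInv ρ H w 1 = ∑ i ∈ Finset.range w, conjIdempotent σ γ i := by
  have hw : (w : F) ≠ 0 := Nat.cast_ne_zero.mpr h.pos.ne'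
  simp only [resInv, LinearMap.smul_apply, fourierInv_one, conjIdempotent,
    groupAlgebraConj_characterIdempotent]
  simp only [characterIdempotent, map_one, char_one]
  rw [Finset.sum_comm, Finset.smul_sum]
  refine Finset.sum_congr rfl fun x _ => ?_
  have hx : Representation.character (ρ.comp H.subtype) x⁻¹ = ρ.character ((x⁻¹ : H) : G) := rfl
  rw [hx, h.character_res, h.finrank_eq, MonoidAlgebra.smul_single, smul_eq_mul, Finset.mul_sum,
    Finset.mul_sum, ← MonoidAlgebra.singleAddHom_apply, map_sum]
  refine Finset.sum_congr rfl fun i _ => ?_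
  rw [MonoidAlgebra.singleAddHom_apply]
  congr 1
  push_cast
  field_simp

theorem resInv_res (x : MonoidAlgebra F H) :
    resInv ρ H w (asAlgebraHom (ρ.comp H.subtype) x) = x * resInv ρ H w 1 := by
  simp only [resInv, LinearMap.smul_apply]
  rw [fourierInv_asAlgebraHom, mul_smul_comm]

theorem res_resInv_one (h : IsCliffordPair ρ σ γ w) :
    asAlgebraHom (ρ.comp H.subtype) (resInv ρ H w 1) = 1 := by
  rw [h.resInv_one, h.res_sum_conjIdempotent]

theorem res_resInv_res (h : IsCliffordPair ρ σ γ w) (x : MonoidAlgebra F H) :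
    asAlgebraHom (ρ.comp H.subtype) (resInv ρ H w (asAlgebraHom (ρ.comp H.subtype) x)) =
      asAlgebraHom (ρ.comp H.subtype) x := by
  rw [resInv_res, map_mul, h.res_resInv_one, mul_one]

/-- If `g` commutes with `γ` and acts on `e(σ)V` like `y`, then it acts on the whole of `V` like the
orbit sum of `y`, and on the image of `F[H]` the map `resInv` is a section. -/
theorem res_resInv_of_sum {g : G} {y : MonoidAlgebra F H} (h : IsCliffordPair ρ σ γ w)
    (hy : ρ g * asAlgebraHom (ρ.comp H.subtype) (characterIdempotent σ.character) =
      asAlgebraHom (ρ.comp H.subtype) y) (hg : Commute g γ) :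
    asAlgebraHom (ρ.comp H.subtype) (resInv ρ H w (ρ g)) = ρ g := by
  have : ρ g = asAlgebraHom (ρ.comp H.subtype)
      (∑ i ∈ Finset.range w, groupAlgebraConj (γ ^ i) y) := by
    rw [map_sum]
    simp_rw [res_conj, ← hy]
    have : ∀ i, ρ (γ ^ i) * (ρ g * asAlgebraHom (ρ.comp H.subtype)
        (characterIdempotent σ.character)) * ρ (γ ^ i)⁻¹ =
        ρ g * asAlgebraHom (ρ.comp H.subtype) (conjIdempotent σ γ i) := by
      intro i
      rw [conjIdempotent, res_conj, ← mul_assoc, ← mul_assoc, ← mul_assoc, ← map_mul, ← map_mul,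
        (hg.pow_right i).eq]
    simp_rw [this]
    rw [← Finset.mul_sum, ← map_sum, h.res_sum_conjIdempotent, mul_one]
  rw [this, h.res_resInv_res]

theorem res_resInv_pow (h : IsCliffordPair ρ σ γ w) :
    asAlgebraHom (ρ.comp H.subtype) (resInv ρ H w (ρ (γ ^ w))) = ρ (γ ^ w) := by
  obtain ⟨y, -, hy, -⟩ := h.exists_res_eq
  exact h.res_resInv_of_sum hy ((Commute.refl γ).pow_left w)

theorem res_resInv_pow_inv (h : IsCliffordPair ρ σ γ w) :
    asAlgebraHom (ρ.comp H.subtype) (resInv ρ H w (ρ (γ ^ w)⁻¹)) = ρ (γ ^ w)⁻¹ := by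
  obtain ⟨-, y, -, hy⟩ := h.exists_res_eq
  exact h.res_resInv_of_sum hy ((Commute.refl γ).pow_left w).inv_left

end IsCliffordPair

end Representation

end

/-! ### Integral matrix units of the block of `η` -/

noncomputable section

/-- Matrix units of an absolutely irreducible block of `k[H]`, together with the component `c` in
`k[H]` of the central element `γ ^ w * c` of the block of `G` it generates. -/
structure CliffordUnits (k : Type*) [CommRing k] {G : Type*} [Group G] (H : Subgroup G) [H.Normal]
    (γ : G) (w d q : ℕ) where
  E : Fin d → Fin d → MonoidAlgebra k H
  c : MonoidAlgebra k H
  c' : MonoidAlgebra k H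
  d_pos : 0 < d
  E_ne_zero : ∀ a b, E a b ≠ 0
  E_mul_E : ∀ a b a' b', E a b * E a' b' = if b = a' then E a b' else 0
  E_mul_mul_E : ∀ a b a' b' x, ∃ τ : k, E a b * x * E a' b' = τ • E a b'
  commute : ∀ x, Commute (∑ a, E a a) x
  conj_pow : groupAlgebraConj (γ ^ w) (∑ a, E a a) = ∑ a, E a a
  conj_mul : ∀ i, ¬ w ∣ i → groupAlgebraConj (γ ^ i) (∑ a, E a a) * ∑ a, E a a = 0
  c_mul_c' : c * c' = ∑ i ∈ Finset.range w, groupAlgebraConj (γ ^ i) (∑ a, E a a)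
  c'_mul_c : c' * c = ∑ i ∈ Finset.range w, groupAlgebraConj (γ ^ i) (∑ a, E a a)
  c_mul : c * ∑ i ∈ Finset.range w, groupAlgebraConj (γ ^ i) (∑ a, E a a) = c
  c'_mul : c' * ∑ i ∈ Finset.range w, groupAlgebraConj (γ ^ i) (∑ a, E a a) = c'
  c_conj : groupAlgebraConj γ c = c
  c_mul_single : ∀ h : H, c * MonoidAlgebra.single h 1 =
    MonoidAlgebra.single (MulAut.conjNormal (γ ^ w)⁻¹ h) 1 * c
  c_pow : c ^ q = ∑ i ∈ Finset.range w, groupAlgebraConj (γ ^ i) (∑ a, E a a)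

section Integrality

variable {k F : Type*} [CommRing k] [Field F] [Algebra k F] {G : Type*} [Group G] {H : Subgroup G}

theorem exists_mapRingHom_eq {X : Type*} [Group X] [Fintype X] {f : X → F}
    (hf : ∀ x, f x ∈ (algebraMap k F).range) :
    ∃ y : MonoidAlgebra k X, MonoidAlgebra.mapRingHom X (algebraMap k F) y =
      ∑ x, MonoidAlgebra.single x (f x) := by
  choose a ha using hf
  refine ⟨∑ x, MonoidAlgebra.single x (a x), ?_⟩
  rw [map_sum]
  refine Finset.sum_congr rfl fun x _ => ?_
  rw [MonoidAlgebra.mapRingHom_single, ha]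

theorem mapRingHom_injective (X : Type*) [Group X] [IsDomain k] [IsFractionRing k F] :
    Function.Injective (MonoidAlgebra.mapRingHom X (algebraMap k F)) := by
  intro x y h
  ext g
  have := congrArg (fun z => z.coeff g) h
  exact IsFractionRing.injective k F (by simpa using this)

theorem mapRingHom_groupAlgebraConj [H.Normal] (g : G) (x : MonoidAlgebra k H) :
    MonoidAlgebra.mapRingHom H (algebraMap k F) (groupAlgebraConj g x) =
      groupAlgebraConj g (MonoidAlgebra.mapRingHom H (algebraMap k F) x) := by
  induction x using MonoidAlgebra.induction_linear with
  | zero => simp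
  | add x y hx hy => simp only [map_add, hx, hy]
  | single h r => simp

theorem mapRingHom_smul {X : Type*} [Group X] (r : k) (x : MonoidAlgebra k X) :
    MonoidAlgebra.mapRingHom X (algebraMap k F) (r • x) =
      algebraMap k F r • MonoidAlgebra.mapRingHom X (algebraMap k F) x := by
  ext g
  simp [Algebra.smul_def]

end Integrality

namespace Representation

section

variable {k F : Type*} [CommRing k] [IsDomain k] [IsPrincipalIdealRing k] [Field F] [CharZero F]
  [Algebra k F] [IsFractionRing k F] {G : Type*} [Group G]
  {V : Type*} [AddCommGroup V] [Module F V] [FiniteDimensional F V]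

-- The trace is computed in an integral basis.
variable (k) in
theorem character_mem_range (ρ : Representation F G V) (hfin : (Set.range ρ).Finite) (g : G) :
    ρ.character g ∈ (algebraMap k F).range := by
  obtain ⟨b, hb⟩ := exists_integral_basis k ρ hfin
  rw [character, LinearMap.trace_eq_matrix_trace F b, Matrix.trace]
  refine sum_mem fun i _ => ?_
  rw [Matrix.diag_apply, LinearMap.toMatrix_apply]
  exact hb g i i

end

namespace IsCliffordPair

variable {F : Type*} [Field F] [CharZero F] {G : Type*} [Group G] {H : Subgroup G} [H.Normal]
  [Fintype H] {V : Type*} [AddCommGroup V] [Module F V] [FiniteDimensional F V]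
  {W : Type*} [AddCommGroup W] [Module F W] [FiniteDimensional F W]
  {σ : Representation F H W} {γ : G} {ρ : Representation F G V} {w : ℕ}

theorem conj_resInv_one (h : IsCliffordPair ρ σ γ w) :
    groupAlgebraConj γ (resInv ρ H w 1) = resInv ρ H w 1 := by
  rw [h.resInv_one, map_sum, ← sum_range_succ_eq (conjIdempotent σ γ)]
  · refine Finset.sum_congr rfl fun i _ => ?_
    rw [conjIdempotent, ← groupAlgebraConj_mul, ← pow_succ', conjIdempotent]
  · rw [conjIdempotent, h.conj_pow, conjIdempotent_zero]

theorem resInv_one_commute (h : IsCliffordPair ρ σ γ w) (x : MonoidAlgebra F H) :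
    Commute (resInv ρ H w 1) x := by
  rw [h.resInv_one]
  exact Commute.sum_left _ _ _ fun i _ => conjIdempotent_commute σ γ i x

/-- The part of `F[H]` cut out by `resInv ρ H w 1` acts faithfully on `V`, so identities in it can
be checked in `End V`. -/
theorem eq_of_res_eq {x y : MonoidAlgebra F H}
    (hx : x * resInv ρ H w 1 = x) (hy : y * resInv ρ H w 1 = y)
    (hxy : asAlgebraHom (ρ.comp H.subtype) x = asAlgebraHom (ρ.comp H.subtype) y) : x = y := by
  rw [← hx, ← hy, ← resInv_res, ← resInv_res, hxy]

theorem resInv_mul_one {f : Module.End F V}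
    (hf : asAlgebraHom (ρ.comp H.subtype) (resInv ρ H w f) = f) :
    resInv ρ H w f * resInv ρ H w 1 = resInv ρ H w f := by
  rw [← resInv_res, hf]

/-- Integrality comes from `dim W / |H|` lying in `k`: the coefficients of the matrix units are this
ratio times matrix entries of `σ` in an integral basis, and those of `c` and `c'` are this ratio
times values of the character of `ρ`. The relations are verified over `F`, in `End W` or `End V`,
and descend because `k[H] → F[H]` is injective. -/
theorem exists_cliffordUnits (h : IsCliffordPair ρ σ γ w) (k : Type*) [CommRing k] [IsDomain k]
    [IsPrincipalIdealRing k] [Algebra k F] [IsFractionRing k F]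
    (hfin : (Set.range ρ).Finite)
    (hdeg : (Module.finrank F W : F) / Fintype.card H ∈ (algebraMap k F).range)
    {q : ℕ} (hq0 : 0 < q) (hq : ρ (γ ^ (w * q)) = 1) :
    ∃ D : CliffordUnits k H γ w (Module.finrank F W) q,
      MonoidAlgebra.mapRingHom H (algebraMap k F) D.c = resInv ρ H w (ρ (γ ^ w)⁻¹) ∧
      MonoidAlgebra.mapRingHom H (algebraMap k F) D.c' = resInv ρ H w (ρ (γ ^ w)) ∧
      MonoidAlgebra.mapRingHom H (algebraMap k F)
        (∑ i ∈ Finset.range w, groupAlgebraConj (γ ^ i) (∑ a, D.E a a)) = resInv ρ H w 1 := by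
  have := h.scalar'.1
  set j := MonoidAlgebra.mapRingHom H (algebraMap k F) with hj
  have hjinj : Function.Injective j := mapRingHom_injective H
  have hjsmul : ∀ (r : k) x, j (r • x) = algebraMap k F r • j x := mapRingHom_smul
  have hjconj : ∀ (g : G) x, j (groupAlgebraConj g x) = groupAlgebraConj g (j x) :=
    mapRingHom_groupAlgebraConj
  obtain ⟨b, hb⟩ := exists_integral_basis k σ (Set.finite_range σ)
  let M : Fin (Module.finrank F W) → Fin (Module.finrank F W) → Module.End F W :=
    fun a a' => (b.coord a').smulRight (b a)
  have hMmul : ∀ a a' f a1 a1', M a a' * f * M a1 a1' = (b.coord a' (f (b a1))) • M a a1' := by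
    intro a a' f a1 a1'
    ext v
    simp only [M, Module.End.mul_apply, LinearMap.smulRight_apply, map_smul, LinearMap.smul_apply,
      smul_smul]
    ring_nf
  have hM1 : ∑ a, M a a = 1 := by
    ext v
    rw [LinearMap.sum_apply]
    simp only [M, LinearMap.smulRight_apply, Module.Basis.coord_apply, Module.End.one_apply]
    exact b.sum_repr v
  have hE : ∀ a a', ∃ x, j x = fourierInv σ (M a a') := by
    intro a a'
    rw [fourierInv_apply]
    refine exists_mapRingHom_eq fun x => mul_mem hdeg ?_
    have : M a a' * σ x⁻¹ = ((b.coord a').comp (σ x⁻¹)).smulRight (b a) := by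
      ext v; simp [M]
    rw [this, LinearMap.trace_smulRight]
    exact hb _ _ _
  choose E hE using hE
  -- The factor `w⁻¹` in `resInv` cancels against `dim V = w dim W`, leaving the integral ratio `dim
  -- W / |H|`.
  have hint : ∀ g : G, ∃ x, j x = resInv ρ H w (ρ g) := by
    intro g
    have hw : (w : F) ≠ 0 := Nat.cast_ne_zero.mpr h.pos.ne'
    have : resInv ρ H w (ρ g) = ∑ x : H, MonoidAlgebra.single x
        ((Module.finrank F W : F) / Fintype.card H * ρ.character (g * (x⁻¹ : H))) := by
      rw [resInv, LinearMap.smul_apply, fourierInv_apply, Finset.smul_sum]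
      refine Finset.sum_congr rfl fun x _ => ?_
      have hx : ρ (g * (x⁻¹ : H)) = ρ g * (ρ.comp H.subtype) x⁻¹ := map_mul ρ _ _
      rw [MonoidAlgebra.smul_single, smul_eq_mul, h.finrank_eq, character, hx]
      congr 1
      push_cast
      rw [← mul_assoc]
      congr 1
      field_simp
    rw [this]
    exact exists_mapRingHom_eq fun x => mul_mem hdeg (character_mem_range k ρ hfin _)
  obtain ⟨c, hc⟩ := hint (γ ^ w)⁻¹
  obtain ⟨c', hc'⟩ := hint (γ ^ w)
  have hsum : j (∑ a, E a a) = characterIdempotent σ.character := by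
    rw [map_sum]
    simp_rw [hE]
    rw [← map_sum, hM1, fourierInv_one]
  have hε : j (∑ i ∈ Finset.range w, groupAlgebraConj (γ ^ i) (∑ a, E a a)) = resInv ρ H w 1 := by
    rw [map_sum, h.resInv_one]
    refine Finset.sum_congr rfl fun i _ => ?_
    rw [hjconj, hsum, conjIdempotent]
  have hρ : ρ (γ ^ w) * ρ (γ ^ w)⁻¹ = 1 := by rw [← map_mul, mul_inv_cancel, map_one]
  have hρ' : ρ (γ ^ w)⁻¹ * ρ (γ ^ w) = 1 := by rw [← map_mul, inv_mul_cancel, map_one]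
  have hcE := resInv_mul_one h.res_resInv_pow_inv
  have hc'E := resInv_mul_one h.res_resInv_pow
  have h1E : resInv ρ H w 1 * resInv ρ H w 1 = resInv ρ H w 1 :=
    resInv_mul_one h.res_resInv_one
  refine ⟨{
      E := E, c := c, c' := c', d_pos := Module.finrank_pos,
      E_ne_zero := ?_, E_mul_E := ?_, E_mul_mul_E := ?_, commute := ?_, conj_pow := ?_,
      conj_mul := ?_, c_mul_c' := ?_, c'_mul_c := ?_, c_mul := ?_,
      c'_mul := ?_, c_conj := ?_, c_mul_single := ?_, c_pow := ?_ }, hc, hc', hε⟩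
  · intro a a' h0
    have h1 := hE a a'
    rw [h0, map_zero, ← map_zero (fourierInv σ)] at h1
    have h2 := DFunLike.congr_fun (fourierInv_injective h.scalar' h1) (b a')
    simp only [M, LinearMap.zero_apply, LinearMap.smulRight_apply, Module.Basis.coord_apply,
      Module.Basis.repr_self, Finsupp.single_eq_same, one_smul] at h2
    exact b.ne_zero a h2.symm
  · intro a a' a1 a1'
    apply hjinj
    have := hMmul a a' 1 a1 a1'
    rw [map_mul, hE, hE, ← fourierInv_mul h.scalar', ← mul_one (M a a'), this]
    rw [Module.End.one_apply, Module.Basis.coord_apply, Module.Basis.repr_self,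
      Finsupp.single_apply]
    by_cases hx : a1 = a'
    · rw [if_pos hx, if_pos hx.symm, one_smul, hE]
    · rw [if_neg hx, if_neg (Ne.symm hx), zero_smul, map_zero, map_zero]
  · intro a a' a1 a1' x
    have hx : b.coord a' (asAlgebraHom σ (j x) (b a1)) ∈ (algebraMap k F).range := by
      induction x using MonoidAlgebra.induction_linear with
      | zero => simp
      | add x y hx hy => rw [map_add, map_add, LinearMap.add_apply, map_add]; exact add_mem hx hy
      | single g r =>
        rw [hj, MonoidAlgebra.mapRingHom_single, asAlgebraHom_single, LinearMap.smul_apply, map_smul]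
        exact mul_mem ⟨r, rfl⟩ (hb g a' a1)
    obtain ⟨τ, hτ⟩ := hx
    refine ⟨τ, hjinj ?_⟩
    rw [map_mul, map_mul, hjsmul, hE, hE, hE, ← fourierInv_mul_asAlgebraHom,
      ← fourierInv_mul h.scalar', hMmul, ← hτ, map_smul]
  · intro x
    apply hjinj
    rw [map_mul, map_mul, hsum]
    exact characterIdempotent_commute σ _
  · apply hjinj
    rw [hjconj, hsum, h.conj_pow]
  · intro i hi
    apply hjinj
    rw [map_mul, hjconj, hsum, map_zero]
    exact h.conjIdempotent_mul_base hi
  · apply hjinj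
    rw [hε, map_mul, hc, hc']
    refine eq_of_res_eq (ρ := ρ) (w := w) (by rw [mul_assoc, hc'E]) h1E ?_
    rw [map_mul, h.res_resInv_pow_inv, h.res_resInv_pow, h.res_resInv_one, hρ']
  · apply hjinj
    rw [hε, map_mul, hc, hc']
    refine eq_of_res_eq (ρ := ρ) (w := w) (by rw [mul_assoc, hcE]) h1E ?_
    rw [map_mul, h.res_resInv_pow_inv, h.res_resInv_pow, h.res_resInv_one, hρ]
  · apply hjinj
    rw [map_mul, hε, hc, hcE]
  · apply hjinj
    rw [map_mul, hε, hc', hc'E]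
  · apply hjinj
    rw [hjconj, hc]
    refine eq_of_res_eq (ρ := ρ) (w := w) ?_ hcE ?_
    · conv_lhs => rw [← h.conj_resInv_one]
      rw [← map_mul, hcE]
    · rw [res_conj, h.res_resInv_pow_inv, ← map_mul, ← map_mul]
      congr 1
      group
  · intro x
    apply hjinj
    rw [map_mul, map_mul, hc, hj, MonoidAlgebra.mapRingHom_single, MonoidAlgebra.mapRingHom_single,
      map_one]
    refine eq_of_res_eq (ρ := ρ) (w := w) ?_ (by rw [mul_assoc, hcE]) ?_
    · rw [mul_assoc, ← (h.resInv_one_commute _).eq, ← mul_assoc, hcE]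
    · rw [map_mul, map_mul, h.res_resInv_pow_inv, res_single, res_single, ← map_mul, ← map_mul,
        MulAut.conjNormal_apply]
      congr 1
      group
  · apply hjinj
    -- `c ^ q` acts as the inverse of `ρ (γ ^ (w * q)) = 1`. Positivity of `q` ensures that `c ^ q`
    -- lies in the block.
    rw [hε, map_pow, hc]
    obtain ⟨q, rfl⟩ := Nat.exists_eq_succ_of_ne_zero hq0.ne'
    refine eq_of_res_eq (ρ := ρ) (w := w) (by rw [pow_succ, mul_assoc, hcE]) h1E ?_
    rw [map_pow, h.res_resInv_pow_inv, h.res_resInv_one, ← map_pow, inv_pow, ← pow_mul]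
    have h2 : ρ (γ ^ (w * q.succ)) * ρ (γ ^ (w * q.succ))⁻¹ = 1 := by
      rw [← map_mul, mul_inv_cancel, map_one]
    rwa [hq, one_mul] at h2

end IsCliffordPair

end Representation

end

/-! ### Matrix units and the central unit of the block of `G` -/

noncomputable section

namespace CliffordUnits

variable {k : Type*} [CommRing k] {G : Type*} [Group G] {H : Subgroup G} [H.Normal]
  {γ : G} {w d q : ℕ} (D : CliffordUnits k H γ w d q)

/-- The central idempotent of `k[H]` underlying the matrix units. -/
def base : MonoidAlgebra k H := ∑ a, D.E a a

/-- The sum of the conjugates of `D.base`, a central idempotent for all of `G`. -/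
def idem : MonoidAlgebra k H := ∑ i ∈ Finset.range w, groupAlgebraConj (γ ^ i) D.base

theorem E_mul_base (a b : Fin d) : D.E a b * D.base = D.E a b := by
  simp [base, Finset.mul_sum, D.E_mul_E]

theorem base_mul_E (a b : Fin d) : D.base * D.E a b = D.E a b := by
  rw [base, Finset.sum_mul, Finset.sum_eq_single a]
  · rw [D.E_mul_E, if_pos rfl]
  · intro a' _ h
    rw [D.E_mul_E, if_neg h]
  · intro h; exact absurd (Finset.mem_univ a) h

theorem base_mul_base : D.base * D.base = D.base := by
  have : (∑ a, D.E a a) * D.base = ∑ a, D.E a a := by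
    rw [Finset.sum_mul]
    exact Finset.sum_congr rfl fun a _ => D.E_mul_base a a
  exact this

theorem base_commute (x : MonoidAlgebra k H) : Commute D.base x := D.commute x

theorem conj_base_commute (g : G) (x : MonoidAlgebra k H) :
    Commute (groupAlgebraConj g D.base) x := by
  have := (D.base_commute (groupAlgebraConj g⁻¹ x)).map (groupAlgebraConj (R := k) g)
  rwa [groupAlgebraConj_apply_inv] at this

theorem idem_commute (x : MonoidAlgebra k H) : Commute D.idem x :=
  Commute.sum_left _ _ _ fun _ _ => D.conj_base_commute _ x

theorem idem_mul_idem : D.idem * D.idem = D.idem := by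
  calc D.idem * D.idem = D.c * D.c' * D.idem := congrArg (· * D.idem) D.c_mul_c'.symm
    _ = D.c * D.c' := by rw [mul_assoc]; exact congrArg _ D.c'_mul
    _ = D.idem := D.c_mul_c'

theorem conj_idem : groupAlgebraConj γ D.idem = D.idem := by
  rw [idem, map_sum, ← Representation.IsCliffordPair.sum_range_succ_eq
    (fun i => groupAlgebraConj (γ ^ i) D.base)]
  · refine Finset.sum_congr rfl fun i _ => ?_
    rw [← groupAlgebraConj_mul, ← pow_succ']
  · change groupAlgebraConj (γ ^ w) D.base = groupAlgebraConj (γ ^ 0) D.base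
    rw [pow_zero, groupAlgebraConj_one]
    exact D.conj_pow

theorem conj_pow_of_conj {x : MonoidAlgebra k H} (hx : groupAlgebraConj γ x = x) (i : ℕ) :
    groupAlgebraConj (γ ^ i) x = x := by
  induction i with
  | zero => simp
  | succ i ih => rw [pow_succ, groupAlgebraConj_mul, hx, ih]

theorem idem_mul_base (hw : 0 < w) : D.idem * D.base = D.base := by
  rw [idem, Finset.sum_mul, Finset.sum_eq_single 0]
  · rw [pow_zero, groupAlgebraConj_one, D.base_mul_base]
  · intro i hi h0
    exact D.conj_mul i fun h =>
      h0 (Nat.eq_zero_of_dvd_of_lt h (Finset.mem_range.mp hi))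
  · intro h; exact absurd (Finset.mem_range.mpr hw) h

theorem base_ne_zero : D.base ≠ 0 := by
  intro h
  refine D.E_ne_zero ⟨0, D.d_pos⟩ ⟨0, D.d_pos⟩ ?_
  rw [← D.base_mul_E, h, zero_mul]

section Hom

variable {A : Type*} [Ring A] [Algebra k A] (φ : G →* A)

/-- The extension of `φ` to the group algebra of `H`. -/
abbrev hom (_ : CliffordUnits k H γ w d q) : MonoidAlgebra k H →ₐ[k] A :=
  MonoidAlgebra.lift k A H (φ.comp H.subtype)

theorem hom_conj_mul (g : G) (x : MonoidAlgebra k H) :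
    D.hom φ (groupAlgebraConj g x) * φ g = φ g * D.hom φ x :=
  lift_groupAlgebraConj_mul φ g x

theorem hom_conj_inv_mul (g : G) (x : MonoidAlgebra k H) :
    D.hom φ x * φ g⁻¹ = φ g⁻¹ * D.hom φ (groupAlgebraConj g x) := by
  rw [← hom_conj_mul, groupAlgebraConj_inv_apply]

theorem map_mul_map_inv (g : G) : φ g * φ g⁻¹ = 1 := by rw [← map_mul, mul_inv_cancel, map_one]

theorem map_inv_mul_map (g : G) : φ g⁻¹ * φ g = 1 := by rw [← map_mul, inv_mul_cancel, map_one]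

theorem commute_pow_of_conj {x : MonoidAlgebra k H} (hx : groupAlgebraConj γ x = x) (i : ℕ) :
    Commute (φ (γ ^ i)) (D.hom φ x) := by
  have := D.hom_conj_mul φ (γ ^ i) x
  rw [conj_pow_of_conj hx] at this
  exact this.symm

/-- The central idempotent `ε` of the block. -/
def eps : A := D.hom φ D.idem

/-- The central unit `γ ^ w * c` of the block. -/
def unit : A := φ (γ ^ w) * D.hom φ D.c

/-- The inverse of the central unit of the block. -/
def unitInv : A := D.hom φ D.c' * φ (γ ^ w)⁻¹

theorem unit_mul_unitInv : D.unit φ * D.unitInv φ = D.eps φ := by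
  rw [unit, unitInv, mul_assoc, ← mul_assoc (D.hom φ D.c), ← map_mul]
  rw [show D.c * D.c' = D.idem from D.c_mul_c', ← mul_assoc,
    (D.commute_pow_of_conj φ D.conj_idem w).eq, mul_assoc, map_mul_map_inv, mul_one, eps]

theorem unitInv_mul_unit : D.unitInv φ * D.unit φ = D.eps φ := by
  rw [unit, unitInv, mul_assoc, ← mul_assoc (φ _), map_inv_mul_map, one_mul, ← map_mul]
  exact congrArg _ D.c'_mul_c

theorem eps_mul_eps : D.eps φ * D.eps φ = D.eps φ := by
  rw [eps, ← map_mul, idem_mul_idem]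

theorem unit_mul_eps : D.unit φ * D.eps φ = D.unit φ := by
  rw [unit, eps, mul_assoc, ← map_mul]
  congr 2
  exact D.c_mul

theorem eps_commute_hom (x : MonoidAlgebra k H) : Commute (D.eps φ) (D.hom φ x) :=
  (D.idem_commute x).map (D.hom φ)

theorem eps_commute_pow (i : ℕ) : Commute (D.eps φ) (φ (γ ^ i)) :=
  (D.commute_pow_of_conj φ D.conj_idem i).symm

theorem unit_commute_pow (i : ℕ) : Commute (D.unit φ) (φ (γ ^ i)) := by
  refine Commute.mul_left ?_ (D.commute_pow_of_conj φ D.c_conj i).symm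
  rw [Commute, SemiconjBy, ← map_mul, ← map_mul, ← pow_add, ← pow_add, add_comm]

theorem unit_commute_hom (x : MonoidAlgebra k H) : Commute (D.unit φ) (D.hom φ x) := by
  induction x using MonoidAlgebra.induction_linear with
  | zero => rw [map_zero]; exact Commute.zero_right _
  | add x y hx hy => rw [map_add]; exact hx.add_right hy
  | single h r =>
    rw [show MonoidAlgebra.single h r = r • MonoidAlgebra.single h (1 : k) by
      rw [MonoidAlgebra.smul_single, smul_eq_mul, mul_one], map_smul]
    refine Commute.smul_right ?_ r
    rw [Commute, SemiconjBy, unit, mul_assoc, ← map_mul, D.c_mul_single, map_mul, ← mul_assoc,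
      ← D.hom_conj_mul, groupAlgebraConj_single, ← MulAut.mul_apply, ← map_mul, mul_inv_cancel,
      map_one, MulAut.one_apply, mul_assoc]

theorem eps_commute_unit : Commute (D.eps φ) (D.unit φ) := (D.unit_commute_hom φ _).symm

theorem unit_pow : D.unit φ ^ q = φ (γ ^ (w * q)) * D.eps φ := by
  rw [unit, (D.commute_pow_of_conj φ D.c_conj w).mul_pow, ← map_pow, ← map_pow, ← pow_mul]
  congr 2
  exact D.c_pow

theorem unit_mul_hom_c' : D.unit φ * D.hom φ D.c' = φ (γ ^ w) * D.eps φ := by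
  rw [unit, mul_assoc, ← map_mul]
  congr 2
  exact D.c_mul_c'

/-- In the block, `γ ^ (w * s)` can be traded for the `s`-th power of the central unit times an
element of `k[H]`; this reduces the corners to polynomials in that unit. -/
theorem unit_pow_mul_hom_c'_pow (s : ℕ) :
    D.unit φ ^ s * D.hom φ (D.c' ^ s) * D.eps φ = φ (γ ^ (w * s)) * D.eps φ := by
  induction s with
  | zero => simp
  | succ s ih =>
    have h1 := D.unit_mul_hom_c' φ
    have h2 := (D.unit_commute_hom φ (D.c' ^ s)).eq
    calc D.unit φ ^ (s + 1) * D.hom φ (D.c' ^ (s + 1)) * D.eps φ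
        = D.unit φ ^ s * (D.unit φ * D.hom φ (D.c' ^ s)) * D.hom φ D.c' * D.eps φ := by
          rw [pow_succ, pow_succ, map_mul]; simp only [mul_assoc]
      _ = D.unit φ ^ s * D.hom φ (D.c' ^ s) * (D.unit φ * D.hom φ D.c') * D.eps φ := by
          rw [h2]; simp only [mul_assoc]
      _ = (D.unit φ ^ s * D.hom φ (D.c' ^ s) * D.eps φ) * φ (γ ^ w) := by
          rw [h1, mul_assoc, mul_assoc (φ _), eps_mul_eps, ← (D.eps_commute_pow φ w).eq, mul_assoc]
          simp only [mul_assoc]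
      _ = φ (γ ^ (w * (s + 1))) * D.eps φ := by
          rw [ih, mul_assoc, (D.eps_commute_pow φ w).eq, ← mul_assoc, ← map_mul, ← pow_add, mul_add,
            mul_one]

/-- The matrix units of the block. -/
def unitE (x y : Fin w × Fin d) : A := φ (γ ^ (x.1 : ℕ)) * D.hom φ (D.E x.2 y.2) * φ (γ ^ (y.1 : ℕ))⁻¹

theorem base_mul_pow_mul_base {s : ℕ} (hs : ¬ w ∣ s) :
    D.hom φ D.base * φ (γ ^ s) * D.hom φ D.base = 0 := by
  rw [mul_assoc, ← D.hom_conj_mul, ← mul_assoc, ← map_mul, ← (D.conj_base_commute _ _).eq,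
    show groupAlgebraConj (γ ^ s) D.base * D.base = 0 from D.conj_mul s hs, map_zero, zero_mul]

theorem base_mul_pow_inv_mul_base {s : ℕ} (hs : ¬ w ∣ s) :
    D.hom φ D.base * φ (γ ^ s)⁻¹ * D.hom φ D.base = 0 := by
  rw [D.hom_conj_inv_mul, mul_assoc, ← map_mul,
    show groupAlgebraConj (γ ^ s) D.base * D.base = 0 from D.conj_mul s hs, map_zero, mul_zero]

/-- When the inner exponents of `γ` agree they cancel and the relation is the one in `k[H]`.
Otherwise a power of `γ` with exponent strictly between `0` and `w` in absolute value stands between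
two copies of `D.base`, and conjugate idempotents are orthogonal. -/
theorem unitE_mul_unitE (x y x' y' : Fin w × Fin d) :
    D.unitE φ x y * D.unitE φ x' y' = if y = x' then D.unitE φ x y' else 0 := by
  obtain ⟨i, a⟩ := x
  obtain ⟨j, b⟩ := y
  obtain ⟨i', a'⟩ := x'
  obtain ⟨j', b'⟩ := y'
  have key : D.unitE φ (i, a) (j, b) * D.unitE φ (i', a') (j', b') = φ (γ ^ (i : ℕ)) *
      (D.hom φ (D.E a b) * φ ((γ ^ (j : ℕ))⁻¹ * γ ^ (i' : ℕ)) * D.hom φ (D.E a' b')) *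
      φ (γ ^ (j' : ℕ))⁻¹ := by
    simp only [unitE, map_mul, mul_assoc]
  rw [key]
  by_cases hij : j = i'
  · subst hij
    rw [inv_mul_cancel, map_one, mul_one, ← map_mul, D.E_mul_E]
    by_cases hab : b = a'
    · subst hab
      simp [unitE]
    · simp [hab]
  · rw [if_neg fun h => hij (congrArg Prod.fst h), ← D.E_mul_base a b, ← D.base_mul_E a' b',
      map_mul (D.hom φ), map_mul (D.hom φ)]
    have hz : D.hom φ D.base * φ ((γ ^ (j : ℕ))⁻¹ * γ ^ (i' : ℕ)) * D.hom φ D.base = 0 := by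
      have hne : (j : ℕ) ≠ i' := fun h => hij (Fin.ext h)
      have hj := j.2
      have hi := i'.2
      rcases lt_or_gt_of_ne hne with h | h
      · obtain ⟨s, hs⟩ := Nat.exists_eq_add_of_lt h
        rw [hs, add_assoc, pow_add, inv_mul_cancel_left]
        exact D.base_mul_pow_mul_base φ fun h => by
          have := Nat.le_of_dvd (Nat.succ_pos s) h
          omega
      · obtain ⟨s, hs⟩ := Nat.exists_eq_add_of_lt h
        rw [hs, add_assoc, pow_add, mul_inv_rev, inv_mul_cancel_right]
        exact D.base_mul_pow_inv_mul_base φ fun h => by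
          have := Nat.le_of_dvd (Nat.succ_pos s) h
          omega
    have : ∀ x y z t u : A, x * y * z * (u * t) = x * (y * z * u) * t := fun x y z t u => by
      simp only [mul_assoc]
    rw [this, hz, mul_zero, zero_mul, mul_zero, zero_mul]

theorem sum_unitE : ∑ x, D.unitE φ x x = D.eps φ := by
  rw [Fintype.sum_prod_type, eps, idem, map_sum, ← Fin.sum_univ_eq_sum_range
    (fun i => D.hom φ (groupAlgebraConj (γ ^ i) D.base))]
  refine Finset.sum_congr rfl fun i _ => ?_
  rw [hom, lift_groupAlgebraConj, base, map_sum, Finset.mul_sum, Finset.sum_mul]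
  rfl

theorem unit_commute_unitE (x y : Fin w × Fin d) : Commute (D.unit φ) (D.unitE φ x y) := by
  refine ((D.unit_commute_pow φ _).mul_right (D.unit_commute_hom φ _)).mul_right ?_
  have h := D.unit_commute_pow φ y.1
  have h1 := map_mul_map_inv φ (γ ^ (y.1 : ℕ))
  have h2 := map_inv_mul_map φ (γ ^ (y.1 : ℕ))
  calc D.unit φ * φ (γ ^ (y.1 : ℕ))⁻¹
      = φ (γ ^ (y.1 : ℕ))⁻¹ * (φ (γ ^ (y.1 : ℕ)) * D.unit φ) * φ (γ ^ (y.1 : ℕ))⁻¹ := by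
        rw [← mul_assoc, h2, one_mul]
    _ = φ (γ ^ (y.1 : ℕ))⁻¹ * D.unit φ := by
        rw [← h.eq, mul_assoc, mul_assoc, h1, mul_one]

/-- The corner of the algebra at a diagonal matrix unit consists of polynomials in the central
unit. -/
theorem exists_aeval_corner (hw : 0 < w) (a : Fin d)
    {y : A} (hy : y ∈ Submodule.span k {y | ∃ (h : H) (i : ℕ), y = φ h * φ (γ ^ i)}) :
    ∃ Q : Polynomial k, D.hom φ (D.E a a) * y * D.hom φ (D.E a a) =
      Polynomial.aeval (D.unit φ) Q * D.hom φ (D.E a a) := by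
  induction hy using Submodule.span_induction with
  | zero => exact ⟨0, by simp⟩
  | add y z _ _ hy hz =>
    obtain ⟨Q, hQ⟩ := hy
    obtain ⟨Q', hQ'⟩ := hz
    exact ⟨Q + Q', by rw [mul_add, add_mul, hQ, hQ', map_add, add_mul]⟩
  | smul r y _ hy =>
    obtain ⟨Q, hQ⟩ := hy
    exact ⟨r • Q, by rw [mul_smul_comm, smul_mul_assoc, hQ, map_smul, smul_mul_assoc]⟩
  | mem y hy =>
    obtain ⟨h, i, rfl⟩ := hy
    have hh : φ h = D.hom φ (MonoidAlgebra.single h 1) := by simp [hom, MonoidAlgebra.lift_single]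
    -- If `w` divides `i`, the power of `γ` becomes a power of the central unit times an element of
    -- `k[H]`, and corners of `k[H]` are scalar. Otherwise orthogonality of conjugates kills the
    -- term.
    by_cases hi : w ∣ i
    · obtain ⟨s, rfl⟩ := hi
      obtain ⟨τ, hτ⟩ := D.E_mul_mul_E a a a a (MonoidAlgebra.single h 1 * D.c' ^ s)
      have heps : D.eps φ * D.hom φ (D.E a a) = D.hom φ (D.E a a) := by
        rw [eps, ← map_mul, ← D.base_mul_E, ← mul_assoc, D.idem_mul_base hw]
      refine ⟨τ • Polynomial.X ^ s, ?_⟩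
      have h1 := D.unit_pow_mul_hom_c'_pow φ s
      have h2 := ((D.unit_commute_hom φ (D.E a a * MonoidAlgebra.single h 1)).pow_left s).eq
      calc D.hom φ (D.E a a) * (φ h * φ (γ ^ (w * s))) * D.hom φ (D.E a a)
          = D.hom φ (D.E a a * MonoidAlgebra.single h 1) *
            (φ (γ ^ (w * s)) * D.eps φ) * D.hom φ (D.E a a) := by
              rw [mul_assoc _ (φ (γ ^ (w * s)) * _), mul_assoc (φ (γ ^ (w * s))), heps, hh]
              simp only [map_mul (D.hom φ), mul_assoc]
        _ = D.unit φ ^ s * D.hom φ (D.E a a * (MonoidAlgebra.single h 1 * D.c' ^ s) * D.E a a) := by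
              rw [← h1, ← mul_assoc, ← mul_assoc, ← h2, mul_assoc _ (D.eps φ), heps]
              simp only [map_mul (D.hom φ), mul_assoc]
        _ = Polynomial.aeval (D.unit φ) (τ • Polynomial.X ^ s) * D.hom φ (D.E a a) := by
              rw [hτ, map_smul, map_smul, Polynomial.aeval_X_pow, smul_mul_assoc, mul_smul_comm]
    · refine ⟨0, ?_⟩
      have h1 := D.base_mul_pow_mul_base φ hi
      have h2 := ((D.base_commute (MonoidAlgebra.single h 1)).map (D.hom φ)).eq
      calc D.hom φ (D.E a a) * (φ h * φ (γ ^ i)) * D.hom φ (D.E a a)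
          = D.hom φ (D.E a a * D.base) * (D.hom φ (MonoidAlgebra.single h 1) * φ (γ ^ i)) *
              D.hom φ (D.base * D.E a a) := by rw [D.E_mul_base, D.base_mul_E, hh]
        _ = D.hom φ (D.E a a) * (D.hom φ D.base * D.hom φ (MonoidAlgebra.single h 1)) *
              φ (γ ^ i) * D.hom φ D.base * D.hom φ (D.E a a) := by
              simp only [map_mul (D.hom φ), mul_assoc]
        _ = D.hom φ (D.E a a) * D.hom φ (MonoidAlgebra.single h 1) *
              (D.hom φ D.base * φ (γ ^ i) * D.hom φ D.base) * D.hom φ (D.E a a) := by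
              rw [h2]; simp only [mul_assoc]
        _ = _ := by rw [h1, mul_zero, zero_mul, map_zero, zero_mul]

/-- The centralizer of the matrix units in the block consists of polynomials in the central unit. -/
theorem exists_aeval_of_commute (hw : 0 < w) {z : A}
    (hz : z ∈ Submodule.span k {y | ∃ (h : H) (i : ℕ), y = φ h * φ (γ ^ i)})
    (hez : D.eps φ * z = z) (hcomm : ∀ x y, Commute z (D.unitE φ x y)) :
    ∃ Q : Polynomial k, z = Polynomial.aeval (D.unit φ) Q * D.eps φ := by
  let x₀ : Fin w × Fin d := (⟨0, hw⟩, ⟨0, D.d_pos⟩)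
  obtain ⟨Q, hQ⟩ := D.exists_aeval_corner φ hw x₀.2 hz
  have hx₀ : D.hom φ (D.E x₀.2 x₀.2) = D.unitE φ x₀ x₀ := by simp [unitE, x₀]
  have hQc : ∀ x y, Commute (Polynomial.aeval (D.unit φ) Q) (D.unitE φ x y) := fun x y => by
    rw [Polynomial.aeval_eq_sum_range]
    exact Commute.sum_left _ _ _ fun i _ =>
      ((D.unit_commute_unitE φ x y).pow_left i).smul_left _
  rw [hx₀] at hQ
  refine ⟨Q, ?_⟩
  -- An element commuting with the matrix units is determined by its corner at one diagonal unit,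
  -- which is spread along the diagonal.
  calc z = ∑ x, D.unitE φ x x * z := by rw [← Finset.sum_mul, sum_unitE, hez]
    _ = ∑ x, D.unitE φ x x₀ * (D.unitE φ x₀ x₀ * z * D.unitE φ x₀ x₀) * D.unitE φ x₀ x := by
      refine Finset.sum_congr rfl fun x _ => ?_
      rw [mul_assoc (D.unitE φ x₀ x₀), (hcomm x₀ x₀).eq, ← mul_assoc (D.unitE φ x₀ x₀),
        unitE_mul_unitE, if_pos rfl, ← mul_assoc, unitE_mul_unitE, if_pos rfl, mul_assoc,
        (hcomm x₀ x).eq, ← mul_assoc, unitE_mul_unitE, if_pos rfl]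
    _ = ∑ x, Polynomial.aeval (D.unit φ) Q * D.unitE φ x x := by
      refine Finset.sum_congr rfl fun x _ => ?_
      rw [hQ, ← mul_assoc, ← (hQc x x₀).eq, mul_assoc, mul_assoc, unitE_mul_unitE, if_pos rfl,
        unitE_mul_unitE, if_pos rfl]
    _ = _ := by rw [← Finset.mul_sum, sum_unitE]

end Hom

end CliffordUnits

end

/-! ### Linear independence and unipotence in the completed group algebra -/

noncomputable section

open scoped PowerSeries PowerSeries.WithPiTopology
open IsLocalRing CompletedGroupAlgebra

/-- The images of `γ` and the finite normal subgroup `H` generate every finite quotient of `G`, and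
`γ` topologically generates a copy of `ℤ_p` that meets `H` trivially. -/
structure IsProcyclicComplement {G : Type*} [Group G] [TopologicalSpace G] (p : ℕ)
    (H : Subgroup G) (γ : G) : Prop where
  exists_mk_eq : ∀ (N : OpenNormalSubgroup G) (g : G),
    ∃ (h : H) (i : ℕ), (QuotientGroup.mk g : G ⧸ N.toSubgroup) = QuotientGroup.mk (h * γ ^ i)
  exists_pow_mem : ∀ N : OpenNormalSubgroup G, ∃ a, γ ^ p ^ a ∈ N
  eq_zero_of_pow_mem : ∀ i : ℕ, γ ^ i ∈ H → i = 0

theorem PowerSeries.algHom_coe {k B : Type*} [CommRing k] [Ring B] [Algebra k B] (φ : k⟦X⟧ →ₐ[k] B)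
    (Q : Polynomial k) : φ Q = Polynomial.aeval (φ PowerSeries.X) Q := by
  have : φ.comp (Polynomial.coeToPowerSeries.algHom k) = Polynomial.aeval (φ PowerSeries.X) := by
    ext; simp
  simpa using DFunLike.congr_fun this Q

theorem PowerSeries.exists_eq_aeval {k : Type*} [CommRing k] [IsLocalRing k]
    [IsAdicComplete (maximalIdeal k) k] {p : ℕ} [Fact p.Prime] (hpk : (p : k) ∈ maximalIdeal k)
    {B : Type*} [Ring B] [Algebra k B] (φ : k⟦X⟧ →ₐ[k] B) {a : ℕ}
    (ha : (1 + φ PowerSeries.X) ^ p ^ a = 1) (f : k⟦X⟧) :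
    ∃ r : Polynomial k, φ f = Polynomial.aeval (φ PowerSeries.X) r := by
  obtain ⟨g, r, hf, -⟩ := exists_omegaPoly_division hpk a f
  refine ⟨r, ?_⟩
  rw [hf, map_add, map_mul, algHom_coe, algHom_coe, aeval_omegaPoly, ha, sub_self, zero_mul, zero_add]

/-- Only the trivial power of `γ` lies in `H`, so the elements `γ ^ e i * h` are distinct. Finitely
many of them are separated at one finite level, where the coefficients can be read off. -/
theorem eq_zero_of_sum_pow_mul_lift {k : Type*} [CommRing k] {G : Type*} [Group G]
    [TopologicalSpace G] [IsTopologicalGroup G] [CompactSpace G] [T2Space G]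
    [TotallyDisconnectedSpace G] {H : Subgroup G} [Fintype H] {γ : G}
    (hγ : ∀ i : ℕ, γ ^ i ∈ H → i = 0) {e : ℕ → ℕ} (he : Function.Injective e) {n : ℕ}
    {f : ℕ → MonoidAlgebra k H} (h : ∑ i ∈ Finset.range n, of k G (γ ^ e i) *
      MonoidAlgebra.lift k (CompletedGroupAlgebra k G) H ((of k G).comp H.subtype) (f i) = 0)
    {i : ℕ} (hi : i < n) : f i = 0 := by
  classical
  let t : Finset (ℕ × H) := Finset.range n ×ˢ Finset.univ
  obtain ⟨N, hN⟩ := exists_openNormalSubgroup_avoiding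
    (((t ×ˢ t).image fun x => (γ ^ e x.1.1 * x.1.2 : G)⁻¹ * (γ ^ e x.2.1 * x.2.2)).erase 1)
    (Finset.notMem_erase 1 _)
  have hle : ∀ a b : ℕ, ∀ x y : H, γ ^ a * (x : G) = γ ^ b * y → a ≤ b → a = b := by
    intro a b x y hxy hab
    obtain ⟨s, rfl⟩ := Nat.exists_eq_add_of_le hab
    rw [pow_add, mul_assoc] at hxy
    have h1 := mul_left_cancel hxy
    have : γ ^ s = ((x * y⁻¹ : H) : G) := by
      rw [Subgroup.coe_mul, h1, Subgroup.coe_inv, mul_inv_cancel_right]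
    rw [hγ s (this ▸ (x * y⁻¹).2), add_zero]
  have hinj : ∀ i < n, ∀ j < n, ∀ x y : H,
      (QuotientGroup.mk (γ ^ e i * x) : G ⧸ N.toSubgroup) = QuotientGroup.mk (γ ^ e j * y) →
      i = j ∧ x = y := by
    intro i hi j hj x y hxy
    have h1 : γ ^ e i * (x : G) = γ ^ e j * y := by
      by_contra hne
      refine hN _ (Finset.mem_erase.mpr ⟨?_, Finset.mem_image.mpr
        ⟨((i, x), (j, y)), by simp [t, hi, hj], rfl⟩⟩) (QuotientGroup.eq.mp hxy)
      rw [ne_eq, inv_mul_eq_one]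
      exact hne
    have h2 : e i = e j := by
      rcases le_total (e i) (e j) with h | h
      · exact hle _ _ x y h1 h
      · exact (hle _ _ y x h1.symm h).symm
    obtain rfl := he h2
    exact ⟨rfl, Subtype.ext (mul_left_cancel h1)⟩
  have hproj : ∀ (j : ℕ) (x : MonoidAlgebra k H), proj N (of k G (γ ^ e j) *
      MonoidAlgebra.lift k (CompletedGroupAlgebra k G) H ((of k G).comp H.subtype) x) =
      ∑ h : H, MonoidAlgebra.single (QuotientGroup.mk (γ ^ e j * h) : G ⧸ N.toSubgroup) (x.coeff h)
      := by
    intro j x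
    induction x using MonoidAlgebra.induction_linear with
    | zero => simp
    | add x y hx hy =>
      simp only [map_add, mul_add, hx, hy, MonoidAlgebra.coeff_add, Finsupp.add_apply,
        MonoidAlgebra.single_add, Finset.sum_add_distrib]
    | single g r =>
      rw [Finset.sum_eq_single g]
      · rw [MonoidAlgebra.lift_single, mul_smul_comm, map_smul, MonoidHom.comp_apply, ← map_mul,
          proj_of, MonoidAlgebra.smul_single]
        simp
      · intro b _ hb
        rw [MonoidAlgebra.coeff_single, Finsupp.single_eq_of_ne hb, MonoidAlgebra.single_zero]
      · intro h; exact absurd (Finset.mem_univ g) h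
  ext x
  have h1 := congrArg (fun z => (proj N z).coeff (QuotientGroup.mk (γ ^ e i * x))) h
  simp only [map_sum, hproj, map_zero, MonoidAlgebra.coeff_sum, Finsupp.coe_finsetSum,
    Finset.sum_apply, MonoidAlgebra.coeff_single] at h1
  rw [Finset.sum_eq_single i, Finset.sum_eq_single x] at h1
  · simpa using h1
  · intro y _ hy
    rw [Finsupp.single_apply, if_neg fun h => hy (hinj i hi i hi y x h).2]
  · intro h; exact absurd (Finset.mem_univ x) h
  · intro j hj hji
    refine Finset.sum_eq_zero fun y _ => ?_
    rw [Finsupp.single_apply, if_neg fun h => hji (hinj j (Finset.mem_range.mp hj) i hi y x h).1]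
  · intro h; exact absurd (Finset.mem_range.mpr hi) h

namespace CliffordUnits

section Map

variable {k : Type*} [CommRing k] {G : Type*} [Group G] {H : Subgroup G} [H.Normal]
  {γ : G} {w d q : ℕ} (D : CliffordUnits k H γ w d q)
  {A : Type*} [Ring A] [Algebra k A] (φ : G →* A) {B : Type*} [Ring B] [Algebra k B] (f : A →ₐ[k] B)

theorem map_hom (x : MonoidAlgebra k H) :
    f (D.hom φ x) = D.hom ((f : A →* B).comp φ) x := by
  induction x using MonoidAlgebra.induction_linear with
  | zero => simp
  | add x y hx hy => simp only [map_add, hx, hy]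
  | single h r => simp [hom, MonoidAlgebra.lift_single]

theorem map_eps : f (D.eps φ) = D.eps ((f : A →* B).comp φ) := D.map_hom φ f _

theorem map_unit : f (D.unit φ) = D.unit ((f : A →* B).comp φ) := by
  rw [unit, map_mul, map_hom]; rfl

theorem map_unitE (x y : Fin w × Fin d) :
    f (D.unitE φ x y) = D.unitE ((f : A →* B).comp φ) x y := by
  rw [unitE, map_mul, map_mul, map_hom]; rfl

/-- Adding `1 - ε` turns the unit of the block into a unit of the whole ring, where power series can
be evaluated. -/
theorem unit_add_pow (n : ℕ) :
    (D.unit φ + (1 - D.eps φ)) ^ n = D.unit φ ^ n * D.eps φ + (1 - D.eps φ) := by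
  have h1 := D.eps_mul_eps φ
  have h2 := D.unit_mul_eps φ
  have h3 := D.eps_commute_unit φ
  induction n with
  | zero => simp
  | succ n ih =>
    have h4 : D.eps φ * D.unit φ = D.unit φ := by rw [h3.eq, h2]
    rw [pow_succ, ih, pow_succ]
    simp only [mul_add, add_mul, mul_sub, sub_mul, mul_one, one_mul, mul_assoc, h1, h2, h4]
    abel

theorem unit_pow_mul_eps (n : ℕ) :
    D.unit φ ^ n * D.eps φ = φ (γ ^ (w * n)) * D.hom φ (D.c ^ n * D.idem) := by
  rw [unit, (D.commute_pow_of_conj φ D.c_conj w).mul_pow, ← map_pow, ← map_pow, ← pow_mul, eps,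
    mul_assoc, ← map_mul]

theorem c_pow_mul_idem_ne_zero (hw : 0 < w) (n : ℕ) : D.c ^ n * D.idem ≠ 0 := by
  have key : ∀ n, D.c' ^ n * (D.c ^ n * D.idem) = D.idem := by
    intro n
    induction n with
    | zero => simp
    | succ n ih =>
      have h : D.c' * D.c = D.idem := D.c'_mul_c
      rw [pow_succ, pow_succ', mul_assoc, mul_assoc D.c, ← mul_assoc D.c', h,
        (D.idem_commute _).eq, mul_assoc, idem_mul_idem, ih]
  intro h
  have h1 := key n
  rw [h, mul_zero] at h1
  apply D.base_ne_zero
  rw [← D.idem_mul_base hw, ← h1, zero_mul]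

end Map

section Completed

variable {k : Type*} [CommRing k] {G : Type*} [Group G] [TopologicalSpace G] {H : Subgroup G}
  [H.Normal] {γ : G} {w d q : ℕ} (D : CliffordUnits k H γ w d q)

theorem mem_span_proj {p : ℕ} (hγ : IsProcyclicComplement p H γ) (N : OpenNormalSubgroup G)
    (y : MonoidAlgebra k (G ⧸ N.toSubgroup)) :
    y ∈ Submodule.span k {y | ∃ (h : H) (i : ℕ), y =
      (((proj N : CompletedGroupAlgebra k G →ₐ[k] _) : _ →* _).comp (of k G)) h *
      (((proj N : CompletedGroupAlgebra k G →ₐ[k] _) : _ →* _).comp (of k G)) (γ ^ i)} := by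
  induction y using MonoidAlgebra.induction_linear with
  | zero => exact zero_mem _
  | add y z hy hz => exact add_mem hy hz
  | single g r =>
    induction g using QuotientGroup.induction_on with
    | H g =>
      obtain ⟨h, i, hi⟩ := hγ.exists_mk_eq N g
      rw [show MonoidAlgebra.single (QuotientGroup.mk g : G ⧸ N.toSubgroup) r =
        r • MonoidAlgebra.single (QuotientGroup.mk g : G ⧸ N.toSubgroup) (1 : k) by
          rw [MonoidAlgebra.smul_single, smul_eq_mul, mul_one]]
      refine Submodule.smul_mem _ r (Submodule.subset_span ⟨h, i, ?_⟩)
      rw [← map_mul, hi]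
      rfl

/-- Centrality may be tested at finite levels, which are spanned by the images of the elements `h γ
^ i`. -/
theorem commute_of_forall {p : ℕ} (hγ : IsProcyclicComplement p H γ) {x : CompletedGroupAlgebra k G}
    (hx : ∀ h : H, Commute x (of k G h)) (hx' : ∀ i : ℕ, Commute x (of k G (γ ^ i)))
    (y : CompletedGroupAlgebra k G) : Commute x y := by
  refine ext_proj fun N => ?_
  rw [map_mul, map_mul]
  have hy := mem_span_proj hγ N (proj N y)
  change Commute (proj N x) (proj N y)
  generalize proj N y = y at hy ⊢
  induction hy using Submodule.span_induction with
  | zero => exact Commute.zero_right _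
  | add y z _ _ hy hz => exact hy.add_right hz
  | smul r y _ hy => exact hy.smul_right r
  | mem y hy =>
    obtain ⟨h, i, rfl⟩ := hy
    exact ((hx h).map (proj N)).mul_right ((hx' i).map (proj N))

theorem hom_single_one (h : H) : D.hom (of k G) (MonoidAlgebra.single h 1) = of k G h := by
  simp [hom, MonoidAlgebra.lift_single]

theorem eps_commute {p : ℕ} (hγ : IsProcyclicComplement p H γ) (y : CompletedGroupAlgebra k G) :
    Commute (D.eps (of k G)) y :=
  commute_of_forall hγ (fun h => D.hom_single_one h ▸ D.eps_commute_hom _ _)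
    (D.eps_commute_pow _) y

theorem unit_commute {p : ℕ} (hγ : IsProcyclicComplement p H γ) (y : CompletedGroupAlgebra k G) :
    Commute (D.unit (of k G)) y :=
  commute_of_forall hγ (fun h => D.hom_single_one h ▸ D.unit_commute_hom _ _)
    (D.unit_commute_pow _) y

/-- Since `c ^ q = ε`, the `q`-th power of the unit is `γ ^ (w * q) ε`. At level `N` the image of
`γ` has order dividing some `p ^ a`, so with `q = p ^ b` the exponent `b + a` works. -/
theorem exists_proj_pow_eq_one {p : ℕ} (hγ : IsProcyclicComplement p H γ) {b : ℕ} (hq : q = p ^ b)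
    (N : OpenNormalSubgroup G) :
    ∃ a, (proj N (D.unit (of k G) + (1 - D.eps (of k G)))) ^ p ^ a = 1 := by
  obtain ⟨a, ha⟩ := hγ.exists_pow_mem N
  refine ⟨b + a, ?_⟩
  have h1 : proj N (of k G (γ ^ (w * q))) ^ p ^ a = 1 := by
    rw [← map_pow, ← map_pow, proj_of, ← pow_mul, mul_comm (w * q), pow_mul,
      (QuotientGroup.eq_one_iff (N := N.toSubgroup) _).mpr (pow_mem ha _)]
    rfl
  rw [← map_pow, unit_add_pow, pow_add, pow_mul, ← hq, unit_pow,
    (D.eps_commute_pow _ _).symm.mul_pow, mul_assoc, ← pow_succ,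
    IsIdempotentElem.pow_succ_eq _ (D.eps_mul_eps _)]
  rw [map_add, map_mul, map_pow, h1, one_mul, map_sub, map_one, add_sub_cancel]

end Completed

end CliffordUnits

end

/-! ### The centre of the block as a power series ring -/

noncomputable section

open scoped PowerSeries PowerSeries.WithPiTopology
open IsLocalRing CompletedGroupAlgebra

section Corner

variable {A : Type*} [Ring A] {e : A} (he : IsIdempotentElem e)

theorem corner_mul_val (x : he.Corner) : e * x.1 = x.1 :=
  ((Subsemigroup.mem_corner_iff he).mp x.2).1

theorem corner_val_pow (x : he.Corner) (n : ℕ) : (x ^ n).1 = x.1 ^ n * e := by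
  induction n with
  | zero => rw [pow_zero, pow_zero, one_mul]; rfl
  | succ n ih =>
    rw [pow_succ', pow_succ', mul_assoc, ← ih]
    rfl

/-- The inclusion `eAe → A` as a linear map. -/
def cornerVal (R : Type*) [CommRing R] [Algebra R A] : he.Corner →ₗ[R] A where
  toFun := Subtype.val
  map_add' _ _ := rfl
  map_smul' _ _ := rfl

/-- Multiplication by a central idempotent `e`, as a homomorphism `A → eAe`. -/
def toCorner (R : Type*) [CommRing R] [Algebra R A] (hc : ∀ x, Commute e x) : A →ₐ[R] he.Corner where
  toFun x := ⟨e * x, x, by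
    change e * x * e = e * x
    rw [mul_assoc, ← (hc x).eq, ← mul_assoc, he.eq]⟩
  map_one' := Subtype.ext (mul_one e)
  map_mul' x y := Subtype.ext (by
    change e * (x * y) = e * x * (e * y)
    rw [mul_assoc, ← mul_assoc x, ← (hc x).eq, mul_assoc, ← mul_assoc e e, he.eq])
  map_zero' := Subtype.ext (mul_zero e)
  map_add' x y := Subtype.ext (mul_add e x y)
  commutes' r := Subtype.ext (by
    change e * algebraMap R A r = r • e
    rw [← Algebra.commutes, Algebra.smul_def])

theorem continuous_toCorner [TopologicalSpace A] [ContinuousMul A] (R : Type*) [CommRing R]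
    [Algebra R A] (hc : ∀ x, Commute e x) : Continuous (toCorner he R hc) :=
  Continuous.subtype_mk (continuous_const.mul continuous_id) _

end Corner

namespace CliffordUnits

variable {k : Type*} [CommRing k] [IsDomain k] [TopologicalSpace k] [IsTopologicalRing k]
  [CompactSpace k] [T2Space k] [IsDiscreteValuationRing k] [IsAdicComplete (maximalIdeal k) k]
  {p : ℕ} [Fact p.Prime]
  {G : Type*} [Group G] [TopologicalSpace G] [IsTopologicalGroup G] [CompactSpace G] [T2Space G]
  [TotallyDisconnectedSpace G] {H : Subgroup G} [H.Normal] [Fintype H] {γ : G} {w d q : ℕ}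
  (D : CliffordUnits k H γ w d q)

/-- The powers of `U` lie over distinct powers of `γ`, hence are independent over `k`. The general
form covers both the central unit (`s = w`) and the image of `γ ^ p ^ n` (`s = p ^ n`). -/
theorem aeval_corner_eq_zero (hγ : IsProcyclicComplement p H γ)
    (hε : IsIdempotentElem (D.eps (of k G))) {U : hε.Corner} {s : ℕ} (hs : 0 < s)
    {x : ℕ → MonoidAlgebra k H} (hx : ∀ i, x i ≠ 0)
    (hU : ∀ i, (U ^ i).1 = of k G (γ ^ (s * i)) * D.hom (of k G) (x i))
    {Q : Polynomial k} (hQ : Polynomial.aeval U Q = 0) : Q = 0 := by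
  have h1 := congrArg (cornerVal hε k) hQ
  rw [Polynomial.aeval_eq_sum_range, map_sum, map_zero] at h1
  have h2 : ∀ i, cornerVal hε k (Q.coeff i • U ^ i) =
      of k G (γ ^ (s * i)) * D.hom (of k G) (Q.coeff i • x i) := by
    intro i
    rw [map_smul, map_smul, mul_smul_comm, ← hU]
    rfl
  simp_rw [h2] at h1
  ext i
  rw [Polynomial.coeff_zero]
  by_cases hi : i ≤ Q.natDegree
  · have h3 := eq_zero_of_sum_pow_mul_lift hγ.eq_zero_of_pow_mem
      (e := fun i => s * i) (fun a b h => Nat.eq_of_mul_eq_mul_left hs h) h1 (Nat.lt_succ_of_le hi)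
    by_contra h0
    refine hx i ?_
    ext g
    have h4 := congrArg (fun y => y.coeff g) h3
    simp only [MonoidAlgebra.coeff_smul, Finsupp.smul_apply, smul_eq_mul, MonoidAlgebra.coeff_zero,
      Finsupp.coe_zero, Pi.zero_apply] at h4
    exact (mul_eq_zero.mp h4).resolve_left h0
  · exact Polynomial.coeff_eq_zero_of_natDegree_lt (not_le.mp hi)

/-- The centre of the block of `k[[G]]` is a power series ring in the central unit. -/
theorem exists_powerSeries (hγ : IsProcyclicComplement p H γ) (hpk : (p : k) ∈ maximalIdeal k)
    (hw : 0 < w) {b : ℕ} (hq : q = p ^ b) (hε : IsIdempotentElem (D.eps (of k G))) :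
    ∃ Φ : k⟦X⟧ →ₐ[k] hε.Corner, (1 + Φ PowerSeries.X).1 = D.unit (of k G) ∧ Continuous Φ ∧
      Function.Injective Φ ∧ (∀ ξ y, Commute (Φ ξ) y) ∧
      ∀ z : hε.Corner, (∀ x y, Commute z.1 (D.unitE (of k G) x y)) → z ∈ Set.range Φ := by
  have hc := D.eps_commute hγ
  obtain ⟨ev, hev, hcont⟩ := exists_eval hpk _ (D.exists_proj_pow_eq_one hγ hq)
  have hev' : 1 + ev PowerSeries.X = D.unit (of k G) + (1 - D.eps (of k G)) := by
    rw [hev, add_sub_cancel]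
  let Φ := (toCorner hε k hc).comp ev
  have hΦX : (1 + Φ PowerSeries.X).1 = D.unit (of k G) := by
    rw [← map_one Φ, ← map_add]
    change _ * ev _ = _
    rw [map_add, map_one, hev', mul_add, (hc _).eq, D.unit_mul_eps, mul_sub, mul_one, D.eps_mul_eps,
      sub_self, add_zero]
  -- At a finite level every value of the evaluation is the value of a polynomial, so centrality
  -- follows from that of the unit and of `ε`.
  have hpoly : ∀ N, ∀ ξ, ∃ Q : Polynomial k, proj N (ev ξ) = proj N (ev Q) := by
    intro N ξ
    obtain ⟨a, ha⟩ := D.exists_proj_pow_eq_one hγ hq N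
    obtain ⟨Q, hQ⟩ := PowerSeries.exists_eq_aeval hpk ((proj N).comp ev) (a := a) (by
      rw [AlgHom.comp_apply, ← map_one (proj N), ← map_add, hev', ha, map_one]) ξ
    refine ⟨Q, ?_⟩
    rw [AlgHom.comp_apply, AlgHom.comp_apply] at hQ
    rw [hQ, PowerSeries.algHom_coe, Polynomial.aeval_algHom_apply]
  have hcomm : ∀ ξ y, Commute (ev ξ) y := by
    intro ξ y
    refine ext_proj fun N => ?_
    obtain ⟨Q, hQ⟩ := hpoly N ξ
    rw [map_mul, map_mul, hQ, ← map_mul, ← map_mul, PowerSeries.algHom_coe, hev]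
    congr 1
    rw [Polynomial.aeval_eq_sum_range, Finset.sum_mul, Finset.mul_sum]
    refine Finset.sum_congr rfl fun i _ => ?_
    refine ((Commute.pow_left ?_ i).smul_left _).eq
    exact (((D.unit_commute hγ y).add_left ((Commute.one_left y).sub_left (hc y)))).sub_left
      (Commute.one_left y)
  have hΦcont : Continuous Φ := (continuous_toCorner hε k hc).comp hcont
  refine ⟨Φ, hΦX, hΦcont, PowerSeries.injective_of_aeval Φ fun Q hQ => ?_, fun ξ y => ?_,
    fun z hz => ?_⟩
  · refine D.aeval_corner_eq_zero hγ hε hw (D.c_pow_mul_idem_ne_zero hw) (fun i => ?_) hQ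
    rw [corner_val_pow, hΦX, unit_pow_mul_eps]
  · refine Subtype.ext ?_
    change D.eps (of k G) * ev ξ * y.1 = y.1 * (D.eps (of k G) * ev ξ)
    exact ((hc _).mul_left (hcomm ξ _)).eq
  · have := PowerSeries.compactSpace_withPiTopology (k := k)
    have hcont' : Continuous fun ξ => (Φ ξ).1 := continuous_subtype_val.comp hΦcont
    -- At each level the centralizer of the matrix units consists of polynomials in the unit;
    -- compactness of the power series ring lifts this to the limit.
    obtain ⟨ξ, hξ⟩ := mem_range_of_forall_proj hcont' (x := z.1) fun N => by
      obtain ⟨Q, hQ⟩ := D.exists_aeval_of_commute _ hw (mem_span_proj hγ N (proj N z.1))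
        (by rw [← map_eps, ← map_mul, corner_mul_val])
        (fun x y => by rw [← map_unitE]; exact (hz x y).map (proj N))
      rw [← map_unit, ← map_eps, Polynomial.aeval_algHom_apply, ← map_mul] at hQ
      refine ⟨Polynomial.aeval (1 + PowerSeries.X) Q, ?_⟩
      rw [hQ]
      congr 1
      rw [← Polynomial.aeval_algHom_apply, map_add, map_one, Polynomial.aeval_eq_sum_range,
        Polynomial.aeval_eq_sum_range, Finset.sum_mul]
      change cornerVal hε k _ = _
      rw [map_sum]
      refine Finset.sum_congr rfl fun i _ => ?_
      rw [map_smul, smul_mul_assoc]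
      congr 1
      exact (corner_val_pow hε _ i).trans (by rw [hΦX])
    exact ⟨ξ, Subtype.ext hξ⟩

end CliffordUnits

end

noncomputable section

/-! ### Matrix units and maximal orders -/

section MatrixUnits

variable {R S : Type*} [CommRing R] [Ring S] [Algebra R S] {I : Type*} [Fintype I] [DecidableEq I]

/-- A ring with matrix units whose centralizer is the centre is a matrix ring over its centre. -/
theorem nonempty_algEquiv_matrix_center (E : I → I → S)
    (hmul : ∀ i j k l, E i j * E k l = if j = k then E i l else 0) (hone : ∑ i, E i i = 1)
    (hcent : ∀ z, (∀ i j, Commute z (E i j)) → ∀ x, Commute z x) :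
    Nonempty (S ≃ₐ[R] Matrix I I (Subalgebra.center R S)) := by
  have hc : ∀ (z : Subalgebra.center R S) (x : S), (z : S) * x = x * z := fun z x =>
    (Subalgebra.mem_center_iff.mp z.2 x).symm
  let f : Matrix I I (Subalgebra.center R S) →ₐ[R] S := AlgHom.ofLinearMap
    { toFun := fun M => ∑ i, ∑ j, (M i j : S) * E i j
      map_add' := fun M N => by
        simp only [Matrix.add_apply, Subalgebra.coe_add, add_mul, Finset.sum_add_distrib]
      map_smul' := fun r M => by
        simp only [Matrix.smul_apply, Subalgebra.coe_smul, smul_mul_assoc, Finset.smul_sum,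
          RingHom.id_apply] }
    (by
      simp only [LinearMap.coe_mk, AddHom.coe_mk]
      rw [← hone]
      refine Finset.sum_congr rfl fun i _ => ?_
      rw [Finset.sum_eq_single i]
      · simp
      · intro j _ hj
        simp [Matrix.one_apply_ne hj.symm]
      · simp)
    (fun M N => by
      simp only [LinearMap.coe_mk, AddHom.coe_mk]
      rw [Finset.sum_mul]
      refine Finset.sum_congr rfl fun i _ => ?_
      have h1 : ∀ j, (M i j : S) * E i j * ∑ k, ∑ l, (N k l : S) * E k l =
          ∑ l, (M i j : S) * N j l * E i l := by
        intro j
        rw [Finset.mul_sum, Finset.sum_eq_single j]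
        · rw [Finset.mul_sum]
          refine Finset.sum_congr rfl fun l _ => ?_
          rw [mul_assoc, ← mul_assoc (E i j), ← hc, mul_assoc, hmul, if_pos rfl, mul_assoc]
        · intro k _ hk
          rw [Finset.mul_sum]
          refine Finset.sum_eq_zero fun l _ => ?_
          rw [mul_assoc, ← mul_assoc (E i j), ← hc, mul_assoc, hmul, if_neg hk.symm, mul_zero,
            mul_zero]
        · simp
      rw [Finset.sum_mul]
      simp_rw [h1]
      rw [Finset.sum_comm]
      refine Finset.sum_congr rfl fun l _ => ?_
      rw [← Finset.sum_mul, Matrix.mul_apply]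
      simp)
  have hf : ∀ M, f M = ∑ i, ∑ j, (M i j : S) * E i j := fun _ => rfl
  -- The entries are recovered from the matrix units alone. This gives injectivity and dictates the
  -- preimage used for surjectivity.
  have hentry : ∀ M i j, (M i j : S) = ∑ k, E k i * f M * E j k := by
    intro M i j
    have h1 : ∀ k, E k i * f M * E j k = (M i j : S) * E k k := by
      intro k
      rw [hf, Finset.mul_sum, Finset.sum_mul, Finset.sum_eq_single i]
      · rw [Finset.mul_sum, Finset.sum_mul, Finset.sum_eq_single j]
        · rw [← mul_assoc, ← hc, mul_assoc, mul_assoc, hmul, if_pos rfl, hmul, if_pos rfl]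
        · intro l _ hl
          rw [mul_assoc, mul_assoc, hmul, if_neg hl, mul_zero, mul_zero]
        · simp
      · intro l _ hl
        rw [Finset.mul_sum, Finset.sum_mul]
        refine Finset.sum_eq_zero fun l' _ => ?_
        rw [← mul_assoc, ← hc, mul_assoc (M l l' : S), hmul, if_neg hl.symm, mul_zero, zero_mul]
      · simp
    simp_rw [h1]
    rw [← Finset.mul_sum, hone, mul_one]
  refine ⟨(AlgEquiv.ofBijective f ⟨fun M N h => ?_, fun s => ?_⟩).symm⟩
  · ext i j
    rw [hentry, hentry, h]
  -- These sums commute with all the matrix units, so by hypothesis they are central.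
  · have hz : ∀ i j, (∑ k, E k i * s * E j k) ∈ Subalgebra.center R S := by
      intro i j
      refine Subalgebra.mem_center_iff.mpr fun x => ((hcent _ fun a b => ?_) x).eq.symm
      rw [Commute, SemiconjBy, Finset.sum_mul, Finset.mul_sum, Finset.sum_eq_single a,
        Finset.sum_eq_single b]
      · rw [mul_assoc, hmul, if_pos rfl, ← mul_assoc, ← mul_assoc, hmul, if_pos rfl]
      · intro k _ hk
        rw [← mul_assoc, ← mul_assoc, hmul, if_neg hk.symm, zero_mul, zero_mul]
      · simp
      · intro k _ hk
        rw [mul_assoc, hmul, if_neg hk, mul_zero]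
      · simp
    refine ⟨Matrix.of fun i j => ⟨_, hz i j⟩, ?_⟩
    rw [hf]
    have h2 : ∀ i j, (∑ k, E k i * s * E j k) * E i j = E i i * s * E j j := by
      intro i j
      rw [Finset.sum_mul, Finset.sum_eq_single i]
      · rw [mul_assoc, hmul, if_pos rfl]
      · intro k _ hk
        rw [mul_assoc, hmul, if_neg hk, mul_zero]
      · simp
    simp only [Matrix.of_apply, h2]
    simp_rw [← Finset.mul_sum, hone, mul_one, ← Finset.sum_mul, hone, one_mul]

end MatrixUnits

section MaximalOrder

variable {R A B : Type*} [CommRing R] [CommRing A] [Algebra R A] [Ring B] [Algebra R B]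
  {I : Type*} [Fintype I] [DecidableEq I]

/-- An order that is a matrix ring over an integrally closed domain is maximal. -/
theorem isMaximalROrder_range_of_matrix [IsDomain A] [IsIntegrallyClosed A] [Nonempty I]
    (φ : Matrix I I A →ₐ[R] B) (hφ : Function.Injective φ) (h : IsROrder R φ.range) :
    IsMaximalROrder R φ.range := by
  refine ⟨h, fun T hT hle => le_antisymm (fun t ht => ?_) hle⟩
  have hE : ∀ i j, φ (Matrix.single i j 1) ∈ T := fun i j => hle ⟨_, rfl⟩
  obtain ⟨r, hr, M, hM⟩ := h.exists_smul_mem t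
  change φ M = r • t at hM
  have hru := h.isUnit_algebraMap r hr
  have hr0 : algebraMap R A r ≠ 0 := by
    intro h0
    have h1 : φ (algebraMap R _ r) = 0 := by
      rw [Matrix.algebraMap_eq_diagonal, Pi.algebraMap_def, h0, ← Pi.zero_def,
        Matrix.diagonal_zero', map_zero]
    rw [AlgHom.commutes] at h1
    rw [h1, isUnit_zero_iff] at hru
    have h2 : (1 : Matrix I I A) = 0 := hφ (by rw [map_one, map_zero, hru])
    exact one_ne_zero h2
  let K := FractionRing A
  -- The `(i, j)` entry of `t`, placed on the diagonal, is formed inside `T` with matrix units. It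
  -- is therefore integral over `R`, and it remains to see that it belongs to `A`.
  have hent : ∀ i j, ∃ a : A,
      ∑ k, φ (Matrix.single k i 1) * t * φ (Matrix.single j k 1) = φ (Matrix.scalar I a) := by
    intro i j
    set y := ∑ k, φ (Matrix.single k i 1) * t * φ (Matrix.single j k 1) with hy
    have hyT : y ∈ T := sum_mem fun k _ => mul_mem (mul_mem (hE k i) ht) (hE j k)
    have hry : algebraMap R B r * y = φ (Matrix.scalar I (M i j)) := by
      rw [← Algebra.smul_def, hy, Finset.smul_sum]
      have h1 : ∀ k, r • (φ (Matrix.single k i 1) * t * φ (Matrix.single j k 1)) =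
          φ (Matrix.single k k (M i j)) := by
        intro k
        rw [← smul_mul_assoc, ← mul_smul_comm, ← hM, ← map_mul, ← map_mul,
          Matrix.single_mul_mul_single, one_mul, mul_one]
      simp_rw [h1]
      rw [← map_sum]
      congr 1
      ext a b
      simp only [Matrix.sum_apply, Matrix.single_apply, Matrix.scalar_apply, Matrix.diagonal_apply]
      by_cases hab : a = b
      · subst hab; simp
      · rw [if_neg hab]
        exact Finset.sum_eq_zero fun c _ => if_neg (by rintro ⟨rfl, rfl⟩; exact hab rfl)
    -- An integral equation for `y` is rescaled by `r` to an equation for `M i j` in `A`. Divided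
    -- back in the field of fractions, it shows that `M i j / r` is integral, so in `A`.
    obtain ⟨P, hP, hPy⟩ := IsIntegral.of_mem_of_fg T hT.fg y hyT
    have h2 : Polynomial.aeval (algebraMap R B r * y) (P.scaleRoots r) = 0 :=
      Polynomial.scaleRoots_aeval_eq_zero hPy
    rw [hry] at h2
    have h3 : Polynomial.aeval (M i j) (P.scaleRoots r) = 0 := by
      have h4 : Polynomial.aeval ((φ.comp (Matrix.scalarAlgHom I R)) (M i j)) (P.scaleRoots r) = 0 :=
        h2
      rw [Polynomial.aeval_algHom_apply, ← map_zero (φ.comp (Matrix.scalarAlgHom I R))] at h4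
      have h5 := hφ h4
      exact Matrix.scalar_inj.mp h5
    have hrK : algebraMap R K r ≠ 0 := by
      rw [IsScalarTower.algebraMap_apply R A K]
      exact fun h => hr0 (IsFractionRing.injective A K (by rw [h, map_zero]))
    have h4 : Polynomial.aeval ((algebraMap R K r)⁻¹ * algebraMap A K (M i j)) P = 0 := by
      have h5 := Polynomial.scaleRoots_eval₂_mul (p := P) (algebraMap R K)
        ((algebraMap R K r)⁻¹ * algebraMap A K (M i j)) r
      rw [mul_inv_cancel_left₀ hrK, ← Polynomial.aeval_def, Polynomial.aeval_algebraMap_apply, h3,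
        map_zero] at h5
      exact (mul_eq_zero.mp h5.symm).resolve_left (pow_ne_zero _ hrK)
    have h5 : IsIntegral A ((algebraMap R K r)⁻¹ * algebraMap A K (M i j)) :=
      IsIntegral.tower_top (R := R) ⟨P, hP, h4⟩
    obtain ⟨a, ha⟩ := IsIntegrallyClosed.algebraMap_eq_of_integral h5
    have h6 : M i j = algebraMap R A r * a := by
      apply IsFractionRing.injective A K
      rw [map_mul, ha, ← IsScalarTower.algebraMap_apply, mul_inv_cancel_left₀ hrK]
    refine ⟨a, hru.mul_left_cancel ?_⟩
    rw [hry, h6, map_mul, map_mul]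
    congr 1
    rw [← AlgHom.commutes φ]
    rfl
  choose a ha using hent
  have hsum : t = ∑ i, ∑ j, φ (Matrix.scalar I (a i j)) * φ (Matrix.single i j 1) := by
    have h1 : ∀ i j, φ (Matrix.scalar I (a i j)) * φ (Matrix.single i j 1) =
        φ (Matrix.single i i 1) * t * φ (Matrix.single j j 1) := by
      intro i j
      rw [← ha, Finset.sum_mul, Finset.sum_eq_single i]
      · rw [mul_assoc, ← map_mul, Matrix.single_mul_single_same, one_mul]
      · intro k _ hk
        rw [mul_assoc, ← map_mul, Matrix.single_mul_single_of_ne _ _ _ _ hk, map_zero, mul_zero]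
      · simp
    have h2 : ∑ i, φ (Matrix.single i i (1 : A)) = 1 := by
      rw [← map_sum, Matrix.sum_single_one, map_one]
    simp_rw [h1, ← Finset.mul_sum, h2, mul_one, ← Finset.sum_mul, h2, one_mul]
  rw [hsum]
  exact sum_mem fun i _ => sum_mem fun j _ => mul_mem ⟨_, rfl⟩ ⟨_, rfl⟩

theorem toSubmodule_range_fg {S : Type*} [Ring S] [Algebra R S] [Module.Finite R S] (f : S →ₐ[R] B) :
    (Subalgebra.toSubmodule f.range).FG := by
  have : Subalgebra.toSubmodule f.range = LinearMap.range f.toLinearMap := by ext; rfl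
  rw [this, LinearMap.range_eq_map]
  exact Module.Finite.fg_top.map _

/-- The finitely many entries have a common denominator, and since `A` is algebraic over `R` this
denominator divides a nonzero element of `R`. -/
theorem isROrder_range_mapMatrix [IsDomain R] [IsDomain A] [FaithfulSMul R A] [Module.Finite R A] :
    IsROrder R (AlgHom.mapMatrix (m := I) (IsScalarTower.toAlgHom R A (FractionRing A))).range where
  isUnit_algebraMap r hr := by
    have h1 : IsUnit (algebraMap R (FractionRing A) r) := by
      rw [isUnit_iff_ne_zero, IsScalarTower.algebraMap_apply R A]
      intro h
      have h2 := IsFractionRing.injective A (FractionRing A) (h.trans (map_zero _).symm)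
      exact nonZeroDivisors.ne_zero hr (FaithfulSMul.algebraMap_injective R A
        (h2.trans (map_zero _).symm))
    exact h1.map (Matrix.scalar I)
  fg := by
    have : Module.Finite R (Matrix I I A) := inferInstanceAs (Module.Finite R (I → I → A))
    exact toSubmodule_range_fg _
  exists_smul_mem a := by
    classical
    obtain ⟨b, hb⟩ := IsLocalization.exist_integer_multiples_of_finset (nonZeroDivisors A)
      (Finset.univ.image fun x : I × I => a x.1 x.2)
    obtain ⟨r, hr, c, hc⟩ := (Algebra.IsAlgebraic.isAlgebraic (R := R) (b : A)).exists_nonzero_dvd b.2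
    refine ⟨r, mem_nonZeroDivisors_of_ne_zero hr, ?_⟩
    have h1 : ∀ i j, ∃ x : A, algebraMap A (FractionRing A) x = r • a i j := by
      intro i j
      obtain ⟨x, hx⟩ := hb _ (Finset.mem_image.mpr ⟨(i, j), Finset.mem_univ _, rfl⟩)
      refine ⟨c * x, ?_⟩
      rw [map_mul, hx, Algebra.smul_def, Algebra.smul_def, IsScalarTower.algebraMap_apply R A, hc,
        map_mul]
      ring
    choose x hx using h1
    exact ⟨Matrix.of x, Matrix.ext fun i j => hx i j⟩

end MaximalOrder

section Fractions

variable (R : Type*) {A : Type*} [CommRing R] [Ring A] [Algebra R A]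

theorem isUnit_toFractions {s : A} (hs : s ∈ centralRegular A) : IsUnit (toFractions R s) :=
  OreLocalization.numerator_isUnit (⟨s, hs⟩ : centralRegular A)

theorem exists_toFractions_mul (q : TotalFractions A) :
    ∃ s ∈ centralRegular A, ∃ x, toFractions R s * q = toFractions R x := by
  induction q using OreLocalization.ind with
  | _ x s => exact ⟨s, s.2, x, OreLocalization.mul_cancel⟩

theorem toFractions_injective : Function.Injective (toFractions R (A := A)) := by
  intro x y h
  obtain ⟨u, v, h1, h2⟩ := OreLocalization.oreDiv_eq_iff.mp h
  have h3 : (u : A) = v := by simpa using h2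
  change (u : A) * y = v * x at h1
  rw [← h3] at h1
  refine (sub_eq_zero.mp (u.2.2.1 _ ?_)).symm
  rw [mul_sub, h1, sub_self]

theorem cornerMap_toFractions_injective {e : A} (he : IsIdempotentElem e) :
    Function.Injective (cornerMap (toFractions R) he) := fun _ _ h =>
  Subtype.ext (toFractions_injective R (congrArg Subtype.val h))

theorem toFractions_commute {z : A} (hz : ∀ x, Commute z x) (q : TotalFractions A) :
    Commute (toFractions R z) q := by
  obtain ⟨s, hs, x, hx⟩ := exists_toFractions_mul R q
  refine (isUnit_toFractions R hs).mul_left_cancel ?_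
  rw [← mul_assoc, ← map_mul, ← (hz s).eq, map_mul, mul_assoc, hx, ← mul_assoc, hx, ← map_mul,
    ← map_mul, (hz x).eq]

variable {R}

/-- For `r ≠ 0` the element `re + (1 - e)` is central and, by torsion-freeness, regular; inverting
it inverts `r` on the corner. A denominator `s` becomes the regular element `es` of the corner,
which is algebraic over `R` and so divides a nonzero element of `R`. -/
theorem isROrder_range_cornerMap [IsDomain R] {e : A} (he : IsIdempotentElem e)
    (hc : ∀ x, Commute e x)
    [Module.Finite R he.Corner] (htf : ∀ r : R, ∀ x : he.Corner, r • x = 0 → r = 0 ∨ x = 0) :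
    IsROrder R (cornerMap (toFractions R) he).range where
  isUnit_algebraMap r hr := by
    have hr0 := nonZeroDivisors.ne_zero hr
    have hs : r • e + (1 - e) ∈ centralRegular A := by
      have hcomm : ∀ x, Commute (r • e + (1 - e)) x := fun x =>
        ((hc x).smul_left r).add_left ((Commute.one_left x).sub_left (hc x))
      have key : ∀ x, (r • e + (1 - e)) * x = 0 → x = 0 := by
        intro x hx
        have h1 : e * ((r • e + (1 - e)) * x) = r • (e * x) := by
          rw [← mul_assoc, mul_add, mul_smul_comm, he.eq, mul_sub, mul_one, he.eq, sub_self,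
            add_zero, smul_mul_assoc]
        rw [hx, mul_zero] at h1
        have h2 := (htf r (toCorner he R hc x) (Subtype.ext h1.symm)).resolve_left hr0
        have h3 : e * x = 0 := congrArg Subtype.val h2
        rw [add_mul, smul_mul_assoc, h3, smul_zero, zero_add, sub_mul, h3, one_mul, sub_zero] at hx
        exact hx
      exact ⟨Submonoid.mem_center_iff.mpr fun x => (hcomm x).eq.symm, key,
        fun x hx => key x (by rw [(hcomm x).eq, hx])⟩
    obtain ⟨v, hv⟩ := isUnit_toFractions R hs
    have hce := toFractions_commute R hc
    have hre : toFractions R e * (v : TotalFractions A) = r • toFractions R e := by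
      rw [hv, ← map_mul, mul_add, mul_smul_comm, he.eq, mul_sub, mul_one, he.eq, sub_self,
            add_zero, map_smul]
    let y : (he.map (toFractions R)).Corner := toCorner (he.map (toFractions R)) R hce
      ((v⁻¹ : (TotalFractions A)ˣ) : TotalFractions A)
    have h1 : algebraMap R (he.map (toFractions R)).Corner r * y = 1 := by
      refine Subtype.ext ?_
      change (r • toFractions R e) * (toFractions R e * _) = toFractions R e
      rw [← hre, ← mul_assoc, mul_assoc (toFractions R e), ← (hce v).eq, ← mul_assoc, ← map_mul, he.eq,
        mul_assoc, Units.mul_inv, mul_one]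
    exact ⟨⟨_, y, h1, by rw [← Algebra.commutes, h1]⟩, rfl⟩
  fg := toSubmodule_range_fg _
  exists_smul_mem a := by
    obtain ⟨s, hs, x, hx⟩ := exists_toFractions_mul R a.1
    let s' : he.Corner := toCorner he R hc s
    have hs' : s' ∈ nonZeroDivisors he.Corner := by
      have key : ∀ y : he.Corner, s' * y = 0 → y = 0 := by
        intro y hy
        have h1 : e * s * y.1 = 0 := congrArg Subtype.val hy
        rw [(hc s).eq, mul_assoc, corner_mul_val] at h1
        exact Subtype.ext (hs.2.1 _ h1)
      refine ⟨key, fun y hy => key y ?_⟩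
      have h1 : y.1 * (e * s) = 0 := congrArg Subtype.val hy
      refine Subtype.ext ?_
      change e * s * y.1 = 0
      rw [mul_assoc, ← Submonoid.mem_center_iff.mp hs.1, ← mul_assoc, (hc y.1).eq, mul_assoc, h1]
    obtain ⟨r, hr, c, hrc⟩ :=
      (Algebra.IsAlgebraic.isAlgebraic (R := R) s').exists_nonzero_dvd hs'
    refine ⟨r, mem_nonZeroDivisors_of_ne_zero hr, c * toCorner he R hc x, Subtype.ext ?_⟩
    have hcs : (e * s) * c.1 = r • e := (congrArg Subtype.val hrc).symm
    change toFractions R (c.1 * (e * x)) = r • a.1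
    have hcs' : (e * s) * c.1 = c.1 * e * s := by
      rw [mul_assoc, ← Submonoid.mem_center_iff.mp hs.1 c.1, ← mul_assoc, (hc c.1).eq]
    conv_rhs => rw [← corner_mul_val (he.map (toFractions R)) a]
    rw [← smul_mul_assoc, ← map_smul, ← hcs, hcs', map_mul (toFractions R) (c.1 * e) s,
      mul_assoc (toFractions R (c.1 * e)), hx, ← map_mul, mul_assoc]

end Fractions

end

/-! ### The Iwasawa algebra of the procyclic group generated by the central unit -/

noncomputable section

open scoped PowerSeries PowerSeries.WithPiTopology Topology
open IsLocalRing CompletedGroupAlgebra Filter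

theorem topologicalClosure_zpowers_subtype {M : Type*} [Group M] [TopologicalSpace M]
    [IsTopologicalGroup M] {P : Subgroup M} {u : M} (hu : u ∈ P)
    (hP : P ≤ (Subgroup.zpowers u).topologicalClosure) :
    (Subgroup.zpowers (⟨u, hu⟩ : P)).topologicalClosure = ⊤ := by
  refine eq_top_iff.mpr fun v _ => closure_subtype.mpr ?_
  refine closure_mono ?_ (hP v.2)
  rintro _ ⟨i, rfl⟩
  exact ⟨⟨u, hu⟩ ^ i, ⟨i, rfl⟩, rfl⟩

theorem closedSubgroupGenerated_le {M : Type*} [Group M] [TopologicalSpace M] {u : M}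
    {P : Subgroup M} (hP : IsClosed (P : Set M)) (hu : u ∈ P) : closedSubgroupGenerated u ≤ P :=
  sInf_le ⟨hP, hu⟩

theorem mem_closedSubgroupGenerated {M : Type*} [Group M] [TopologicalSpace M] (u : M) :
    u ∈ closedSubgroupGenerated u :=
  Subgroup.mem_sInf.mpr fun _ hP => hP.2

theorem isClosed_closedSubgroupGenerated {M : Type*} [Group M] [TopologicalSpace M] (u : M) :
    IsClosed (closedSubgroupGenerated u : Set M) := by
  rw [closedSubgroupGenerated, Subgroup.coe_sInf]
  exact isClosed_biInter fun P hP => hP.1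

section

variable {k : Type*} [CommRing k] [IsDomain k] [TopologicalSpace k] [IsTopologicalRing k]
  [CompactSpace k] [T2Space k] [IsDiscreteValuationRing k] [IsAdicComplete (maximalIdeal k) k]
  {p : ℕ} [Fact p.Prime]

theorem PowerSeries.one_add_X_pow_eq_one {i : ℕ} (h : (1 + PowerSeries.X : k⟦X⟧) ^ i = 1) :
    i = 0 := by
  have h1 : ((1 + Polynomial.X : Polynomial k) ^ i : Polynomial k) = 1 := by
    apply Polynomial.coe_injective k
    simpa using h
  have h2 := congrArg Polynomial.natDegree h1
  have h3 : (1 + Polynomial.X : Polynomial k).natDegree = 1 := by compute_degree!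
  rwa [Polynomial.natDegree_pow, h3, mul_one, Polynomial.natDegree_one] at h2

/-- The completed group algebra of the procyclic group generated by a topologically unipotent unit
`u`, in terms of evaluation of power series at `u - 1`. -/
theorem exists_algHom_closedSubgroupGenerated (hpk : (p : k) ∈ maximalIdeal k)
    {S : Type*} [Ring S] [Algebra k S] [TopologicalSpace S] [IsTopologicalRing S] [T2Space S]
    [TotallyDisconnectedSpace S] (Φ : k⟦X⟧ →ₐ[k] S) (hΦ : Continuous Φ)
    (hΦi : Function.Injective Φ) {u : Sˣ} (hu : (u : S) = 1 + Φ PowerSeries.X)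
    (hlim : Tendsto (fun a : ℕ => (u : S) ^ p ^ a) atTop (𝓝 1)) :
    ∃ j : CompletedGroupAlgebra k (closedSubgroupGenerated u) →ₐ[k] S,
      Function.Injective j ∧ Continuous j ∧
      (∀ v : closedSubgroupGenerated u, j (of k _ v) = (v : Sˣ)) ∧ Set.range j = Set.range Φ := by
  have := PowerSeries.compactSpace_withPiTopology (k := k)
  set P := closedSubgroupGenerated u with hP
  have hΦu : Φ (1 + PowerSeries.X) = u := by rw [map_add, map_one, hu]
  -- The group is closed in the image of the unit group of `k⟦X⟧`, which is compact.
  have hcompact : IsCompact (P : Set Sˣ) := by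
    have hK : IsCompact ((Units.map (Φ : k⟦X⟧ →* S)).range : Set Sˣ) := by
      rw [MonoidHom.coe_range]
      exact isCompact_range (Continuous.units_map _ hΦ)
    refine hK.of_isClosed_subset (isClosed_closedSubgroupGenerated u)
      (closedSubgroupGenerated_le hK.isClosed ?_)
    have hunit : IsUnit (1 + PowerSeries.X : k⟦X⟧) := by
      rw [PowerSeries.isUnit_iff_constantCoeff]
      simp
    exact ⟨hunit.unit, Units.ext hΦu⟩
  have : CompactSpace P := isCompact_iff_compactSpace.mp hcompact
  let ι : P → S := fun v => ((v : Sˣ) : S)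
  have hι : Continuous ι := Units.continuous_val.comp continuous_subtype_val
  have hιi : Function.Injective ι := fun v v' h => Subtype.ext (Units.ext h)
  have : TotallyDisconnectedSpace P := ⟨isTotallyDisconnected_of_image hι.continuousOn hιi
    (isTotallyDisconnected_of_totallyDisconnectedSpace _)⟩
  let t : P := ⟨u, mem_closedSubgroupGenerated u⟩
  have ht : (Subgroup.zpowers t).topologicalClosure = ⊤ :=
    topologicalClosure_zpowers_subtype _ (closedSubgroupGenerated_le
      (Subgroup.isClosed_topologicalClosure _)
      (subset_closure (Subgroup.mem_zpowers u)))
  have hlim' : Tendsto (fun a : ℕ => t ^ p ^ a) atTop (𝓝 1) := by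
    rw [(hι.isClosedEmbedding hιi).isEmbedding.tendsto_nhds_iff]
    exact hlim
  -- The completed group algebra is itself a power series ring in `t - 1`: the powers `t ^ p ^ a`
  -- tend to `1`, and `t` has infinite order because `1 + X` does and `Φ` is injective.
  obtain ⟨φ, hφX, hφc, hφb⟩ := exists_bijective_powerSeries hpk ht (fun N => by
      exact (hlim'.eventually (N.isOpen'.mem_nhds (one_mem N))).exists) (fun i hi => by
    refine PowerSeries.one_add_X_pow_eq_one (k := k) (hΦi ?_)
    rw [map_pow, hΦu, map_one, ← Units.val_pow_eq_pow_val]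
    exact congrArg ι hi)
  let φe := AlgEquiv.ofBijective φ hφb
  let j : CompletedGroupAlgebra k P →ₐ[k] S := Φ.comp (φe.symm : _ →ₐ[k] k⟦X⟧)
  have hj : ∀ f, j (φ f) = Φ f := fun f => congrArg Φ (φe.symm_apply_apply f)
  -- The bijection `φ` is a quotient map by compactness, so continuity of `j` follows from that of
  -- `Φ`.
  have hjc : Continuous j := by
    rw [(hφc.isClosedMap.isQuotientMap hφc hφb.2).continuous_iff]
    convert hΦ using 1
    exact funext hj
  refine ⟨j, hΦi.comp φe.symm.injective, hjc, fun v => ?_, ?_⟩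
  -- Two continuous maps that agree on the dense subgroup of powers of `t` are equal.
  · have hdense : Dense ((Subgroup.zpowers t : Subgroup P) : Set P) := fun v => by
      have : v ∈ (Subgroup.zpowers t).topologicalClosure := ht ▸ Subgroup.mem_top v
      exact this
    refine congrFun (Continuous.ext_on hdense (hjc.comp continuous_of) hι ?_) v
    have hjt : j (of k P t) = u := by
      have : of k P t = φ (1 + PowerSeries.X) := by rw [map_add, map_one, hφX, add_sub_cancel]
      rw [this, hj, hΦu]
    let f₁ : P →* Sˣ := (Units.map (j : _ →* S)).comp (MonoidHom.toHomUnits (of k P))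
    rintro _ ⟨i, rfl⟩
    have h1 : f₁ t = u := Units.ext hjt
    have h2 : f₁ (t ^ i) = u ^ i := by rw [map_zpow, h1]
    exact congrArg Units.val h2
  · ext s
    constructor
    · rintro ⟨x, rfl⟩
      exact ⟨φe.symm x, rfl⟩
    · rintro ⟨f, rfl⟩
      exact ⟨φ f, hj f⟩

end

section CornerTopology

variable {A : Type*} [Ring A] [TopologicalSpace A] {e : A} (he : IsIdempotentElem e)

instance [T2Space A] : T2Space he.Corner := inferInstanceAs (T2Space (Subsemigroup.corner e))

instance [TotallyDisconnectedSpace A] : TotallyDisconnectedSpace he.Corner :=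
  inferInstanceAs (TotallyDisconnectedSpace (Subsemigroup.corner e))

theorem isInducing_corner_val : Topology.IsInducing (fun x : he.Corner => x.1) := ⟨rfl⟩

instance [IsTopologicalRing A] : IsTopologicalRing he.Corner where
  continuous_add := (isInducing_corner_val he).continuous_iff.mpr
    (((isInducing_corner_val he).continuous.comp continuous_fst).add
      ((isInducing_corner_val he).continuous.comp continuous_snd))
  continuous_mul := (isInducing_corner_val he).continuous_iff.mpr
    (((isInducing_corner_val he).continuous.comp continuous_fst).mul
      ((isInducing_corner_val he).continuous.comp continuous_snd))
  continuous_neg := (isInducing_corner_val he).continuous_iff.mpr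
    (isInducing_corner_val he).continuous.neg

end CornerTopology

namespace CliffordUnits

variable {k : Type*} [CommRing k] [TopologicalSpace k]
  {p : ℕ} {G : Type*} [Group G] [TopologicalSpace G] {H : Subgroup G} [H.Normal] {γ : G}
  {w d q : ℕ} (D : CliffordUnits k H γ w d q)

/-- At every finite level the powers in question are eventually equal to the identity of the corner.
-/
theorem tendsto_unit_pow (hγ : IsProcyclicComplement p H γ) {b : ℕ} (hq : q = p ^ b)
    (hε : IsIdempotentElem (D.eps (of k G))) {U : hε.Corner} (hU : U.1 = D.unit (of k G)) :
    Tendsto (fun a : ℕ => U ^ p ^ a) atTop (𝓝 1) := by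
  rw [(isInducing_corner_val hε).tendsto_nhds_iff]
  change Tendsto _ _ (𝓝 (D.eps (of k G)))
  rw [nhds_induced, tendsto_comap_iff, tendsto_pi_nhds]
  intro N
  rw [tendsto_pi_nhds]
  intro g
  refine tendsto_const_nhds.congr' ?_
  obtain ⟨a, ha⟩ := D.exists_proj_pow_eq_one hγ hq N
  refine eventually_atTop.mpr ⟨a, fun a' h => ?_⟩
  change (proj N (D.eps (of k G))).coeff g = (proj N (U ^ p ^ a').1).coeff g
  have h1 : (U ^ p ^ a').1 =
      (D.unit (of k G) + (1 - D.eps (of k G))) ^ p ^ a' * D.eps (of k G) := by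
    rw [unit_add_pow, add_mul, mul_assoc, sub_mul, one_mul, D.eps_mul_eps, sub_self, add_zero,
      corner_val_pow, hU]
  obtain ⟨s, rfl⟩ := Nat.exists_eq_add_of_le h
  rw [h1, map_mul, map_pow, pow_add, pow_mul, ha, one_pow, one_mul]

end CliffordUnits

end

/-! ### The block as an algebra over the Iwasawa algebra of `Γ₀` -/

noncomputable section

open scoped PowerSeries PowerSeries.WithPiTopology Topology
open IsLocalRing CompletedGroupAlgebra Filter

section CentralSubgroup

variable {G : Type*} [Group G] [TopologicalSpace G] [IsTopologicalGroup G] [T2Space G]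

theorem isClosed_center_of_t2 : IsClosed (Subgroup.center G : Set G) := by
  have : (Subgroup.center G : Set G) = ⋂ g : G, {z | g * z = z * g} := by
    ext z
    simp [Subgroup.mem_center_iff]
  rw [this]
  exact isClosed_iInter fun g => isClosed_eq (continuous_const.mul continuous_id)
    (continuous_id.mul continuous_const)

variable [CompactSpace G]

instance compactSpace_centralClosure {z : G} (hz : z ∈ Subgroup.center G) :
    CompactSpace (centralClosure hz) := by
  have : CompactSpace (Subgroup.center G) :=
    isCompact_iff_compactSpace.mp isClosed_center_of_t2.isCompact
  exact isCompact_iff_compactSpace.mp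
    ((Subgroup.isClosed_topologicalClosure _).isCompact)

/-- The topological generator of the closed subgroup generated by a central element. -/
def centralGenerator {z : G} (hz : z ∈ Subgroup.center G) : centralClosure hz :=
  ⟨⟨z, hz⟩, subset_closure (Subgroup.mem_zpowers _)⟩

variable [TotallyDisconnectedSpace G]
  {k : Type*} [CommRing k] [IsDomain k] [TopologicalSpace k] [IsTopologicalRing k]
  [CompactSpace k] [T2Space k] [IsDiscreteValuationRing k] [IsAdicComplete (maximalIdeal k) k]
  {p : ℕ} [Fact p.Prime] {H : Subgroup G} {γ : G}

/-- The topology of the closure is induced from `G`, so the `p`-power orders at its finite levels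
come from those of `γ`; the order is infinite because no positive power of `γ` lies in `H`. -/
theorem exists_bijective_centralClosure (hγ : IsProcyclicComplement p H γ)
    (hpk : (p : k) ∈ maximalIdeal k) {n : ℕ} (hn : γ ^ p ^ n ∈ Subgroup.center G) :
    ∃ ψ : k⟦X⟧ →ₐ[k] CompletedGroupAlgebra k (centralClosure hn),
      ψ PowerSeries.X = of k _ (centralGenerator hn) - 1 ∧ Continuous ψ ∧ Function.Bijective ψ := by
  refine exists_bijective_powerSeries hpk
    (topologicalClosure_zpowers_subtype _ le_rfl) (fun N => ?_) fun i hi => ?_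
  · have hι : Topology.IsInducing (fun x : centralClosure hn => (x : G)) :=
      Topology.IsInducing.subtypeVal.comp Topology.IsInducing.subtypeVal
    obtain ⟨U, hU, hUN⟩ := hι.isOpen_iff.mp N.isOpen'
    have h1 : (1 : G) ∈ U := by
      have : (1 : centralClosure hn) ∈ (N : Set (centralClosure hn)) := one_mem N
      change (1 : centralClosure hn) ∈ N.carrier at this
      rw [← hUN] at this
      exact this
    obtain ⟨M, hM⟩ := ProfiniteGrp.exist_openNormalSubgroup_sub_open_nhds_of_one hU h1
    obtain ⟨a, ha⟩ := hγ.exists_pow_mem M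
    refine ⟨a, ?_⟩
    change _ ∈ N.carrier
    rw [← hUN]
    refine hM ?_
    change (γ ^ p ^ n) ^ p ^ a ∈ M
    rw [← pow_mul, mul_comm, pow_mul]
    exact pow_mem ha _
  · have h1 : (γ ^ p ^ n) ^ i = 1 := congrArg (fun x : centralClosure hn => (x : G)) hi
    rw [← pow_mul] at h1
    have h2 := hγ.eq_zero_of_pow_mem _ (h1 ▸ one_mem H)
    exact (Nat.mul_eq_zero.mp h2).resolve_left (pow_ne_zero _ (Fact.out : p.Prime).ne_zero)

theorem algebraMap_of_central {z : G} (hz : z ∈ Subgroup.center G) (v : centralClosure hz) :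
    algebraMap (CompletedGroupAlgebra k (centralClosure hz)) (CompletedGroupAlgebra k G) (of k _ v) =
      of k G (v : G) := by
  refine ext_proj fun N => ?_
  change MonoidAlgebra.mapDomain _ (MonoidAlgebra.single _ _) = MonoidAlgebra.single _ _
  rw [MonoidAlgebra.mapDomain_single]
  rfl

theorem CompletedGroupAlgebra.continuous_map {P P' : Type*} [Group P] [TopologicalSpace P]
    [IsTopologicalGroup P] [CompactSpace P] [Group P'] [TopologicalSpace P'] (f : P →* P')
    (hf : Continuous f) : Continuous (CompletedGroupAlgebra.map k f hf) := by
  refine continuous_iff.mpr fun N g => ?_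
  have hfin : Finite (P ⧸ (comapOpenNormal f hf N).toSubgroup) :=
    Subgroup.quotient_finite_of_isOpen _ (comapOpenNormal f hf N).isOpen'
  have := Fintype.ofFinite (P ⧸ (comapOpenNormal f hf N).toSubgroup)
  let F := QuotientGroup.map (comapOpenNormal f hf N).toSubgroup N.toSubgroup f le_rfl
  have key : ∀ y : MonoidAlgebra k (P ⧸ (comapOpenNormal f hf N).toSubgroup),
      (MonoidAlgebra.mapDomain F y).coeff g =
        ∑ z, y.coeff z * (MonoidAlgebra.single (F z) (1 : k)).coeff g := by
    intro y
    induction y using MonoidAlgebra.induction_linear with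
    | zero => simp
    | add y y' hy hy' =>
      simp only [MonoidAlgebra.mapDomain_add, MonoidAlgebra.coeff_add, Finsupp.add_apply, hy, hy',
        add_mul, Finset.sum_add_distrib]
    | single z r =>
      rw [MonoidAlgebra.mapDomain_single, Finset.sum_eq_single z]
      · by_cases hz : F z = g
        · simp [hz]
        · simp [Finsupp.single_eq_of_ne (Ne.symm hz)]
      · intro z' _ h
        rw [MonoidAlgebra.coeff_single, Finsupp.single_eq_of_ne h, zero_mul]
      · intro h; exact absurd (Finset.mem_univ z) h
  have h1 : ∀ x, (proj N (CompletedGroupAlgebra.map k f hf x)).coeff g =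
      ∑ z, (proj (comapOpenNormal f hf N) x).coeff z *
        (MonoidAlgebra.single (F z) (1 : k)).coeff g := fun x => key _
  simp_rw [h1]
  exact continuous_finsetSum _ fun z _ => (continuous_coeff_proj _ z).mul continuous_const

theorem continuous_centralInclusion (Z : Subgroup (Subgroup.center G)) [CompactSpace Z] :
    Continuous (centralInclusion k Z) :=
  CompletedGroupAlgebra.continuous_map _ _

end CentralSubgroup

namespace CliffordUnits

variable {k : Type*} [CommRing k] [IsDomain k] [TopologicalSpace k] [IsTopologicalRing k]
  [CompactSpace k] [T2Space k] [IsDiscreteValuationRing k] [IsAdicComplete (maximalIdeal k) k]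
  {p : ℕ} [Fact p.Prime]
  {G : Type*} [Group G] [TopologicalSpace G] [IsTopologicalGroup G] [CompactSpace G] [T2Space G]
  [TotallyDisconnectedSpace G] {H : Subgroup G} [H.Normal] [Fintype H] {γ : G} {w d q : ℕ}
  (D : CliffordUnits k H γ w d q)

/-- The structure of the corner as an algebra over the Iwasawa algebra of `γ ^ p ^ n`. -/
theorem exists_powerSeries_central (hγ : IsProcyclicComplement p H γ)
    (hpk : (p : k) ∈ maximalIdeal k) (hw : 0 < w) {n : ℕ} (hn : γ ^ p ^ n ∈ Subgroup.center G)
    (hε : IsIdempotentElem (D.eps (of k G))) :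
    ∃ ψ : k⟦X⟧ ≃ₐ[k] CompletedGroupAlgebra k (centralClosure hn),
      Continuous (fun ξ => algebraMap (CompletedGroupAlgebra k (centralClosure hn))
        hε.Corner (ψ ξ)) ∧
      Function.Injective (algebraMap (CompletedGroupAlgebra k (centralClosure hn)) hε.Corner) := by
  obtain ⟨ψ, hψX, hψc, hψb⟩ := exists_bijective_centralClosure hγ hpk hn
  have hc := D.eps_commute hγ
  let Ψ : k⟦X⟧ →ₐ[k] hε.Corner :=
    (toCorner hε k hc).comp ((centralInclusion k (centralClosure hn)).comp ψ)
  have hΨ : ∀ ξ, Ψ ξ = algebraMap (CompletedGroupAlgebra k (centralClosure hn)) hε.Corner (ψ ξ) := by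
    intro ξ
    refine Subtype.ext ?_
    change D.eps (of k G) * algebraMap _ _ (ψ ξ) = ψ ξ • D.eps (of k G)
    rw [← Algebra.commutes, Algebra.smul_def]
  have hΨi : Function.Injective Ψ := by
    refine PowerSeries.injective_of_aeval Ψ fun Q hQ => ?_
    have hU : 1 + Ψ PowerSeries.X = toCorner hε k hc (of k G (γ ^ p ^ n)) := by
      rw [← map_one Ψ, ← map_add]
      change toCorner hε k hc (centralInclusion k _ (ψ _)) = _
      rw [map_add, map_one, hψX, add_sub_cancel]
      exact congrArg _ (algebraMap_of_central hn _)
    -- The powers of `γ ^ p ^ n ε` have the same nonzero component `D.idem` in `k[H]`.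
    refine D.aeval_corner_eq_zero hγ hε (pow_pos (Fact.out : p.Prime).pos n)
      (x := fun _ => D.idem) (fun _ => by simpa using D.c_pow_mul_idem_ne_zero hw 0) (fun i => ?_) hQ
    rw [hU, ← map_pow, ← map_pow, ← pow_mul]
    exact (hc _).eq
  refine ⟨AlgEquiv.ofBijective ψ hψb, ?_, ?_⟩
  · have h1 : Continuous Ψ := (continuous_toCorner hε k hc).comp
      ((continuous_centralInclusion _).comp hψc)
    convert h1 using 1
    exact (funext hΨ).symm
  · intro r s h
    obtain ⟨x, rfl⟩ := hψb.2 r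
    obtain ⟨y, rfl⟩ := hψb.2 s
    rw [← hΨ, ← hΨ] at h
    rw [hΨi h]

theorem smul_corner_algebraMap {Z : Subgroup (Subgroup.center G)} {e : CompletedGroupAlgebra k G}
    (he : IsIdempotentElem e) (a : k) (x : he.Corner) :
    (algebraMap k (CompletedGroupAlgebra k Z) a) • x = a • x := by
  refine Subtype.ext ?_
  change (algebraMap k (CompletedGroupAlgebra k Z) a) • x.1 = a • x.1
  rw [Algebra.smul_def, Algebra.smul_def]
  congr 1
  exact (centralInclusion k Z).commutes a

/-- The centre of the block is finite over the Iwasawa algebra of `γ ^ p ^ n`. -/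
theorem range_fg (hγ : IsProcyclicComplement p H γ)
    (hpk : (p : k) ∈ maximalIdeal k) (hw : 0 < w) {n : ℕ} (hn : γ ^ p ^ n ∈ Subgroup.center G)
    {b : ℕ} (hq : q = p ^ b) (hnb : n ≤ b)
    (hε : IsIdempotentElem (D.eps (of k G))) {Φ : k⟦X⟧ →ₐ[k] hε.Corner} (hΦ : Continuous Φ)
    (hΦX : (1 + Φ PowerSeries.X).1 = D.unit (of k G))
    {L : Submodule (CompletedGroupAlgebra k (centralClosure hn)) hε.Corner}
    (hL : (L : Set hε.Corner) = Set.range Φ) : L.FG := by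
  set R := CompletedGroupAlgebra k (centralClosure hn)
  obtain ⟨ψ, hψc, -⟩ := D.exists_powerSeries_central hγ hpk hw hn hε
  have hc := D.eps_commute hγ
  set U : hε.Corner := 1 + Φ PowerSeries.X with hU
  -- As `n ≤ b`, the exponent `w * q` is a multiple of `p ^ n`, so `U ^ q` comes from `Γ₀` and the
  -- powers `U ^ i` with `i < q` suffice.
  obtain ⟨s, hs⟩ : ∃ s, w * q = p ^ n * s := by
    obtain ⟨c, rfl⟩ := Nat.exists_eq_add_of_le hnb
    exact ⟨w * p ^ c, by rw [hq, pow_add]; ring⟩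
  have hUq : U ^ q = algebraMap R hε.Corner (of k _ (centralGenerator hn ^ s)) := by
    refine Subtype.ext ?_
    rw [corner_val_pow, hΦX, unit_pow, mul_assoc, D.eps_mul_eps]
    change _ = (of k _ (centralGenerator hn ^ s) : R) • D.eps (of k G)
    rw [Algebra.smul_def, algebraMap_of_central, hs, pow_mul]
    rfl
  have hq0 : 0 < q := hq ▸ pow_pos (Fact.out : p.Prime).pos b
  let M : Submodule R hε.Corner := Submodule.span R (Set.range fun i : Fin q => U ^ (i : ℕ))
  have hpow : ∀ i : ℕ, U ^ i ∈ M := by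
    intro i
    rw [← Nat.div_add_mod i q, pow_add, pow_mul, hUq, ← map_pow, ← Algebra.smul_def]
    exact M.smul_mem _ (Submodule.subset_span ⟨⟨i % q, Nat.mod_lt i hq0⟩, rfl⟩)
  have hmul : ∀ x ∈ M, U * x ∈ M := by
    intro x hx
    induction hx using Submodule.span_induction with
    | zero => rw [mul_zero]; exact zero_mem _
    | add x y _ _ hx hy => rw [mul_add]; exact add_mem hx hy
    | smul r x _ hx => rw [mul_smul_comm]; exact M.smul_mem r hx
    | mem x hx =>
      obtain ⟨i, rfl⟩ := hx
      change U * U ^ (i : ℕ) ∈ M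
      rw [← pow_succ']
      exact hpow _
  have hXpow : ∀ i : ℕ, Φ PowerSeries.X ^ i ∈ M := by
    intro i
    induction i with
    | zero => simpa using hpow 0
    | succ i ih =>
      have : Φ PowerSeries.X = U - 1 := by rw [hU, add_sub_cancel_left]
      rw [pow_succ']
      nth_rw 1 [this]
      rw [sub_mul, one_mul]
      exact sub_mem (hmul _ ih) ih
  have := PowerSeries.compactSpace_withPiTopology (k := k)
  -- The span is a continuous image of the compact space of `q`-tuples of power series.
  have hclosed : IsClosed (M : Set hε.Corner) := by
    have hM : (M : Set hε.Corner) = Set.range fun f : Fin q → k⟦X⟧ =>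
        ∑ i, algebraMap R hε.Corner (ψ (f i)) * U ^ (i : ℕ) := by
      ext x
      rw [SetLike.mem_coe, Submodule.mem_span_range_iff_exists_fun]
      constructor
      · rintro ⟨c, rfl⟩
        refine ⟨fun i => ψ.symm (c i), Finset.sum_congr rfl fun i _ => ?_⟩
        rw [AlgEquiv.apply_symm_apply, Algebra.smul_def]
      · rintro ⟨f, rfl⟩
        refine ⟨fun i => ψ (f i), Finset.sum_congr rfl fun i _ => ?_⟩
        rw [Algebra.smul_def]
    rw [hM]
    exact (isCompact_range (continuous_finsetSum _ fun i _ =>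
      (hψc.comp (continuous_apply i)).mul continuous_const)).isClosed
  have hle : L ≤ M := by
    intro x hx
    have hx' : x ∈ Set.range Φ := hL ▸ hx
    obtain ⟨ξ, rfl⟩ := hx'
    have hcl : IsClosed {ξ | Φ ξ ∈ M} := hclosed.preimage hΦ
    -- Polynomials are dense among power series, and their images are combinations of powers of `U`.
    refine hcl.closure_subset_iff.mpr ?_ ((PowerSeries.WithPiTopology.denseRange_toPowerSeries k) ξ)
    rintro _ ⟨Q, rfl⟩
    change Φ Q ∈ M
    rw [PowerSeries.algHom_coe, Polynomial.aeval_eq_sum_range]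
    refine sum_mem fun i _ => ?_
    rw [← smul_corner_algebraMap (Z := centralClosure hn) hε]
    exact M.smul_mem _ (hXpow i)
  have hge : M ≤ L := by
    refine Submodule.span_le.mpr ?_
    rintro _ ⟨i, rfl⟩
    rw [hL]
    exact ⟨(1 + PowerSeries.X) ^ (i : ℕ), by rw [map_pow, map_add, map_one]⟩
  exact (le_antisymm hle hge) ▸ Submodule.fg_span (Set.finite_range _)

end CliffordUnits

end

/-! ### The structure of the block -/

noncomputable section

open scoped PowerSeries PowerSeries.WithPiTopology
open IsLocalRing CompletedGroupAlgebra

theorem isMaximalROrder_range_mapMatrix {R A I : Type*} [CommRing R] [CommRing A] [Algebra R A]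
    [Fintype I] [DecidableEq I] [Nonempty I] [IsDomain R] [IsDomain A] [IsIntegrallyClosed A]
    [FaithfulSMul R A] [Module.Finite R A] : IsMaximalROrder R
      (AlgHom.mapMatrix (m := I) (IsScalarTower.toAlgHom R A (FractionRing A))).range :=
  isMaximalROrder_range_of_matrix _ (fun _ _ h => Matrix.ext fun i j =>
    IsFractionRing.injective A (FractionRing A) (congrFun (congrFun h i) j)) isROrder_range_mapMatrix

/-- The isomorphism `e` exhibits the image of the corner as a matrix ring over `Z`; it also supplies
the finiteness and torsion-freeness needed for the order property. -/
theorem isMaximalROrder_range_cornerMap {R A Z I : Type*} [CommRing R] [Ring A] [Algebra R A]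
    [CommRing Z] [Algebra R Z] [Fintype I] [DecidableEq I] [Nonempty I] [IsDomain R] [IsDomain Z]
    [IsIntegrallyClosed Z] [FaithfulSMul R Z] [Module.Finite R Z] {ε : A} (hε : IsIdempotentElem ε)
    (hc : ∀ x, Commute ε x) (e : hε.Corner ≃ₐ[R] Matrix I I Z) :
    IsMaximalROrder R (cornerMap (toFractions R) hε).range := by
  have : Module.Finite R (Matrix I I Z) := inferInstanceAs (Module.Finite R (I → I → Z))
  have : Module.Finite R hε.Corner := Module.Finite.equiv e.symm.toLinearEquiv
  have htf : ∀ r : R, ∀ x : hε.Corner, r • x = 0 → r = 0 ∨ x = 0 := by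
    intro r x h
    by_cases hr : r = 0
    · exact Or.inl hr
    refine Or.inr (e.injective ?_)
    have h1 : r • e x = 0 := by rw [← map_smul, h, map_zero]
    rw [map_zero]
    refine Matrix.ext fun i j => ?_
    have h2 : r • (e x i j) = 0 := congrFun (congrFun h1 i) j
    rw [Algebra.smul_def] at h2
    exact (mul_eq_zero.mp h2).resolve_left fun h3 =>
      hr (FaithfulSMul.algebraMap_injective R Z (h3.trans (map_zero _).symm))
  have hrange : ((cornerMap (toFractions R) hε).comp e.symm.toAlgHom).range =
      (cornerMap (toFractions R) hε).range := by
    ext y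
    constructor
    · rintro ⟨x, rfl⟩
      exact ⟨e.symm x, rfl⟩
    · rintro ⟨x, rfl⟩
      refine ⟨e x, ?_⟩
      change cornerMap (toFractions R) hε (e.symm (e x)) = cornerMap (toFractions R) hε x
      rw [AlgEquiv.symm_apply_apply]
  rw [← hrange]
  refine isMaximalROrder_range_of_matrix _
    ((cornerMap_toFractions_injective R hε).comp e.symm.injective) ?_
  rw [hrange]
  exact isROrder_range_cornerMap hε hc htf

namespace CliffordUnits

variable {k : Type*} [CommRing k] [IsDomain k] [TopologicalSpace k] [IsTopologicalRing k]
  [CompactSpace k] [T2Space k] [TotallyDisconnectedSpace k]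
  [IsDiscreteValuationRing k] [IsAdicComplete (maximalIdeal k) k]
  {p : ℕ} [Fact p.Prime]
  {G : Type*} [Group G] [TopologicalSpace G] [IsTopologicalGroup G] [CompactSpace G] [T2Space G]
  [TotallyDisconnectedSpace G] {H : Subgroup G} [H.Normal] [Fintype H] {γ : G} {w d q : ℕ}
  (D : CliffordUnits k H γ w d q)

/-- The structure of the block of `k[[G]]` with matrix units `D`. -/
theorem block_structure (hγ : IsProcyclicComplement p H γ)
    (hpk : (p : k) ∈ maximalIdeal k) (hw : 0 < w) {n : ℕ} (hn : γ ^ p ^ n ∈ Subgroup.center G)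
    {b : ℕ} (hq : q = p ^ b) (hnb : n ≤ b) (hε : IsIdempotentElem (D.eps (of k G)))
    {m : ℕ} (hm : m = w * d) {u : hε.Cornerˣ} (hu : u.1.1 = D.unit (of k G)) :
    let R := CompletedGroupAlgebra k (centralClosure hn)
    (∃ j : CompletedGroupAlgebra k (closedSubgroupGenerated u) →ₐ[k] hε.Corner,
        Function.Injective j ∧ Continuous j ∧
        (∀ v : closedSubgroupGenerated u, j (of k _ v) = (v : hε.Cornerˣ)) ∧
        Set.range j = Set.center hε.Corner) ∧
      Nonempty (hε.Corner ≃ₐ[R] Matrix (Fin m) (Fin m) (Subalgebra.center R hε.Corner)) ∧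
      IsMaximalROrder R (cornerMap (toFractions R : CompletedGroupAlgebra k G →ₐ[R] _) hε).range ∧
      IsMaximalROrder R
        (AlgHom.mapMatrix (m := Fin m) (IsScalarTower.toAlgHom R (Subalgebra.center R hε.Corner)
          (FractionRing (Subalgebra.center R hε.Corner)))).range ∧
      Nonempty (hε.Corner ≃+* Matrix (Fin m) (Fin m) (PowerSeries k)) := by
  intro R
  obtain ⟨Φ, hΦX, hΦc, hΦi, hΦcomm, hΦr⟩ := D.exists_powerSeries hγ hpk hw hq hε
  have hc := D.eps_commute hγ
  let E : Fin w × Fin d → Fin w × Fin d → hε.Corner := fun x y =>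
    toCorner hε k hc (D.unitE (of k G) x y)
  have hE : ∀ x y, (E x y).1 = D.unitE (of k G) x y := by
    intro x y
    change D.eps (of k G) * _ = _
    rw [← sum_unitE, Finset.sum_mul, Finset.sum_eq_single x]
    · rw [unitE_mul_unitE, if_pos rfl]
    · intro z _ hz
      rw [unitE_mul_unitE, if_neg hz]
    · simp
  have hcent : ∀ z : hε.Corner, (∀ x y, Commute z (E x y)) → z ∈ Set.range Φ := fun z hz =>
    hΦr z fun x y => by rw [← hE]; exact congrArg Subtype.val (hz x y)
  -- Values of `Φ` are central, central elements commute with the matrix units, and whatever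
  -- commutes with these is a value of `Φ`.
  have hcenter : Set.range Φ = Set.center hε.Corner := by
    ext z
    rw [Semigroup.mem_center_iff]
    constructor
    · rintro ⟨ξ, rfl⟩ y
      exact (hΦcomm ξ y).eq.symm
    · exact fun hz => hcent z fun x y => (hz _).symm
  have hmul : ∀ i j k l, E i j * E k l = if j = k then E i l else 0 := by
    intro i j k' l
    change toCorner hε k hc _ * toCorner hε k hc _ = _
    rw [← map_mul, unitE_mul_unitE]
    split_ifs
    · rfl
    · exact map_zero _
  have hone : ∑ i, E i i = 1 := by
    change ∑ i, toCorner hε k hc _ = 1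
    rw [← map_sum, sum_unitE]
    exact Subtype.ext (D.eps_mul_eps _)
  obtain ⟨e₀⟩ := nonempty_algEquiv_matrix_center (R := R) E hmul hone fun z hz x => by
    obtain ⟨ξ, rfl⟩ := hcent z hz
    exact hΦcomm ξ x
  let Z := Subalgebra.center R hε.Corner
  let eI : Fin w × Fin d ≃ Fin m := finProdFinEquiv.trans (finCongr hm.symm)
  let e : hε.Corner ≃ₐ[R] Matrix (Fin m) (Fin m) Z := e₀.trans (Matrix.reindexAlgEquiv R Z eI)
  have hmemZ : ∀ ξ, Φ ξ ∈ Z := fun ξ =>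
    Subalgebra.mem_center_iff.mpr fun y => (hΦcomm ξ y).eq.symm
  let θ : k⟦X⟧ ≃+* Z := RingEquiv.ofBijective ((Φ : k⟦X⟧ →+* hε.Corner).codRestrict Z hmemZ)
    ⟨fun x y h => hΦi (congrArg Subtype.val h), fun z => by
      have hz : z.1 ∈ Set.range Φ := hcenter ▸ z.2
      obtain ⟨ξ, hξ⟩ := hz
      exact ⟨ξ, Subtype.ext hξ⟩⟩
  have : IsDomain Z := θ.symm.toMulEquiv.isDomain k⟦X⟧
  have : IsIntegrallyClosed Z := IsIntegrallyClosed.of_equiv θ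
  obtain ⟨ψ, -, hψi⟩ := D.exists_powerSeries_central hγ hpk hw hn hε
  have : IsDomain R := ψ.symm.toMulEquiv.isDomain k⟦X⟧
  have hRZ : Function.Injective (algebraMap R Z) := fun r s h => hψi (congrArg Subtype.val h)
  have : FaithfulSMul R Z := (faithfulSMul_iff_algebraMap_injective R Z).mpr hRZ
  have : Module.Finite R Z := Module.Finite.iff_fg.mpr
    (D.range_fg hγ hpk hw hn hq hnb hε hΦc hΦX (L := Subalgebra.toSubmodule Z) hcenter.symm)
  have : Nonempty (Fin m) := ⟨⟨0, hm ▸ Nat.mul_pos hw D.d_pos⟩⟩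
  refine ⟨?_, ⟨e⟩, ?_, ?_, ⟨(e : hε.Corner ≃+* _).trans θ.symm.mapMatrix⟩⟩
  · have hu' : u.1 = 1 + Φ PowerSeries.X := Subtype.ext (hu.trans hΦX.symm)
    obtain ⟨j, h1, h2, h3, h4⟩ := exists_algHom_closedSubgroupGenerated hpk Φ hΦc hΦi hu'
      (D.tendsto_unit_pow hγ hq hε hu)
    exact ⟨j, h1, h2, h3, h4.trans hcenter⟩
  · exact isMaximalROrder_range_cornerMap (Z := Subalgebra.center R hε.Corner) hε hc e
  · exact isMaximalROrder_range_mapMatrix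

end CliffordUnits

end

noncomputable section

/-! ### The ring of integers of a finite extension of `ℚ_p` -/

/-- Powers of the maximal ideal are principal, hence compact and closed, so the residue classes
prescribed by a Cauchy sequence form a decreasing chain of nonempty compact sets. -/
theorem isAdicComplete_of_compactSpace (A : Type*) [CommRing A] [IsDomain A] [IsPrincipalIdealRing A]
    [IsLocalRing A] [TopologicalSpace A] [IsTopologicalRing A] [CompactSpace A] [T2Space A] :
    IsAdicComplete (IsLocalRing.maximalIdeal A) A where
  prec' f hf := by
    set m := IsLocalRing.maximalIdeal A
    have hsmul : ∀ n, (m ^ n • ⊤ : Submodule A A) = m ^ n := fun n => Ideal.mul_top (m ^ n)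
    have hclosed : ∀ n, IsClosed ((m ^ n : Ideal A) : Set A) := by
      intro n
      obtain ⟨a, ha⟩ := IsPrincipalIdealRing.principal (m ^ n)
      have : ((m ^ n : Ideal A) : Set A) = Set.range fun x => x * a := by
        ext x
        rw [SetLike.mem_coe, ha]
        exact Submodule.mem_span_singleton
      rw [this]
      exact (isCompact_range (continuous_id.mul continuous_const)).isClosed
    have hC : ∀ n, IsClosed {x | f n - x ∈ m ^ n} := fun n =>
      (hclosed n).preimage (continuous_const.sub continuous_id)
    have hmono : ∀ i j, i ≤ j → {x | f j - x ∈ m ^ j} ⊆ {x | f i - x ∈ m ^ i} := by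
      intro i j hij x hx
      have h1 := SModEq.sub_mem.mp (hf hij)
      rw [hsmul] at h1
      have h2 := add_mem h1 (Ideal.pow_le_pow_right hij hx)
      rwa [sub_add_sub_cancel] at h2
    obtain ⟨x, hx⟩ := IsCompact.nonempty_iInter_of_directed_nonempty_isCompact_isClosed
      (fun n => {x | f n - x ∈ m ^ n})
      (fun i j => ⟨max i j, hmono _ _ (le_max_left i j), hmono _ _ (le_max_right i j)⟩)
      (fun n => ⟨f n, by simp⟩) (fun n => (hC n).isCompact) hC
    refine ⟨x, fun n => SModEq.sub_mem.mpr ?_⟩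
    rw [hsmul]
    exact Set.mem_iInter.mp hx n

namespace padicIntegers

open IsLocalRing

variable {p : ℕ} [Fact p.Prime] (F : IntermediateField ℚ_[p] (PadicAlgCl p))

/-- The norm on the algebraic closure is the spectral norm, so the bound says that the minimal
polynomial has coefficients in `ℤ_p`. -/
theorem isIntegral_of_norm_le_one {x : PadicAlgCl p} (hx : ‖x‖ ≤ 1) : IsIntegral ℤ_[p] x := by
  have hint : IsIntegral ℚ_[p] x := Algebra.IsIntegral.isIntegral x
  have hmonic := minpoly.monic hint
  have hx' : spectralValue (minpoly ℚ_[p] x) ≤ 1 := hx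
  rw [spectralValue_le_one_iff hmonic] at hx'
  obtain ⟨P, hP, -, hPm⟩ := Polynomial.lifts_and_natDegree_eq_and_monic
    (f := algebraMap ℤ_[p] ℚ_[p]) (p := minpoly ℚ_[p] x)
    ((Polynomial.lifts_iff_coeff_lifts _).mpr fun n => ⟨⟨_, hx' n⟩, rfl⟩) hmonic
  refine ⟨P, hPm, ?_⟩
  rw [IsScalarTower.algebraMap_eq ℤ_[p] ℚ_[p] (PadicAlgCl p), ← Polynomial.eval₂_map, hP]
  exact minpoly.aeval ℚ_[p] x

theorem isIntegral_or_inv (x : F) : IsIntegral ℤ_[p] x ∨ IsIntegral ℤ_[p] x⁻¹ := by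
  have : IsScalarTower ℤ_[p] F (PadicAlgCl p) := IsScalarTower.to₁₃₄ ℤ_[p] ℚ_[p] F (PadicAlgCl p)
  have key : ∀ y : F, ‖(y : PadicAlgCl p)‖ ≤ 1 → IsIntegral ℤ_[p] y := fun y hy =>
    (isIntegral_algebraMap_iff (algebraMap F (PadicAlgCl p)).injective).mp
      (isIntegral_of_norm_le_one hy)
  rcases le_total ‖(x : PadicAlgCl p)‖ 1 with h | h
  · exact Or.inl (key x h)
  · refine Or.inr (key _ ?_)
    rw [IntermediateField.coe_inv, norm_inv]
    exact inv_le_one_of_one_le₀ h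

variable [FiniteDimensional ℚ_[p] F]

instance finite : Module.Finite ℤ_[p] (padicIntegers F) :=
  IsIntegralClosure.finite ℤ_[p] ℚ_[p] F (padicIntegers F)

instance : IsNoetherianRing (padicIntegers F) :=
  IsIntegralClosure.isNoetherianRing ℤ_[p] ℚ_[p] F (padicIntegers F)

instance : ValuationRing (padicIntegers F) := by
  rw [ValuationRing.iff_isInteger_or_isInteger (padicIntegers F) F]
  intro x
  rcases isIntegral_or_inv F x with h | h
  · exact Or.inl ⟨⟨x, h⟩, rfl⟩
  · exact Or.inr ⟨⟨x⁻¹, h⟩, rfl⟩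

/-- Otherwise `p⁻¹` would be an element of `ℚ_p` integral over the integrally closed ring `ℤ_p`. -/
theorem not_isUnit_p : ¬ IsUnit (p : padicIntegers F) := by
  intro h
  obtain ⟨y, hy⟩ := h.exists_right_inv
  have h1 : (p : ℚ_[p]) ≠ 0 := Nat.cast_ne_zero.mpr (Fact.out : p.Prime).ne_zero
  have h2 : algebraMap ℚ_[p] F (p : ℚ_[p])⁻¹ = (y : F) := by
    have h3 : (p : F) * (y : F) = 1 := by
      have := congrArg (fun z : padicIntegers F => (z : F)) hy
      simpa using this
    rw [map_inv₀, map_natCast]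
    exact inv_eq_of_mul_eq_one_right h3
  have h3 : IsIntegral ℤ_[p] (p : ℚ_[p])⁻¹ := by
    rw [← isIntegral_algebraMap_iff (algebraMap ℚ_[p] F).injective, h2]
    exact y.2
  obtain ⟨z, hz⟩ := IsIntegrallyClosed.algebraMap_eq_of_integral h3
  refine PadicInt.prime_p.not_isUnit (IsUnit.of_mul_eq_one z ?_)
  apply IsFractionRing.injective ℤ_[p] ℚ_[p]
  rw [map_mul, hz, map_natCast, map_one, mul_inv_cancel₀ h1]

theorem p_mem_maximalIdeal : (p : padicIntegers F) ∈ maximalIdeal (padicIntegers F) :=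
  (mem_maximalIdeal _).mpr (not_isUnit_p F)

instance : IsPrincipalIdealRing (padicIntegers F) :=
  ((IsBezout.TFAE (R := padicIntegers F)).out 0 1 :
    IsNoetherianRing _ ↔ IsPrincipalIdealRing _).mp inferInstance

instance : IsDiscreteValuationRing (padicIntegers F) where
  not_a_field' h := by
    have h1 := p_mem_maximalIdeal F
    rw [h, Ideal.mem_bot] at h1
    have : CharZero (padicIntegers F) := inferInstance
    exact (Fact.out : p.Prime).ne_zero (Nat.cast_eq_zero.mp h1)

instance : T2Space (padicIntegers F) := inferInstance

instance : IsTopologicalRing (padicIntegers F) := inferInstance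

instance : TotallyDisconnectedSpace (padicIntegers F) := inferInstance

/-- The ring is finite over `ℤ_p`, so it is a continuous image of some power of the compact ring
`ℤ_p`. -/
instance : CompactSpace (padicIntegers F) := by
  obtain ⟨r, f, hf⟩ := Module.Finite.exists_fin' ℤ_[p] (padicIntegers F)
  have hc : Continuous (algebraMap ℤ_[p] (padicIntegers F)) := by
    refine Continuous.subtype_mk (Continuous.subtype_mk ?_ _) _
    exact (continuous_algebraMap ℚ_[p] (PadicAlgCl p)).comp continuous_subtype_val
  have hf' : Continuous f := by
    have : ∀ x, f x = ∑ i, algebraMap ℤ_[p] (padicIntegers F) (x i) * f (Pi.single i 1) := by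
      intro x
      conv_lhs => rw [← Finset.univ_sum_single x]
      rw [map_sum]
      refine Finset.sum_congr rfl fun i _ => ?_
      rw [← Algebra.smul_def, ← map_smul, ← Pi.single_smul, smul_eq_mul, mul_one]
    rw [funext this]
    exact continuous_finsetSum _ fun i _ => (hc.comp (continuous_apply i)).mul continuous_const
  exact ⟨by rw [← hf.range_eq]; exact isCompact_range hf'⟩

instance : IsAdicComplete (maximalIdeal (padicIntegers F)) (padicIntegers F) :=
  isAdicComplete_of_compactSpace _

end padicIntegers

end

noncomputable section

open Filter Topology

/-! ### Profinite groups of the form `H ⋊ ℤ_p` -/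

section Profinite

variable {p : ℕ} [Fact p.Prime] {G : Type*} [Group G] [TopologicalSpace G] [IsTopologicalGroup G]
  [CompactSpace G] [T2Space G] [TotallyDisconnectedSpace G] {H Γ : Subgroup G} {γ : G}

/-- All three properties are transported from `ℤ_p`, where `γ` corresponds to some `z`: the first
uses density of the powers of `γ` in `Γ`, the second `p ^ a z → 0`, the third that `ℤ_p` is
torsion-free and `z ≠ 0`. -/
theorem isProcyclicComplement (hΓ : Nonempty (Γ ≃ₜ* Multiplicative ℤ_[p]))
    (hHΓ : Subgroup.IsComplement' H Γ) (hγ : (Subgroup.zpowers γ).topologicalClosure = Γ) :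
    IsProcyclicComplement p H γ := by
  obtain ⟨e⟩ := hΓ
  have hmem : γ ∈ Γ := hγ ▸ subset_closure (Subgroup.mem_zpowers γ)
  let t : Γ := ⟨γ, hmem⟩
  let z : ℤ_[p] := (e t).toAdd
  have hpow : ∀ i : ℕ, (e (t ^ i)).toAdd = i * z := by
    intro i
    rw [map_pow, toAdd_pow, nsmul_eq_mul]
  refine ⟨fun N g => ?_, fun N => ?_, fun i hi => ?_⟩
  · obtain ⟨⟨h, x⟩, rfl⟩ := hHΓ.2 g
    have hx : (x : G) ∈ (Subgroup.zpowers γ).topologicalClosure := by rw [hγ]; exact x.2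
    obtain ⟨i, hi⟩ := CompletedGroupAlgebra.exists_pow_mem_of_dense hx N
    refine ⟨h, i, ?_⟩
    change ((QuotientGroup.mk (h : G) : G ⧸ N.toSubgroup) * QuotientGroup.mk (x : G)) = _
    rw [hi]
    rfl
  · have h1 : Tendsto (fun a : ℕ => ((p : ℤ_[p]) ^ a) * z) atTop (𝓝 0) := by
      rw [← zero_mul z]
      exact (tendsto_pow_atTop_nhds_zero_of_norm_lt_one (by
        rw [PadicInt.norm_p]
        exact inv_lt_one_of_one_lt₀ (Nat.one_lt_cast.mpr (Fact.out : p.Prime).one_lt))).mul_const z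
    have h2 : Tendsto (fun a : ℕ => ((e.symm (Multiplicative.ofAdd (((p : ℤ_[p]) ^ a) * z)) : Γ) : G))
        atTop (𝓝 1) := by
      have hc : Continuous fun y : ℤ_[p] => ((e.symm (Multiplicative.ofAdd y) : Γ) : G) :=
        continuous_subtype_val.comp (e.symm.continuous.comp continuous_ofAdd)
      have h3 := (hc.tendsto 0).comp h1
      simpa [Function.comp_def] using h3
    obtain ⟨a, ha⟩ := (h2.eventually (N.isOpen'.mem_nhds (one_mem N))).exists
    refine ⟨a, ?_⟩
    have h3 : e.symm (Multiplicative.ofAdd (((p : ℤ_[p]) ^ a) * z)) = t ^ p ^ a := by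
      rw [ContinuousMulEquiv.symm_apply_eq]
      have h4 := hpow (p ^ a)
      rw [Nat.cast_pow] at h4
      rw [← h4]
      rfl
    rw [h3] at ha
    exact ha
  · have h1 : γ ^ i = 1 := Subgroup.disjoint_def.mp hHΓ.disjoint hi (pow_mem hmem i)
    have h2 : t ^ i = 1 := Subtype.ext h1
    have h3 := hpow i
    rw [h2, map_one, toAdd_one] at h3
    rcases mul_eq_zero.mp h3.symm with h | h
    · exact Nat.cast_eq_zero.mp h
    -- If `z = 0` then `γ = 1` and `Γ` is trivial, unlike `ℤ_p`.
    · exfalso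
      have ht : t = 1 := e.injective (by rw [map_one]; exact h)
      have h4 : γ = 1 := congrArg Subtype.val ht
      have h5 : Γ = ⊥ := by
        rw [← hγ, h4, Subgroup.zpowers_one_eq_bot, eq_bot_iff]
        intro x hx
        have : x ∈ closure ({1} : Set G) := hx
        rwa [closure_singleton] at this
      have : Subsingleton Γ := by rw [h5]; infer_instance
      have h6 : (1 : Multiplicative ℤ_[p]) = Multiplicative.ofAdd 1 := e.symm.injective
        (Subsingleton.elim _ _)
      exact zero_ne_one (congrArg Multiplicative.toAdd h6)

theorem exists_openNormalSubgroup_le {S : Subgroup G} (hS : IsOpen (S : Set G)) :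
    ∃ N : OpenNormalSubgroup G, N.toSubgroup ≤ S := by
  obtain ⟨N, hN⟩ := ProfiniteGrp.exist_openNormalSubgroup_sub_open_nhds_of_one hS (one_mem S)
  exact ⟨N, hN⟩

variable [H.Normal]

theorem IsProcyclicComplement.exists_mul_pow_inv_mem (hγ : IsProcyclicComplement p H γ)
    {S : Subgroup G} (hS : IsOpen (S : Set G)) (g : G) : ∃ (h : H) (i : ℕ), g⁻¹ * (h * γ ^ i) ∈ S := by
  obtain ⟨N, hN⟩ := exists_openNormalSubgroup_le hS
  obtain ⟨h, i, hi⟩ := hγ.exists_mk_eq N g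
  exact ⟨h, i, hN (QuotientGroup.eq.mp hi)⟩

/-- The index of an open subgroup containing `H` is the order of `γ` modulo it. -/
theorem IsProcyclicComplement.index_pos_and_mem_iff (hγ : IsProcyclicComplement p H γ)
    {S : Subgroup G} (hS : IsOpen (S : Set G)) (hHS : H ≤ S) :
    0 < S.index ∧ ∀ i : ℕ, γ ^ i ∈ S ↔ S.index ∣ i := by
  have : Finite (G ⧸ S) := Subgroup.quotient_finite_of_isOpen S hS
  have := Fintype.ofFinite (G ⧸ S)
  -- Because `H` is normal and contained in `S`, the powers of `γ` permute the cosets of `S`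
  -- transitively; the index is the length of this cycle.
  have horb : MulAction.orbit (Subgroup.zpowers γ) ((1 : G) : G ⧸ S) = Set.univ := by
    refine Set.eq_univ_iff_forall.mpr fun y => ?_
    induction y using QuotientGroup.induction_on with
    | H g =>
      obtain ⟨h, i, hi⟩ := hγ.exists_mul_pow_inv_mem hS g
      refine ⟨⟨γ ^ i, Subgroup.npow_mem_zpowers γ i⟩, ?_⟩
      change ((γ ^ i * 1 : G) : G ⧸ S) = g
      rw [mul_one, eq_comm]
      refine QuotientGroup.eq.mpr ?_
      have h1 : (γ ^ i)⁻¹ * (h : G)⁻¹ * γ ^ i ∈ S := by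
        have h2 := ‹H.Normal›.conj_mem _ (inv_mem h.2) (γ ^ i)⁻¹
        rw [inv_inv] at h2
        exact hHS h2
      have h3 := mul_mem hi h1
      simpa [mul_assoc] using h3
  have hidx : S.index = Function.minimalPeriod (γ • ·) ((1 : G) : G ⧸ S) := by
    classical
    rw [MulAction.minimalPeriod_eq_card, ← Nat.card_eq_fintype_card]
    refine Eq.trans ?_ (congrArg (fun s : Set (G ⧸ S) => Nat.card s) horb.symm)
    rw [Nat.card_univ]
    rfl
  have hper : ∀ i : ℕ, γ ^ i ∈ S ↔ S.index ∣ i := by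
    intro i
    rw [hidx, ← Function.isPeriodicPt_iff_minimalPeriod_dvd, Function.IsPeriodicPt,
      Function.IsFixedPt, smul_iterate]
    change _ ↔ ((γ ^ i * 1 : G) : G ⧸ S) = _
    rw [mul_one, eq_comm, QuotientGroup.eq, inv_one, one_mul]
  exact ⟨Nat.pos_of_ne_zero Subgroup.index_ne_zero_of_finite, hper⟩

variable [Fintype H] {K : Type*} [Field K]

theorem isOpen_of_finite_subgroup (s : Set H) : IsOpen s := by
  have : DiscreteTopology H := inferInstance
  exact isOpen_discrete s

/-- It is a finite intersection of preimages of subsets of the discrete group `H` under the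
continuous maps `g ↦ g⁻¹hg`. -/
theorem isOpen_characterStabilizer (η : H → K) : IsOpen (characterStabilizer H η : Set G) := by
  have hc : ∀ h : H, Continuous fun g : G => (MulAut.conjNormal g⁻¹ : H ≃* H) h := by
    intro h
    refine Continuous.subtype_mk ?_ _
    exact ((continuous_inv.mul continuous_const).mul (continuous_inv.inv))
  have : (characterStabilizer H η : Set G) =
      ⋂ h : H, (fun g : G => (MulAut.conjNormal g⁻¹ : H ≃* H) h) ⁻¹' {x | η x = η h} := by
    ext g
    simp only [Set.mem_iInter, Set.mem_preimage]
    rfl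
  rw [this]
  exact isOpen_iInter_of_finite fun h => (isOpen_of_finite_subgroup _).preimage (hc h)

end Profinite

end

noncomputable section

/-! ### Characters of `G` and their constituents on `H` -/

theorem Representation.IsIrreducible.comp_mulEquiv {K G G' W : Type*} [Field K] [Group G] [Group G']
    [AddCommGroup W] [Module K W] {σ : Representation K G W} (hσ : σ.IsIrreducible) (e : G' ≃* G) :
    Representation.IsIrreducible (σ.comp e.toMonoidHom : Representation K G' W) := by
  let f : Subrepresentation (σ.comp e.toMonoidHom : Representation K G' W) ≃o Subrepresentation σ :=
    { toFun := fun U => ⟨U.toSubmodule, fun g v hv => by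
        have := U.apply_mem_toSubmodule (e.symm g) hv
        simpa using this⟩
      invFun := fun U => ⟨U.toSubmodule, fun g v hv => U.apply_mem_toSubmodule (e g) hv⟩
      left_inv := fun _ => rfl
      right_inv := fun _ => rfl
      map_rel_iff' := Iff.rfl }
  exact (OrderIso.isSimpleOrder_iff f).mpr hσ

theorem coeff_characterIdempotent {K H : Type*} [Field K] [Group H] [Fintype H] (f : H → K) (g : H) :
    (characterIdempotent f).coeff g = f 1 / (Fintype.card H : K) * f g⁻¹ := by
  classical
  rw [characterIdempotent, MonoidAlgebra.coeff_sum, Finsupp.finsetSum_apply]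
  simp [Finsupp.single_apply]

/-- Up to a nonzero factor, the inner product is the coefficient at `1` of the product of the
idempotents. -/
theorem characterInner_eq_zero_of_mul {K H : Type*} [Field K] [CharZero K] [Group H] [Fintype H]
    {f f' : H → K} (hf : f 1 ≠ 0) (hf' : f' 1 ≠ 0)
    (h : characterIdempotent f * characterIdempotent f' = 0) : characterInner f f' = 0 := by
  have hH : (Fintype.card H : K) ≠ 0 := Nat.cast_ne_zero.mpr Fintype.card_ne_zero
  have h1 := congrArg (fun x => x.coeff 1) h
  simp only [MonoidAlgebra.coeff_mul_apply_left, MonoidAlgebra.coeff_zero, Finsupp.coe_zero,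
    Pi.zero_apply, mul_one] at h1
  rw [Finsupp.sum_fintype _ _ fun _ => zero_mul _] at h1
  simp only [coeff_characterIdempotent, inv_inv] at h1
  have h2 : (f 1 / (Fintype.card H : K) * (f' 1 / Fintype.card H)) * ∑ x, f x⁻¹ * f' x = 0 := by
    rw [← h1, Finset.mul_sum]
    exact Finset.sum_congr rfl fun x _ => by ring
  have h3 := (mul_eq_zero.mp h2).resolve_left
    (mul_ne_zero (div_ne_zero hf hH) (div_ne_zero hf' hH))
  rw [characterInner, ← Equiv.sum_comp (Equiv.inv H)]
  simp only [Equiv.inv_apply, inv_inv, h3, mul_zero]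

namespace Representation

section HasScalar

variable {F K : Type*} [Field F] [CharZero F] [Field K] [CharZero K] [IsAlgClosed K] [Algebra F K]
  {V : Type*} [AddCommGroup V] [Module F V] [FiniteDimensional F V]

theorem Affords.hasScalarCommutant_of_finite {H : Type*} [Group H] [TopologicalSpace H] [Finite H]
    {η : H → K} (hη : IsIrrCharacter η) {σ : Representation F H V} (hσ : σ.Affords η) :
    HasScalarCommutant σ := by
  obtain ⟨d, τ, hτ, haff⟩ := hη
  exact HasScalarCommutant.of_character_eq (⊥ : Subgroup H) bot_le bot_le
    (fun g => (hσ.2 g).trans (haff.2 g).symm) (IsIrreducible.hasScalarCommutant τ)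

/-- Modulo the common open kernel of the two realisations the group is finite, so the character
criterion transfers Schur's lemma from the algebraically closed field to `F`. -/
theorem Affords.hasScalarCommutant {G : Type*} [Group G] [TopologicalSpace G] [IsTopologicalGroup G]
    [CompactSpace G] {χ : G → K} (hχ : IsIrrCharacter χ) {ρ : Representation F G V}
    (hρ : ρ.Affords χ) : HasScalarCommutant ρ := by
  obtain ⟨d, τ, hτ, haff⟩ := hχ
  have hopen : IsOpen ((MonoidHom.ker ρ ⊓ MonoidHom.ker τ : Subgroup G) : Set G) :=
    hρ.1.inter haff.1
  have : Finite (G ⧸ (MonoidHom.ker ρ ⊓ MonoidHom.ker τ)) :=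
    Subgroup.quotient_finite_of_isOpen _ hopen
  exact HasScalarCommutant.of_character_eq _ inf_le_left inf_le_right
    (fun g => (hρ.2 g).trans (haff.2 g).symm) (IsIrreducible.hasScalarCommutant τ)

end HasScalar

section Clifford

variable {p : ℕ} [Fact p.Prime] {G : Type*} [Group G] [TopologicalSpace G] [IsTopologicalGroup G]
  [CompactSpace G] [T2Space G] [TotallyDisconnectedSpace G] {H : Subgroup G} [H.Normal] [Fintype H]
  {γ : G} {F K : Type*} [Field F] [CharZero F] [Field K] [CharZero K] [IsAlgClosed K] [Algebra F K]
  {V : Type*} [AddCommGroup V] [Module F V] [FiniteDimensional F V]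
  {W : Type*} [AddCommGroup W] [Module F W] [FiniteDimensional F W]
  {χ : G → K} {η : H → K} {ρ : Representation F G V} {σ : Representation F H W}

theorem Affords.le_characterStabilizer (hσ : σ.Affords η) : H ≤ characterStabilizer H η := by
  intro g hg h
  rw [← hσ.2, ← hσ.2]
  congr 1
  have : (MulAut.conjNormal g⁻¹ : H ≃* H) h = (⟨g, hg⟩⁻¹ : H) * h * (⟨g, hg⟩⁻¹ : H)⁻¹ :=
    Subtype.ext rfl
  rw [this, char_conj]

/-- This turns the condition that `η` is a constituent into the statement that `e(σ)` acts
nontrivially on `V`. -/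
theorem Affords.algebraMap_trace_characterIdempotent (hρ : ρ.Affords χ) (hσ : σ.Affords η) :
    algebraMap F K (LinearMap.trace F V
      (asAlgebraHom (ρ.comp H.subtype) (characterIdempotent σ.character))) =
      η 1 * characterInner (fun h : H => χ h) η := by
  simp only [characterIdempotent, map_sum, asAlgebraHom_single, map_smul, smul_eq_mul, map_mul,
    map_div₀, map_natCast, hσ.2, characterInner, Finset.mul_sum]
  refine Finset.sum_congr rfl fun h _ => ?_
  have h1 : algebraMap F K (LinearMap.trace F V ((ρ.comp H.subtype) h)) = χ h := hρ.2 h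
  rw [h1]
  ring

/-- The stabilizer of `η` contains `H` and is open, so its index is the least positive `i` for which
`γ ^ i` fixes `η`. -/
theorem isCliffordPair (hγ : IsProcyclicComplement p H γ) (hχ : IsIrrCharacter χ)
    (hη : IsConstituent H χ η) (hρ : ρ.Affords χ) (hσ : σ.Affords η) :
    IsCliffordPair ρ σ γ (characterStabilizer H η).index := by
  have hs := hρ.hasScalarCommutant hχ
  have hs' := hσ.hasScalarCommutant_of_finite hη.1
  have := hs'.1
  obtain ⟨hpos, hiff⟩ := hγ.index_pos_and_mem_iff (isOpen_characterStabilizer η)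
    hσ.le_characterStabilizer
  refine ⟨hs, hs', fun g => ?_, hpos, fun h => ?_, fun i hi hiw => ?_, fun h0 => ?_⟩
  · obtain ⟨h, i, hi⟩ := hγ.exists_mul_pow_inv_mem hρ.1 g
    refine ⟨h, i, ?_⟩
    have h1 : ρ (g⁻¹ * (h * γ ^ i)) = 1 := hi
    have h2 : ρ (h * γ ^ i) = ρ g * ρ (g⁻¹ * (h * γ ^ i)) := by
      rw [← map_mul, mul_inv_cancel_left]
    rw [h2, h1, mul_one]
  · apply (algebraMap F K).injective
    rw [hσ.2, hσ.2]
    exact (hiff _).mpr dvd_rfl h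
  · by_contra hne
    push Not at hne
    refine Nat.not_dvd_of_pos_of_lt hi hiw ((hiff i).mp fun h => ?_)
    rw [← hσ.2, ← hσ.2, hne]
  · have h1 := hρ.algebraMap_trace_characterIdempotent hσ
    rw [h0, map_zero, map_zero, eq_comm, mul_eq_zero] at h1
    refine h1.elim (fun h2 => ?_) hη.2
    rw [← hσ.2, char_one, map_natCast, Nat.cast_eq_zero] at h2
    exact Module.finrank_pos.ne' h2

theorem _root_.IsConstituent.conj (hρ : ρ.Affords χ) (hη : IsConstituent H χ η) (g : G) :
    IsConstituent H χ fun h => η (MulAut.conjNormal g⁻¹ h) := by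
  obtain ⟨⟨d, τ, hτ, haff⟩, hne⟩ := hη
  refine ⟨⟨d, (τ.comp (MulAut.conjNormal g⁻¹ : H ≃* H).toMonoidHom : Representation K H _),
    hτ.comp_mulEquiv _, isOpen_of_finite_subgroup _,
    fun h => haff.2 ((MulAut.conjNormal g⁻¹ : H ≃* H) h)⟩, ?_⟩
  have : characterInner (fun h : H => χ h) (fun h => η (MulAut.conjNormal g⁻¹ h)) =
      characterInner (fun h : H => χ h) η := by
    rw [characterInner, characterInner, ← Equiv.sum_comp (MulAut.conjNormal g : H ≃* H).toEquiv]
    congr 1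
    refine Finset.sum_congr rfl fun h _ => ?_
    have h1 : χ ((MulAut.conjNormal g : H ≃* H) h : H) = χ h := by
      rw [← hρ.2, ← hρ.2, MulAut.conjNormal_apply, char_conj]
    have h2 : (MulAut.conjNormal g⁻¹ : H ≃* H) ((MulAut.conjNormal g : H ≃* H) h)⁻¹ = h⁻¹ := by
      rw [← map_inv, ← MulAut.mul_apply, ← map_mul, inv_mul_cancel, map_one]; rfl
    change χ ((MulAut.conjNormal g : H ≃* H) h : H) *
      η ((MulAut.conjNormal g⁻¹ : H ≃* H) ((MulAut.conjNormal g : H ≃* H) h)⁻¹) = _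
    rw [h1, h2]
  rwa [this]

theorem characterInner_eq_zero_of_ne {ψ ψ' : H → K} (hψ : IsIrrCharacter ψ)
    (hψ' : IsIrrCharacter ψ') (hne : ψ ≠ ψ') : characterInner ψ ψ' = 0 := by
  obtain ⟨d, τ, hτ, haff⟩ := hψ
  obtain ⟨d', τ', hτ', haff'⟩ := hψ'
  have h1 : ψ = τ.character := funext fun h => (haff.2 h).symm
  have h2 : ψ' = τ'.character := funext fun h => (haff'.2 h).symm
  have hs := IsIrreducible.hasScalarCommutant τ
  have hs' := IsIrreducible.hasScalarCommutant τ'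
  have := hs.1
  have := hs'.1
  subst h1 h2
  refine characterInner_eq_zero_of_mul ?_ ?_
    ((hs.character_eq_or_mul_eq_zero hs').resolve_left hne)
  · rw [char_one]; exact Nat.cast_ne_zero.mpr Module.finrank_pos.ne'
  · rw [char_one]; exact Nat.cast_ne_zero.mpr Module.finrank_pos.ne'

theorem mapRingHom_characterIdempotent {ψ : H → F} {ψ' : H → K}
    (h : ∀ x, algebraMap F K (ψ x) = ψ' x) :
    MonoidAlgebra.mapRingHom H (algebraMap F K) (characterIdempotent ψ) =
      characterIdempotent ψ' := by
  rw [characterIdempotent, characterIdempotent, map_sum]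
  refine Finset.sum_congr rfl fun x _ => ?_
  rw [MonoidAlgebra.mapRingHom_single, map_mul, map_div₀, map_natCast, h, h]

/-- The idempotent `e_χ` is the sum of the conjugates of `e(η)`. -/
theorem mapRingHom_resInv_one (hγ : IsProcyclicComplement p H γ) (hχ : IsIrrCharacter χ)
    (hη : IsConstituent H χ η) (hρ : ρ.Affords χ) (hσ : σ.Affords η) :
    MonoidAlgebra.mapRingHom H (algebraMap F K)
      (IsCliffordPair.resInv ρ H (characterStabilizer H η).index 1) = chiIdempotent H χ := by
  classical
  have hC := isCliffordPair hγ hχ hη hρ hσ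
  obtain ⟨hpos, hiff⟩ := hγ.index_pos_and_mem_iff (isOpen_characterStabilizer η)
    hσ.le_characterStabilizer
  set w := (characterStabilizer H η).index
  let c : ℕ → H → K := fun i h => η (MulAut.conjNormal (γ ^ i)⁻¹ h)
  have hc : ∀ i, IsConstituent H χ (c i) := fun i => hη.conj hρ (γ ^ i)
  have hsum : ∀ h : H, χ h = ∑ i ∈ Finset.range w, c i h := by
    intro h
    rw [← hρ.2, hC.character_res, map_sum]
    exact Finset.sum_congr rfl fun i _ => hσ.2 _
  have hinj : Set.InjOn c (Finset.range w : Set ℕ) := by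
    have key : ∀ i j, i ≤ j → j < w → c i = c j → i = j := by
      intro i j hij hj h
      obtain ⟨s, rfl⟩ := Nat.exists_eq_add_of_le hij
      have h1 : γ ^ s ∈ characterStabilizer H η := by
        intro x
        have h2 := congrFun h ((MulAut.conjNormal (γ ^ i) : H ≃* H) x)
        simp only [c] at h2
        rw [← MulAut.mul_apply, ← map_mul, inv_mul_cancel, map_one, MulAut.one_apply,
          ← MulAut.mul_apply, ← map_mul, pow_add, mul_inv_rev, inv_mul_cancel_right] at h2
        exact h2.symm
      have h2 := Nat.eq_zero_of_dvd_of_lt ((hiff s).mp h1) (by omega)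
      omega
    intro i hi j hj h
    rw [Finset.mem_coe, Finset.mem_range] at hi hj
    rcases le_total i j with hij | hij
    · exact key i j hij hj h
    · exact (key j i hij hi h.symm).symm
  -- The restriction of `χ` is the sum of the `c i`, so by orthogonality an irreducible character
  -- different from all of them has inner product zero with it.
  have hset : {ψ | IsConstituent H χ ψ} = (((Finset.range w).image c : Finset (H → K)) :
      Set (H → K)) := by
    ext ψ
    rw [Finset.coe_image]
    constructor
    · intro hψ
      by_contra hne
      refine hψ.2 ?_
      have h1 : characterInner (fun h : H => χ h) ψ =
          ∑ i ∈ Finset.range w, characterInner (c i) ψ := by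
        simp only [characterInner, hsum, Finset.sum_mul, ← Finset.mul_sum]
        rw [Finset.sum_comm]
      rw [h1]
      refine Finset.sum_eq_zero fun i hi => characterInner_eq_zero_of_ne (hc i).1 hψ.1 fun h => ?_
      exact hne ⟨i, hi, h⟩
    · rintro ⟨i, -, rfl⟩
      exact hc i
  rw [hC.resInv_one, map_sum, chiIdempotent]
  change _ = ∑ᶠ (ψ : H → K) (_ : ψ ∈ {ψ | IsConstituent H χ ψ}), characterIdempotent ψ
  rw [hset, finsum_mem_coe_finset, Finset.sum_image hinj]
  refine Finset.sum_congr rfl fun i _ => ?_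
  rw [conjIdempotent, groupAlgebraConj_characterIdempotent]
  exact mapRingHom_characterIdempotent fun x => hσ.2 _

end Clifford

end Representation

end

noncomputable section

open CompletedGroupAlgebra

/-! ### The element `γ_χ` -/

section Fractions

variable {k : Type*} [CommRing k] [IsDomain k] {G : Type*} [Group G] [TopologicalSpace G]
  {K : Type*} [Field K] [Algebra k K] [IsFractionRing k K] {H : Subgroup G}

theorem fractionScalars_algebraMap (a : k) : fractionScalars k G K (algebraMap k K a) =
    algebraMap k (TotalFractions (CompletedGroupAlgebra k G)) a :=
  congrArg Subtype.val (IsLocalization.lift_eq (M := nonZeroDivisors k) (S := K)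
    (g := scalarToCenter k G) _ a)

theorem groupAlgebraToFractions_single (h : H) (r : K) :
    groupAlgebraToFractions k G K H (MonoidAlgebra.single h r) =
      fractionScalars k G K r * toFractions k (of k G (h : G)) :=
  MonoidAlgebra.liftNC_single _ _ _ _

theorem groupAlgebraToFractions_mapRingHom (x : MonoidAlgebra k H) :
    groupAlgebraToFractions k G K H (MonoidAlgebra.mapRingHom H (algebraMap k K) x) =
      toFractions k (MonoidAlgebra.lift k (CompletedGroupAlgebra k G) H
        ((of k G).comp H.subtype) x) := by
  induction x using MonoidAlgebra.induction_linear with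
  | zero => simp only [map_zero]
  | add x y hx hy => simp only [map_add, hx, hy]
  | single h r =>
    rw [MonoidAlgebra.mapRingHom_single, groupAlgebraToFractions_single,
      fractionScalars_algebraMap, MonoidAlgebra.lift_single, map_smul, Algebra.smul_def]
    rfl

end Fractions

theorem Representation.Affords.finite_range {G : Type*} [Group G] [TopologicalSpace G]
    [IsTopologicalGroup G] [CompactSpace G] {F K V : Type*} [Field F] [Field K] [Algebra F K]
    [AddCommGroup V] [Module F V] {ρ : Representation F G V} {χ : G → K} (hρ : ρ.Affords χ) :
    (Set.range ρ).Finite := by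
  have : Finite (G ⧸ MonoidHom.ker ρ) := Subgroup.quotient_finite_of_isOpen _ hρ.1
  refine (Set.finite_range fun y : G ⧸ MonoidHom.ker ρ => ρ y.out).subset ?_
  rintro _ ⟨g, rfl⟩
  refine ⟨(g : G ⧸ MonoidHom.ker ρ), ?_⟩
  obtain ⟨h, hh⟩ := QuotientGroup.mk_out_eq_mul (MonoidHom.ker ρ) g
  have h1 : ρ (h : G) = 1 := h.2
  change ρ (Quotient.out _) = _
  rw [hh, map_mul, h1, mul_one]

/-- Equal valuations give the quotient norm `1`, so it already lies in `ℤ_p`. -/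
theorem padicIntegers.natCast_div_mem_range {p : ℕ} [Fact p.Prime]
    (F : IntermediateField ℚ_[p] (PadicAlgCl p)) {a b : ℕ} (ha : a ≠ 0) (hb : b ≠ 0)
    (h : padicValNat p a = padicValNat p b) :
    (a : F) / (b : F) ∈ (algebraMap (padicIntegers F) F).range := by
  have hnorm : ∀ {m : ℕ}, m ≠ 0 → ‖(m : ℚ_[p])‖ = (p : ℝ) ^ (-(padicValNat p m : ℤ)) := by
    intro m hm
    rw [Padic.norm_eq_zpow_neg_valuation (Nat.cast_ne_zero.mpr hm), Padic.valuation_natCast]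
  have h1 : ‖(a / b : ℚ_[p])‖ ≤ 1 := by
    rw [norm_div, hnorm ha, hnorm hb, h, div_self]
    exact (zpow_pos (Nat.cast_pos.mpr (Fact.out : p.Prime).pos) _).ne'
  let z : ℤ_[p] := ⟨_, h1⟩
  refine ⟨algebraMap ℤ_[p] (padicIntegers F) z, ?_⟩
  change algebraMap ℚ_[p] F (a / b : ℚ_[p]) = _
  rw [map_div₀, map_natCast, map_natCast]

namespace Representation.IsCliffordPair

variable {k : Type*} [CommRing k] [IsDomain k] {F : Type*} [Field F] [CharZero F] [Algebra k F]
  [IsFractionRing k F] {p : ℕ} [Fact p.Prime] [TopologicalSpace k] [IsTopologicalRing k]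
  {G : Type*} [Group G] [TopologicalSpace G] [IsTopologicalGroup G] [CompactSpace G] [T2Space G]
  [TotallyDisconnectedSpace G] {H : Subgroup G} [H.Normal] [Fintype H]
  {V : Type*} [AddCommGroup V] [Module F V] [FiniteDimensional F V]
  {W : Type*} [AddCommGroup W] [Module F W] [FiniteDimensional F W]
  {σ : Representation F H W} {γ : G} {ρ : Representation F G V} {w d q : ℕ}

/-- The distinguished central unit of the block has the defining property of `γ_χ`. -/
theorem isGammaChi_unit (h : IsCliffordPair ρ σ γ w) (hγ : IsProcyclicComplement p H γ)
    (D : CliffordUnits k H γ w d q)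
    (hc : MonoidAlgebra.mapRingHom H (algebraMap k F) D.c = resInv ρ H w (ρ (γ ^ w)⁻¹))
    (he : MonoidAlgebra.mapRingHom H (algebraMap k F) D.idem = resInv ρ H w 1) :
    IsGammaChi H k ρ (resInv ρ H w 1) γ w (toFractions k (D.unit (of k G))) := by
  have hcomm := toFractions_commute k (D.unit_commute hγ)
  have hcomm' := toFractions_commute k (D.eps_commute (k := k) hγ)
  have heps : groupAlgebraToFractions k G F H (resInv ρ H w 1) =
      toFractions k (D.eps (of k G)) := by
    rw [← he, groupAlgebraToFractions_mapRingHom]; rfl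
  refine ⟨?_, fun y => hcomm _, γ ^ w, resInv ρ H w (ρ (γ ^ w)⁻¹), rfl,
    resInv_mul_one h.res_resInv_pow_inv,
    ⟨MonoidAlgebra.mapRingHom H (algebraMap k F) D.c', ?_, ?_, ?_⟩, ?_, ?_⟩
  · rw [heps, ← map_mul, D.unit_mul_eps]
  · rw [← he, ← map_mul]; exact congrArg _ D.c'_mul
  · rw [← hc, ← he, ← map_mul]; exact congrArg _ D.c_mul_c'
  · rw [← hc, ← he, ← map_mul]; exact congrArg _ D.c'_mul_c
  · rw [← hc, groupAlgebraToFractions_mapRingHom, ← map_mul]; rfl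
  · rw [h.res_resInv_pow_inv]
    change ρ (γ ^ w) * ρ (γ ^ w)⁻¹ = 1
    rw [← map_mul, mul_inv_cancel, map_one]

/-- Any admissible `gc` can be rewritten as `γ ^ w (sc)` with `s ∈ H`. The factor `sc` must act on
`V` as the inverse of `γ ^ w`, and it lies in the part of `F[H]` that acts faithfully, so it is
determined. -/
theorem eq_of_isGammaChi (h : IsCliffordPair ρ σ γ w)
    {x y : TotalFractions (CompletedGroupAlgebra k G)}
    (hx : IsGammaChi H k ρ (resInv ρ H w 1) γ w x)
    (hy : IsGammaChi H k ρ (resInv ρ H w 1) γ w y) : x = y := by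
  have key : ∀ z, IsGammaChi H k ρ (resInv ρ H w 1) γ w z →
      z = toFractions k (of k G (γ ^ w)) *
        groupAlgebraToFractions k G F H (resInv ρ H w (ρ (γ ^ w)⁻¹)) := by
    rintro z ⟨-, -, g, c, hg, hc, -, rfl, hρ⟩
    let s : H := ⟨(γ ^ w)⁻¹ * g, QuotientGroup.eq.mp hg.symm⟩
    have hgs : g = γ ^ w * s := (mul_inv_cancel_left _ _).symm
    have h1 : MonoidAlgebra.single s 1 * c = resInv ρ H w (ρ (γ ^ w)⁻¹) := by
      refine eq_of_res_eq (ρ := ρ) (w := w) (by rw [mul_assoc, hc])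
        (resInv_mul_one h.res_resInv_pow_inv) ?_
      rw [h.res_resInv_pow_inv, map_mul, res_single]
      have h2 : ρ (γ ^ w) * (ρ s * asAlgebraHom (ρ.comp H.subtype) c) = 1 := by
        rw [← mul_assoc, ← map_mul, ← hgs]; exact hρ
      calc _ = ρ (γ ^ w)⁻¹ * (ρ (γ ^ w) * (ρ s * asAlgebraHom (ρ.comp H.subtype) c)) := by
            rw [← mul_assoc (ρ (γ ^ w)⁻¹), ← map_mul, inv_mul_cancel, map_one, one_mul]
        _ = _ := by rw [h2, mul_one]
    rw [← h1, map_mul, groupAlgebraToFractions_single, map_one, one_mul, ← mul_assoc, ← map_mul,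
      ← map_mul, ← hgs]
  rw [key x hx, key y hy]

end Representation.IsCliffordPair

end

/-! ### Assembly of the block structure from a Clifford pair -/

noncomputable section

open CompletedGroupAlgebra IsLocalRing

namespace Representation.IsCliffordPair

variable {k : Type*} [CommRing k] [IsDomain k] [TopologicalSpace k] [IsTopologicalRing k]
  [CompactSpace k] [T2Space k] [TotallyDisconnectedSpace k]
  [IsDiscreteValuationRing k] [IsAdicComplete (maximalIdeal k) k]
  {F : Type*} [Field F] [CharZero F] [Algebra k F] [IsFractionRing k F] {p : ℕ} [Fact p.Prime]
  {G : Type*} [Group G] [TopologicalSpace G] [IsTopologicalGroup G] [CompactSpace G] [T2Space G]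
  [TotallyDisconnectedSpace G] {H : Subgroup G} [H.Normal] [Fintype H]
  {V : Type*} [AddCommGroup V] [Module F V] [FiniteDimensional F V]
  {W : Type*} [AddCommGroup W] [Module F W] [FiniteDimensional F W]
  {σ : Representation F H W} {γ : G} {ρ : Representation F G V} {w : ℕ}

/-- The structure of the block of `k[[G]]` cut out by the Clifford pair `ρ`, `σ` when the degree
of `σ` and the order of `H` differ by a unit of `k`. -/
theorem exists_block_structure (h : IsCliffordPair ρ σ γ w) (hγ : IsProcyclicComplement p H γ)
    (hpk : (p : k) ∈ maximalIdeal k) (hker : IsOpen (MonoidHom.ker ρ : Set G))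
    (hfin : (Set.range ρ).Finite)
    (hdeg : (Module.finrank F W : F) / Fintype.card H ∈ (algebraMap k F).range)
    {n : ℕ} (hn : γ ^ p ^ n ∈ Subgroup.center G) {m : ℕ} (hm : m = Module.finrank F V) :
    let R := CompletedGroupAlgebra k (centralClosure hn)
    let e := resInv ρ H w 1
    ∃ (ε : CompletedGroupAlgebra k G) (hε : IsIdempotentElem ε),
      toFractions k ε = groupAlgebraToFractions k G F H e ∧
      ε ∈ Subring.center (CompletedGroupAlgebra k G) ∧
    ∃ u : hε.Cornerˣ,
      IsGammaChi H k ρ e γ w (toFractions k u.1.1) ∧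
      (∀ x, IsGammaChi H k ρ e γ w x → x = toFractions k u.1.1) ∧
      (∃ j : CompletedGroupAlgebra k (closedSubgroupGenerated u) →ₐ[k] hε.Corner,
        Function.Injective j ∧ Continuous j ∧
        (∀ v : closedSubgroupGenerated u, j (of k _ v) = (v : hε.Cornerˣ)) ∧
        Set.range j = Set.center hε.Corner) ∧
      Nonempty (hε.Corner ≃ₐ[R] Matrix (Fin m) (Fin m) (Subalgebra.center R hε.Corner)) ∧
      IsMaximalROrder R (cornerMap (toFractions R : CompletedGroupAlgebra k G →ₐ[R] _) hε).range ∧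
      IsMaximalROrder R
        (AlgHom.mapMatrix (m := Fin m) (IsScalarTower.toAlgHom R (Subalgebra.center R hε.Corner)
          (FractionRing (Subalgebra.center R hε.Corner)))).range ∧
      Nonempty (hε.Corner ≃+* Matrix (Fin m) (Fin m) (PowerSeries k)) := by
  intro R e
  obtain ⟨N, hN⟩ := exists_openNormalSubgroup_le hker
  obtain ⟨a, ha⟩ := hγ.exists_pow_mem N
  -- The exponent `max a n` serves two purposes: `a` makes `γ ^ (w * q)` act trivially, so that `c`
  -- has finite order, and `n` makes the `q`-th power of the unit come from `Γ₀`.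
  have hq : ρ (γ ^ (w * p ^ max a n)) = 1 := by
    obtain ⟨s, hs⟩ := pow_dvd_pow p (le_max_left a n)
    have h1 : ρ (γ ^ p ^ a) = 1 := hN ha
    rw [hs, show w * (p ^ a * s) = p ^ a * (w * s) by ring, pow_mul, map_pow, h1, one_pow]
  obtain ⟨D, hDc, -, hDe⟩ := h.exists_cliffordUnits k hfin hdeg
    (pow_pos (Fact.out : p.Prime).pos _) hq
  have hε : IsIdempotentElem (D.eps (of k G)) := D.eps_mul_eps _
  have hc := D.eps_commute (k := k) hγ
  have hmul : ∀ x y : CompletedGroupAlgebra k G, x * y = D.eps (of k G) →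
      toCorner hε k hc x * toCorner hε k hc y = 1 := by
    intro x y hxy
    rw [← map_mul, hxy]
    exact Subtype.ext hε
  let u : hε.Cornerˣ := ⟨toCorner hε k hc (D.unit (of k G)), toCorner hε k hc (D.unitInv (of k G)),
    hmul _ _ (D.unit_mul_unitInv _), hmul _ _ (D.unitInv_mul_unit _)⟩
  have hu : u.1.1 = D.unit (of k G) := (hc _).eq.trans (D.unit_mul_eps _)
  have hΓχ := h.isGammaChi_unit hγ D hDc hDe
  refine ⟨D.eps (of k G), hε, ?_,
    Subring.mem_center_iff.mpr fun x => (hc x).eq.symm, u, ?_, fun x hx => ?_, ?_⟩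
  · change _ = groupAlgebraToFractions k G F H (resInv ρ H w 1)
    rw [← hDe, groupAlgebraToFractions_mapRingHom]; rfl
  · rw [hu]; exact hΓχ
  · rw [hu]; exact h.eq_of_isGammaChi hx hΓχ
  · exact D.block_structure hγ hpk h.pos hn rfl (le_max_right a n) hε (hm.trans h.finrank_eq) hu

end Representation.IsCliffordPair

end

theorem proposition3p3
    -- an odd prime and a profinite group `G = H ⋊ Γ` with `H` finite and `Γ ≃ ℤ_p`
    {p : ℕ} [Fact p.Prime] (hp : p ≠ 2)
    {G : Type*} [Group G] [TopologicalSpace G] [IsTopologicalGroup G] [CompactSpace G] [T2Space G]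
    [TotallyDisconnectedSpace G]
    (H Γ : Subgroup G) [H.Normal] [Fintype H] (hΓ : Nonempty (Γ ≃ₜ* Multiplicative ℤ_[p]))
    (hHΓ : Subgroup.IsComplement' H Γ)
    -- a topological generator `γ` of `Γ`, and `n` such that `γ ^ p ^ n` is central
    (γ : G) (hγ : (Subgroup.zpowers γ).topologicalClosure = Γ)
    (n : ℕ) (hn : γ ^ p ^ n ∈ Subgroup.center G)
    -- `χ ∈ Irr(G)` and an irreducible constituent `η` of its restriction to `H`
    (χ : G → PadicAlgCl p) (hχ : IsIrrCharacter χ)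
    (η : H → PadicAlgCl p) (hη : IsConstituent H χ η)
    -- a finite extension `F` of `ℚ_p` over which `χ` and `η` have realisations
    (F : IntermediateField ℚ_[p] (PadicAlgCl p)) [FiniteDimensional ℚ_[p] F]
    {V : Type*} [AddCommGroup V] [Module F V] [FiniteDimensional F V]
    (ρ : Representation F G V) (hρ : ρ.Affords χ) (hηF : IsRealisableOver F η)
    -- `m = χ(1)`, `d = η(1)` and `v_p(η(1)) = v_p(|H|)`
    (m d : ℕ) (hm : χ 1 = m) (hd : η 1 = d) (hv : padicValNat p d = padicValNat p (Nat.card H)) :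
    let 𝒪 := padicIntegers F
    let Λ := CompletedGroupAlgebra 𝒪 G
    let R := CompletedGroupAlgebra 𝒪 (centralClosure hn)
    let w := (characterStabilizer H η).index
    -- the idempotent `e_χ` has coefficients in `F`
    ∃ e : MonoidAlgebra F H,
      MonoidAlgebra.mapRingHom H (algebraMap F (PadicAlgCl p)) e = chiIdempotent H χ ∧
    -- and it belongs to `Λ`, in which it is a central idempotent `ε`; `Λe_χ` is `hε.Corner`
    ∃ (ε : Λ) (hε : IsIdempotentElem ε),
      toFractions 𝒪 ε = groupAlgebraToFractions 𝒪 G F H e ∧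
      ε ∈ Subring.center Λ ∧
    -- the element `γ_χ` exists, is unique, and is a unit `u` of `Λe_χ`
    ∃ u : hε.Cornerˣ,
      IsGammaChi H 𝒪 ρ e γ w (toFractions 𝒪 u.1.1) ∧
      (∀ x, IsGammaChi H 𝒪 ρ e γ w x → x = toFractions 𝒪 u.1.1) ∧
    -- `𝒪[[Γ_χ]]` embeds into `Λe_χ`, continuously and extending the inclusion of `Γ_χ`, and its
    -- image is the centre of `Λe_χ`
      (∃ j : CompletedGroupAlgebra 𝒪 (closedSubgroupGenerated u) →ₐ[𝒪] hε.Corner,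
        Function.Injective j ∧ Continuous j ∧
        (∀ v : closedSubgroupGenerated u, j (CompletedGroupAlgebra.of 𝒪 _ v) = (v : hε.Cornerˣ)) ∧
        Set.range j = Set.center hε.Corner) ∧
    -- `Λe_χ` is isomorphic as an `R`-order to the ring of `m × m` matrices over this centre
      Nonempty (hε.Corner ≃ₐ[R] Matrix (Fin m) (Fin m) (Subalgebra.center R hε.Corner)) ∧
    -- `Λe_χ` is a maximal `R`-order in `Q(G)e_χ`, and so is the matrix ring in the matrix ring over
    -- the field of fractions of the centre
      IsMaximalROrder R (cornerMap (toFractions R : Λ →ₐ[R] TotalFractions Λ) hε).range ∧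
      IsMaximalROrder R
        (AlgHom.mapMatrix (m := Fin m) (IsScalarTower.toAlgHom R (Subalgebra.center R hε.Corner)
          (FractionRing (Subalgebra.center R hε.Corner)))).range ∧
    -- both are isomorphic as rings to the ring of `m × m` matrices over `𝒪[[T]]`
      Nonempty (hε.Corner ≃+* Matrix (Fin m) (Fin m) (PowerSeries 𝒪)) := by
  intro 𝒪 Λ R w
  have hγ' := isProcyclicComplement hΓ hHΓ hγ
  obtain ⟨d', σ, hσ⟩ := hηF
  have hC := Representation.isCliffordPair hγ' hχ hη hρ hσ
  have hd' : Module.finrank F (Fin d' → F) = d := by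
    have h1 := hσ.2 1
    rw [Representation.char_one, map_natCast, hd] at h1
    exact_mod_cast h1
  have hm' : m = Module.finrank F V := by
    have h1 := hρ.2 1
    rw [Representation.char_one, map_natCast, hm] at h1
    exact_mod_cast h1.symm
  -- The valuation hypothesis enters here and supplies the integrality of `η(1)/|H|`.
  have hdeg : (Module.finrank F (Fin d' → F) : F) / Fintype.card H ∈
      (algebraMap (padicIntegers F) F).range := by
    have := hC.scalar'.1
    refine padicIntegers.natCast_div_mem_range F Module.finrank_pos.ne' Fintype.card_ne_zero ?_
    rw [hd', hv, Nat.card_eq_fintype_card]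
  exact ⟨_, Representation.mapRingHom_resInv_one hγ' hχ hη hρ hσ,
    hC.exists_block_structure hγ' (padicIntegers.p_mem_maximalIdeal F) hρ.1 hρ.finite_range hdeg
      hn hm'⟩
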